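/- Let $M$ be a smooth manifold and let $(A,[\cdot,\cdot],\rho)$ be a Lie algebroid over $M$ with differential $d$ and Lie derivative $\mathcal L$. For $\pi\in\Gamma(\bigwedge^2A)$ write $\pi^\sharp\alpha=\pi(\alpha,\cdot)$ for $\alpha\in\Gamma(A^*)$, and $$[\alpha,\beta]_\pi=\mathcal L_{\pi^\sharp\alpha}\beta-\mathcal L_{\pi^\sharp\beta}\alpha-d(\pi(\alpha,\beta)),\qquad \rho_\pi=\rho\circ\pi^\sharp ;$$ write $A^*_\pi$ for $A^*$ with this bracket and anchor. For $N\in\Gamma(A\otimes A^*)=\mathrm{End}(A)$ put $$[X,Y]_N=[NX,Y]+[X,NY]-N[X,Y],\qquad \rho_N=\rho\circ N,\qquad T_N(X,Y)=[NX,NY]-N[X,Y]_N,$$ let $d_N$ be the degree one derivation of $\Gamma(\bigwedge^\bullet A^*)$ given by the Koszul formula for $([\cdot,\cdot]_N,\rho_N)$, and let $C_{\pi,N}=([\cdot,\cdot]_N)_\pi-([\cdot,\cdot]_\pi)_{{}^tN}$. For a $3$-form $H$ let $i_{X\wedge Y}H=H(X,Y,\cdot)$, $(i_NH)(X,Y,Z)=H(NX,Y,Z)+H(X,NY,Z)+H(X,Y,NZ)$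 and $\mathcal H(X,Y,Z)=H(NX,NY,Z)+H(NY,NZ,X)+H(NZ,NX,Y)$. A Poisson quasi-Nijenhuis structure with background on $A$ is a quadruple $(\pi,N,\psi,H)$ with $\pi\in\Gamma(\bigwedge^2A)$, $N\in\Gamma(A\otimes A^*)$, $\psi,H\in\Gamma(\bigwedge^3A^*)$ such that $N\circ\pi^\sharp=\pi^\sharp\circ{}^tN$, $d\psi=0$, $dH=0$, $\pi$ is Poisson (its Schouten–Nijenhuis bracket $[\pi,\pi]$ vanishes), and for all $X,Y\in\Gamma(A)$, $\alpha,\beta\in\Gamma(A^*)$ $$C_{\pi,N}(\alpha,\beta)=-2\,i_{\pi^\sharp\alpha\wedge\pi^\sharp\beta}H,\qquad T_N(X,Y)=\pi^\sharp\bigl(i_{NX\wedge Y}H-i_{NY\wedge X}H+i_{X\wedge Y}\psi\bigr),\qquad d_N\psi=d\mathcal H .$$ A Lie quasi-bialgebroid is a triple $(B,\delta,\varphi)$ where $B$ is a Lie algebroid, $\delta$ is a degree one derivation of the Gerstenhaber algebra $(\Gamma(\bigwedge^\bullet B),\wedge,[\cdot,\cdot])$, that is, $\delta(P\wedge Q)=\delta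 P\wedge Q+(-1)^pP\wedge\delta Q$ and $\delta[P,Q]=[\delta P,Q]+(-1)^{p-1}[P,\delta Q]$ for $P$ of degree $p$, and $\varphi\in\Gamma(\bigwedge^3B)$ satisfies $\delta^2=[\varphi,\cdot]$ and $\delta\varphi=0$. **Theorem.** If $(\pi,N,\psi,H)$ is a Poisson quasi-Nijenhuis structure with background on $A$, then $(A^*_\pi,\;d_N^H,\;\psi+i_NH)$ is a Lie quasi-bialgebroid, where $d_N^H$ is the degree one derivation of $(\Gamma(\bigwedge^\bullet A^*),\wedge)$ with $d_N^Hf=d_Nf$ for $f\in C^\infty(M)$ and $d_N^H\alpha=d_N\alpha-i_{\pi^\sharp\alpha}H$ for $\alpha\in\Gamma(A^*)$. -/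

import Mathlib

open scoped Manifold ContDiff DirectSum

noncomputable section

/-! ### Sections of a smooth vector bundle as a module over the smooth functions -/

section Sections

variable {EM : Type*} [NormedAddCommGroup EM] [NormedSpace ℝ EM]
  {M : Type*} [TopologicalSpace M] [ChartedSpace EM M]
  {F : Type*} [NormedAddCommGroup F] [NormedSpace ℝ F]
  {E : M → Type*} [TopologicalSpace (Bundle.TotalSpace F E)]
  [∀ x, AddCommGroup (E x)] [∀ x, Module ℝ (E x)] [∀ x, TopologicalSpace (E x)]
  [FiberBundle F E] [VectorBundle ℝ F E]

instance sectionSMul :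
    SMul C^∞⟮𝓘(ℝ, EM), M; 𝓘(ℝ), ℝ⟯ Cₛ^∞⟮𝓘(ℝ, EM); F, E⟯ where
  smul f s := ⟨fun x => f x • s x, f.contMDiff.smul_section s.contMDiff⟩

theorem section_smul_apply (f : C^∞⟮𝓘(ℝ, EM), M; 𝓘(ℝ), ℝ⟯)
    (s : Cₛ^∞⟮𝓘(ℝ, EM); F, E⟯) (x : M) : (f • s) x = f x • s x := rfl

instance sectionModule :
    Module C^∞⟮𝓘(ℝ, EM), M; 𝓘(ℝ), ℝ⟯ Cₛ^∞⟮𝓘(ℝ, EM); F, E⟯ where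
  one_smul s := by ext x; exact one_smul ℝ (s x)
  mul_smul f g s := by ext x; exact mul_smul (f x) (g x) (s x)
  smul_zero f := by ext x; exact smul_zero (f x)
  smul_add f s t := by ext x; exact smul_add (f x) (s x) (t x)
  add_smul f g s := by ext x; exact add_smul (f x) (g x) (s x)
  zero_smul s := by ext x; exact zero_smul ℝ (s x)

instance sectionScalarTower :
    IsScalarTower ℝ C^∞⟮𝓘(ℝ, EM), M; 𝓘(ℝ), ℝ⟯ Cₛ^∞⟮𝓘(ℝ, EM); F, E⟯ where
  smul_assoc c f s := by ext x; exact smul_assoc c (f x) (s x)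

end Sections

/-! ### The exterior algebra

`R` stands for `C^∞(M)` and `V` for the module `Γ(B)` of sections of a vector bundle `B`.  Sections
of `B*` are the `R`-linear maps `V → R`, and sections of `⋀^k B*` are the alternating `R`-multilinear
maps `V^k → R`.  Sections of `⋀^k B` are obtained by using `Γ(B*) = Module.Dual R V` instead of `V`.
-/

section Exterior

variable (R V : Type*) [CommRing R] [AddCommGroup V] [Module R V]

/-- Sections of `⋀^• B*`, where `V = Γ(B)`. -/
abbrev ExtForms : Type _ := ⨁ k : ℕ, V [⋀^Fin k]→ₗ[R] R

variable {R V}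

/-- A homogeneous element of degree `k`. -/
abbrev homog (k : ℕ) (η : V [⋀^Fin k]→ₗ[R] R) : ExtForms R V :=
  DirectSum.lof R ℕ (fun k => V [⋀^Fin k]→ₗ[R] R) k η

/-- A function, as an element of degree `0`. -/
def fn0 (f : R) : ExtForms R V := homog 0 (AlternatingMap.constOfIsEmpty R V (Fin 0) f)

/-- A section of `B*`, as an element of degree `1`. -/
def form1 (α : Module.Dual R V) : ExtForms R V :=
  homog 1 (AlternatingMap.ofSubsingleton R V R (0 : Fin 1) α)

/-- The wedge product of homogeneous elements (sum over shuffles). -/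
def wedgeHom (p q : ℕ) :
    (V [⋀^Fin p]→ₗ[R] R) →ₗ[R] (V [⋀^Fin q]→ₗ[R] R) →ₗ[R] (V [⋀^Fin (p + q)]→ₗ[R] R) :=
  TensorProduct.curry
    ((AlternatingMap.domDomCongrₗ R (finSumFinEquiv (m := p) (n := q))).toLinearMap ∘ₗ
      LinearMap.compAlternatingMapₗ R (LinearMap.mul' R R) ∘ₗ
      AlternatingMap.domCoprod')

/-- The wedge product. -/
def wedge : ExtForms R V →ₗ[R] ExtForms R V →ₗ[R] ExtForms R V :=
  DirectSum.toModule R ℕ _ fun p =>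
    (DirectSum.toModule R ℕ _ fun q =>
      ((wedgeHom p q).compr₂ (DirectSum.lof R ℕ (fun k => V [⋀^Fin k]→ₗ[R] R) (p + q))).flip).flip

/-- `i_N η`, that is `(X₁, …, X_k) ↦ ∑ᵢ η(X₁, …, N Xᵢ, …, X_k)`. -/
def insertEnd {k : ℕ} (N : V →ₗ[R] V) (η : V [⋀^Fin k]→ₗ[R] R) : V [⋀^Fin k]→ₗ[R] R where
  toMultilinearMap := ∑ i : Fin k,
    η.toMultilinearMap.compLinearMap fun j => if j = i then N else LinearMap.id
  map_eq_zero_of_eq' v i j hv hij := by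
    simp only [MultilinearMap.toFun_eq_coe, sum_apply,
      MultilinearMap.compLinearMap_apply, AlternatingMap.coe_multilinearMap]
    rw [Finset.sum_eq_add i j hij]
    · rw [← η.map_swap_add _ hij, add_comm]
      congr 2
      funext m
      by_cases h1 : m = i
      · subst h1; simp [hv, hij, hij.symm, Equiv.swap_apply_left]
      · by_cases h2 : m = j
        · subst h2; simp [hv, Equiv.swap_apply_right]
        · simp [Equiv.swap_apply_of_ne_of_ne h1 h2, h1, h2]
    · rintro c - ⟨h1, h2⟩
      exact η.map_eq_zero_of_eq _ (by simp [h1.symm, h2.symm, hv]) hij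
    · simp
    · simp

theorem insertEnd_apply {k : ℕ} (N : V →ₗ[R] V) (η : V [⋀^Fin k]→ₗ[R] R) (X : Fin k → V) :
    insertEnd N η X = ∑ i, η (Function.update X i (N (X i))) := by
  change (∑ i : Fin k, η.toMultilinearMap.compLinearMap
    fun j => if j = i then N else LinearMap.id) X = _
  simp only [sum_apply, MultilinearMap.compLinearMap_apply,
    AlternatingMap.coe_multilinearMap]
  refine Finset.sum_congr rfl fun i _ => congrArg η (funext fun j => ?_)
  by_cases h : j = i
  · subst h; simp
  · simp [h]

/-- `i_{X∧Y} η = η(X, Y, ·)` for a `3`-form `η`. -/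
def contract2 (η : V [⋀^Fin 3]→ₗ[R] R) (X Y : V) : Module.Dual R V where
  toFun Z := η ![X, Y, Z]
  map_add' Z Z' := by
    have h := η.map_update_add ![X, Y, 0] 2 Z Z'
    have e : ∀ W, Function.update ![X, Y, 0] 2 W = ![X, Y, W] := fun W => by
      ext i; fin_cases i <;> rfl
    simpa only [e] using h
  map_smul' c Z := by
    have h := η.map_update_smul ![X, Y, 0] 2 c Z
    have e : ∀ W, Function.update ![X, Y, 0] 2 W = ![X, Y, W] := fun W => by
      ext i; fin_cases i <;> rfl
    simpa only [e, RingHom.id_apply] using h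

variable (R V)

/-- A section `π` of `⋀² A`, where `V = Γ(A)`: an alternating bilinear map on `Γ(A*)`, together with
the (uniquely determined) map `π♯ : Γ(A*) → Γ(A)`, `π♯ α = π(α, ·)`. -/
structure Bivector where
  toForm : Module.Dual R V [⋀^Fin 2]→ₗ[R] R
  sharp : Module.Dual R V →ₗ[R] V
  apply_sharp : ∀ α β : Module.Dual R V, β (sharp α) = toForm ![α, β]

variable {R V}

theorem Bivector.apply_sharp_self (π : Bivector R V) (α : Module.Dual R V) :
    α (π.sharp α) = 0 := by
  rw [π.apply_sharp]
  exact π.toForm.map_eq_zero_of_eq _ (i := 0) (j := 1) rfl (by decide)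

theorem Bivector.apply_sharp_swap (π : Bivector R V) (α β : Module.Dual R V) :
    α (π.sharp β) = - β (π.sharp α) := by
  have h := π.apply_sharp_self (α + β)
  simp only [map_add, LinearMap.add_apply, π.apply_sharp_self] at h
  linear_combination h

end Exterior

/-! ### Lie algebroids -/

/-- A skew-symmetric bracket on `Γ(B)` together with an anchor `Γ(B) → 𝔛(M) = Der C^∞(M)`, related by
the Leibniz rule.  It is a Lie algebroid structure if `AlmostLieAlgebroid.IsLie` holds. -/
structure AlmostLieAlgebroid (R B : Type*) [CommRing R] [Algebra ℝ R] [AddCommGroup B] [Module R B]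
    [Module ℝ B] [IsScalarTower ℝ R B] where
  bracket : B →ₗ[ℝ] B →ₗ[ℝ] B
  anchor : B →ₗ[R] Derivation ℝ R R
  bracket_self : ∀ X, bracket X X = 0
  leibniz : ∀ (X Y : B) (f : R), bracket X (f • Y) = f • bracket X Y + anchor X f • Y

namespace AlmostLieAlgebroid

variable {R B : Type*} [CommRing R] [Algebra ℝ R] [AddCommGroup B] [Module R B]
  [Module ℝ B] [IsScalarTower ℝ R B]

/-- The Lie algebroid axioms: the Jacobi identity, and the anchor preserves brackets. -/
structure IsLie (A : AlmostLieAlgebroid R B) : Prop where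
  jacobi : ∀ X Y Z, A.bracket X (A.bracket Y Z) =
    A.bracket (A.bracket X Y) Z + A.bracket Y (A.bracket X Z)
  anchor_bracket : ∀ X Y, A.anchor (A.bracket X Y) = ⁅A.anchor X, A.anchor Y⁆

theorem bracket_swap (A : AlmostLieAlgebroid R B) (X Y : B) :
    A.bracket X Y = - A.bracket Y X := by
  have h := A.bracket_self (X + Y)
  simp only [map_add, LinearMap.add_apply, A.bracket_self, zero_add, add_zero] at h
  exact eq_neg_of_add_eq_zero_right h

/-- The differential of a `k`-form `η`, evaluated on `k + 1` sections:
`∑ᵢ (-1)ⁱ ρ(Xᵢ) η(…, X̂ᵢ, …) + ∑_{i<j} (-1)^(i+j) η([Xᵢ, Xⱼ], …, X̂ᵢ, …, X̂ⱼ, …)`.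
In the code `[Xᵢ, Xⱼ]` stands at the place of `Xⱼ`, which changes `(-1)^(i+j)` to `-(-1)ⁱ`. -/
def diff (A : AlmostLieAlgebroid R B) {k : ℕ} (η : (Fin k → B) → R) (X : Fin (k + 1) → B) : R :=
  ∑ i : Fin (k + 1), (-1 : R) ^ (i : ℕ) *
    (A.anchor (X i) (η (i.removeNth X)) -
      ∑ j ∈ Finset.Ioi i, η (i.removeNth (Function.update X j (A.bracket (X i) (X j)))))

/-- The differential of a function, `df(X) = ρ(X) f`. -/
def diffFn (A : AlmostLieAlgebroid R B) (f : R) : Module.Dual R B where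
  toFun X := A.anchor X f
  map_add' X Y := by simp
  map_smul' c X := by simp

/-- The Lie derivative of a `1`-form, `(L_X β)(Y) = ρ(X)(β(Y)) - β([X, Y])`. -/
def lieDer (A : AlmostLieAlgebroid R B) (X : B) (β : Module.Dual R B) : Module.Dual R B where
  toFun Y := A.anchor X (β Y) - β (A.bracket X Y)
  map_add' Y Z := by simp only [map_add]; ring
  map_smul' c Y := by
    simp only [map_smul, smul_eq_mul, Derivation.leibniz, A.leibniz, map_add, RingHom.id_apply]
    ring

/-- The structure `[X, Y]_N = [NX, Y] + [X, NY] - N[X, Y]`, `ρ_N = ρ ∘ N`. -/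
def deform (A : AlmostLieAlgebroid R B) (N : B →ₗ[R] B) : AlmostLieAlgebroid R B where
  bracket := LinearMap.mk₂ ℝ
    (fun X Y => A.bracket (N X) Y + A.bracket X (N Y) - N (A.bracket X Y))
    (fun X X' Y => by simp only [map_add, LinearMap.add_apply]; abel)
    (fun c X Y => by
      simp only [LinearMap.map_smul_of_tower, map_smul, LinearMap.smul_apply, smul_add, smul_sub])
    (fun X Y Y' => by simp only [map_add]; abel)
    (fun c X Y => by
      simp only [LinearMap.map_smul_of_tower, map_smul, smul_add, smul_sub])
  anchor := A.anchor ∘ₗ N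
  bracket_self X := by
    rw [LinearMap.mk₂_apply, A.bracket_self, A.bracket_swap X (N X)]; simp
  leibniz X Y f := by
    simp only [LinearMap.mk₂_apply, A.leibniz, map_smul, map_add, LinearMap.comp_apply, smul_sub,
      smul_add]
    abel

/-- The Nijenhuis torsion `T_N(X, Y) = [NX, NY] - N([NX, Y] + [X, NY] - N[X, Y])`. -/
def torsion (A : AlmostLieAlgebroid R B) (N : B →ₗ[R] B) (X Y : B) : B :=
  A.bracket (N X) (N Y) - N (A.bracket (N X) Y + A.bracket X (N Y) - N (A.bracket X Y))

/-- The structure on the dual bundle `A*` given by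
`[α, β]_π = L_{π♯α} β - L_{π♯β} α - d(π(α, β))`, `ρ_π = ρ ∘ π♯`. -/
def cotangent (A : AlmostLieAlgebroid R B) (π : Bivector R B) :
    AlmostLieAlgebroid R (Module.Dual R B) where
  bracket := LinearMap.mk₂ ℝ
    (fun α β => A.lieDer (π.sharp α) β - A.lieDer (π.sharp β) α - A.diffFn (π.toForm ![α, β]))
    (fun α α' β => by
      ext Y
      simp only [← π.apply_sharp, lieDer, diffFn, LinearMap.sub_apply, LinearMap.coe_mk,
        AddHom.coe_mk, map_add, LinearMap.add_apply, Derivation.add_apply]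
      ring)
    (fun c α β => by
      ext Y
      simp only [← π.apply_sharp, lieDer, diffFn, LinearMap.sub_apply, LinearMap.coe_mk,
        AddHom.coe_mk, LinearMap.map_smul_of_tower, LinearMap.smul_apply, Derivation.smul_apply,
        Derivation.map_smul, smul_sub])
    (fun α β β' => by
      ext Y
      simp only [← π.apply_sharp, lieDer, diffFn, LinearMap.sub_apply, LinearMap.coe_mk,
        AddHom.coe_mk, map_add, LinearMap.add_apply, Derivation.add_apply]
      ring)
    (fun c α β => by
      ext Y
      simp only [← π.apply_sharp, lieDer, diffFn, LinearMap.sub_apply, LinearMap.coe_mk,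
        AddHom.coe_mk, LinearMap.map_smul_of_tower, LinearMap.smul_apply, Derivation.smul_apply,
        Derivation.map_smul, smul_sub])
  anchor := A.anchor ∘ₗ π.sharp
  bracket_self α := by
    ext Y
    simp [LinearMap.mk₂_apply, ← π.apply_sharp, π.apply_sharp_self, diffFn]
  leibniz α β f := by
    ext Y
    simp only [LinearMap.mk₂_apply, ← π.apply_sharp, lieDer, diffFn, LinearMap.sub_apply,
      LinearMap.coe_mk, AddHom.coe_mk, LinearMap.smul_apply, LinearMap.add_apply, map_smul,
      smul_eq_mul, Derivation.smul_apply, Derivation.leibniz, LinearMap.comp_apply]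
    rw [A.bracket_swap (f • π.sharp β) Y, A.leibniz, A.bracket_swap Y (π.sharp β)]
    simp only [map_neg, map_add, map_smul, smul_eq_mul, smul_neg, π.apply_sharp_swap α β]
    ring

/-- `C_{π,N} = ([·,·]_N)_π - ([·,·]_π)_{ᵗN}`. -/
def concomitant (A : AlmostLieAlgebroid R B) (π : Bivector R B) (N : B →ₗ[R] B)
    (α β : Module.Dual R B) : Module.Dual R B :=
  ((A.deform N).cotangent π).bracket α β - ((A.cotangent π).deform N.dualMap).bracket α β

end AlmostLieAlgebroid

/-! ### Schouten brackets, Poisson bivectors and Lie quasi-bialgebroids -/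

section Schouten

variable {R B C : Type*} [CommRing R] [Algebra ℝ R] [AddCommGroup B] [Module R B]
  [Module ℝ B] [IsScalarTower ℝ R B] [AddCommGroup C] [Module R C]

/-- `br` is the Schouten bracket of the algebroid `A` with sections `B`, that is, the bracket of the
Gerstenhaber algebra `Γ(⋀^• A)`.  Here `C` is the module of sections of the dual bundle, and `pair`
is the pairing, so that `Γ(⋀^• A) = ExtForms R C`.  The Schouten bracket is the unique graded
skew-symmetric `ℝ`-bilinear operation of degree `-1` which is a graded derivation of the wedge
product in each argument and extends the bracket of sections and the anchor; it satisfies the graded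
Jacobi identity when `A` is a Lie algebroid. -/
structure IsSchoutenBracket (A : AlmostLieAlgebroid R B) (pair : B →ₗ[R] Module.Dual R C)
    (br : ExtForms R C →ₗ[ℝ] ExtForms R C →ₗ[ℝ] ExtForms R C) : Prop where
  degree : ∀ (p q : ℕ) (P : C [⋀^Fin p]→ₗ[R] R) (Q : C [⋀^Fin q]→ₗ[R] R) (n : ℕ),
    n + 1 ≠ p + q → br (homog p P) (homog q Q) n = 0
  skew : ∀ (p q : ℕ) (P : C [⋀^Fin p]→ₗ[R] R) (Q : C [⋀^Fin q]→ₗ[R] R),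
    br (homog p P) (homog q Q) =
      -((-1 : ℝ) ^ ((p + 1) * (q + 1)) • br (homog q Q) (homog p P))
  leibniz : ∀ (p q : ℕ) (P : C [⋀^Fin p]→ₗ[R] R) (Q : C [⋀^Fin q]→ₗ[R] R) (S : ExtForms R C),
    br (homog p P) (wedge (homog q Q) S) =
      wedge (br (homog p P) (homog q Q)) S +
        (-1 : ℝ) ^ ((p + 1) * q) • wedge (homog q Q) (br (homog p P) S)
  sections : ∀ X Y : B,
    br (form1 (pair X)) (form1 (pair Y)) = form1 (pair (A.bracket X Y))
  function : ∀ (X : B) (f : R), br (form1 (pair X)) (fn0 f) = fn0 (A.anchor X f)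

/-- `π` is a Poisson bivector: `[π, π] = 0` for the Schouten-Nijenhuis bracket on `Γ(⋀^• A)`. -/
def IsPoisson (A : AlmostLieAlgebroid R B) (π : Bivector R B) : Prop :=
  ∃ br : ExtForms R (Module.Dual R B) →ₗ[ℝ] ExtForms R (Module.Dual R B) →ₗ[ℝ]
      ExtForms R (Module.Dual R B),
    IsSchoutenBracket A (Module.Dual.eval R B) br ∧ br (homog 2 π.toForm) (homog 2 π.toForm) = 0

/-- `δ` is a degree one derivation of the wedge product. -/
structure IsDegreeOneDerivation (δ : ExtForms R C →ₗ[ℝ] ExtForms R C) : Prop where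
  degree : ∀ (p : ℕ) (P : C [⋀^Fin p]→ₗ[R] R) (n : ℕ), n ≠ p + 1 → δ (homog p P) n = 0
  leibniz : ∀ (p : ℕ) (P : C [⋀^Fin p]→ₗ[R] R) (S : ExtForms R C),
    δ (wedge (homog p P) S) =
      wedge (δ (homog p P)) S + (-1 : ℝ) ^ p • wedge (homog p P) (δ S)

/-- `(A, δ, φ)` is a Lie quasi-bialgebroid: `A` is a Lie algebroid, `δ` is a degree one derivation of
the Gerstenhaber algebra `(Γ(⋀^• A), ∧, [·,·])`, `δ² = [φ, ·]` and `δ φ = 0`. -/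
structure IsLieQuasiBialgebroid (A : AlmostLieAlgebroid R B) (pair : B →ₗ[R] Module.Dual R C)
    (δ : ExtForms R C →ₗ[ℝ] ExtForms R C) (φ : C [⋀^Fin 3]→ₗ[R] R) : Prop where
  isLie : A.IsLie
  derivation : IsDegreeOneDerivation δ
  bracket : ∃ br : ExtForms R C →ₗ[ℝ] ExtForms R C →ₗ[ℝ] ExtForms R C,
    IsSchoutenBracket A pair br ∧
    (∀ (p : ℕ) (P : C [⋀^Fin p]→ₗ[R] R) (S : ExtForms R C),
      δ (br (homog p P) S) =
        br (δ (homog p P)) S + (-1 : ℝ) ^ (p + 1) • br (homog p P) (δ S)) ∧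
    ∀ S : ExtForms R C, δ (δ S) = br (homog 3 φ) S
  closed : δ (homog 3 φ) = 0

/-- `(π, N, ψ, H)` is a Poisson quasi-Nijenhuis structure with background on `A`. -/
structure IsPoissonQuasiNijenhuis (A : AlmostLieAlgebroid R B) (π : Bivector R B)
    (N : B →ₗ[R] B) (ψ H : B [⋀^Fin 3]→ₗ[R] R) : Prop where
  comm : N ∘ₗ π.sharp = π.sharp ∘ₗ N.dualMap
  closed_psi : ∀ X, A.diff ψ X = 0
  closed_H : ∀ X, A.diff H X = 0
  poisson : IsPoisson A π
  concomitant : ∀ α β : Module.Dual R B,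
    A.concomitant π N α β = -(2 : R) • contract2 H (π.sharp α) (π.sharp β)
  torsion : ∀ X Y : B, A.torsion N X Y =
    π.sharp (contract2 H (N X) Y - contract2 H (N Y) X + contract2 ψ X Y)
  diff_psi : ∀ X, (A.deform N).diff ψ X =
    A.diff (fun Y : Fin 3 → B =>
      H ![N (Y 0), N (Y 1), Y 2] + H ![N (Y 1), N (Y 2), Y 0] + H ![N (Y 2), N (Y 0), Y 1]) X

/-- `δ = d_N^H`: the degree one derivation of `Γ(⋀^• A*)` with `δ f = d_N f` on functions and
`δ α = d_N α - i_{π♯α} H` on sections `α` of `A*`. -/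
structure IsTwistedDifferential (A : AlmostLieAlgebroid R B) (π : Bivector R B)
    (N : B →ₗ[R] B) (H : B [⋀^Fin 3]→ₗ[R] R) (δ : ExtForms R B →ₗ[ℝ] ExtForms R B) : Prop where
  derivation : IsDegreeOneDerivation δ
  function : ∀ f : R, δ (fn0 f) = form1 ((A.deform N).diffFn f)
  one_form : ∀ (α : Module.Dual R B) (X Y : B),
    δ (form1 α) 2 ![X, Y] =
      (A.deform N).diff (fun Z : Fin 1 → B => α (Z 0)) ![X, Y] - H ![π.sharp α, X, Y]

end Schouten

end

/-!
The bracket of `A*_π` extends to forms as a derived bracket,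
`[P, Q]_π = d(P, Q) + (d P, Q) - (ε P, d Q)`, where `d` is the Koszul differential of `A`, `(·, ·)`
is the pairing of degree `-2` that extends `π` as a graded derivation in each argument, and `ε` is
the grading involution. The operator `d_N^H` is itself a Koszul differential, that of the bracket
`[X, Y]_N - π♯ H(X, Y, ·)` with anchor `ρ ∘ N`, which need not satisfy the Jacobi identity.

The failure of `d_N^H` to be a derivation of `[·, ·]_π`, and the difference
`(d_N^H)² - [ψ + i_N H, ·]_π`, are derivations of the wedge product. By Euler's formula in local
frames they vanish as soon as they vanish on functions and `1`-forms. There the first amounts to the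
concomitant condition together with `d H = 0`, and the second is the Jacobiator of the twisted
bracket, which the torsion condition, `d ψ = 0` and `d H = 0` compute. Finally
`d_N^H (ψ + i_N H)` is `d_N ψ - d 𝓗` plus six instances of `d H = 0`, plus terms quadratic in `H`
that cancel because `π♯` is skew.
-/

noncomputable section

/-! ### Interior product and wedge product -/

namespace ExtForms

section Contract

variable {R V : Type*} [CommRing R] [AddCommGroup V] [Module R V]

theorem homog_apply_self (k : ℕ) (η : V [⋀^Fin k]→ₗ[R] R) : homog k η k = η :=
  DirectSum.lof_apply (M := fun k => V [⋀^Fin k]→ₗ[R] R) R k η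

theorem homog_apply_of_ne {k n : ℕ} (h : k ≠ n) (η : V [⋀^Fin k]→ₗ[R] R) : homog k η n = 0 :=
  DirectSum.of_eq_of_ne (β := fun k => V [⋀^Fin k]→ₗ[R] R) k n η h.symm

theorem induction_homog {p : ExtForms R V → Prop} (θ : ExtForms R V)
    (homog : ∀ k η, p (homog k η)) (add : ∀ θ η, p θ → p η → p (θ + η)) : p θ := by
  induction θ using DirectSum.induction_on with
  | zero => simpa only [map_zero] using homog 0 0
  | of k η => exact homog k η
  | add θ η hθ hη => exact add θ η hθ hη

/-- The interior product of a `k`-form with a vector, as an element of the exterior algebra: this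
makes it `0` on functions, where there is no form of degree `k - 1`. -/
def contractHom : (k : ℕ) → V →ₗ[R] (V [⋀^Fin k]→ₗ[R] R) →ₗ[R] ExtForms R V
  | 0 => 0
  | k + 1 => (AlternatingMap.curryLeftLinearMap (R := R) (M := V) (N := R)).flip.compr₂
      (DirectSum.lof R ℕ (fun k => V [⋀^Fin k]→ₗ[R] R) k)

/-- The interior product `ι_X θ = θ(X, ·, …, ·)` on the exterior algebra. -/
def contract : V →ₗ[R] ExtForms R V →ₗ[R] ExtForms R V :=
  (DirectSum.toModule R ℕ _ fun k => (contractHom k).flip).flip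

theorem contract_homog_zero (X : V) (η : V [⋀^Fin 0]→ₗ[R] R) :
    contract X (homog 0 η) = 0 := by
  simp [contract, contractHom]

theorem contract_homog_succ (X : V) {k : ℕ} (η : V [⋀^Fin (k + 1)]→ₗ[R] R) :
    contract X (homog (k + 1) η) = homog k (η.curryLeft X) := by
  simp [contract, contractHom]

theorem contract_apply (X : V) (θ : ExtForms R V) (n : ℕ) :
    contract X θ n = (θ (n + 1)).curryLeft X := by
  induction θ using induction_homog with
  | homog k η =>
    cases k with
    | zero => rw [contract_homog_zero, homog_apply_of_ne (Nat.succ_ne_zero n).symm]; rfl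
    | succ k =>
      rw [contract_homog_succ]
      obtain rfl | h := eq_or_ne k n
      · rw [homog_apply_self, homog_apply_self]
      · rw [homog_apply_of_ne h, homog_apply_of_ne (by lia)]; rfl
  | add θ η hθ hη => simp only [map_add, DirectSum.add_apply, hθ, hη]; rfl

theorem contract_apply_apply (X : V) (θ : ExtForms R V) (n : ℕ) (v : Fin n → V) :
    contract X θ n v = θ (n + 1) (Matrix.vecCons X v) := by
  rw [contract_apply]; rfl

theorem contract_contract_self (X : V) (θ : ExtForms R V) : contract X (contract X θ) = 0 :=
  DFinsupp.ext fun n => by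
    rw [contract_apply, contract_apply]
    exact AlternatingMap.curryLeft_same _ _

theorem contract_contract (X Y : V) (θ : ExtForms R V) :
    contract X (contract Y θ) = -contract Y (contract X θ) := by
  have h := contract_contract_self (X + Y) θ
  simp only [map_add, LinearMap.add_apply, contract_contract_self, zero_add, add_zero] at h
  exact eq_neg_of_add_eq_zero_right h

theorem apply_succ_apply (θ : ExtForms R V) (n : ℕ) (v : Fin (n + 1) → V) :
    θ (n + 1) v = contract (v 0) θ n (Fin.tail v) := by
  rw [contract_apply_apply]
  exact congrArg _ (Fin.cons_self_tail v).symm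

theorem apply_succ_eq_of_contract {θ η : ExtForms R V} {n : ℕ}
    (h : ∀ X, contract X θ n = contract X η n) : θ (n + 1) = η (n + 1) := by
  ext v
  rw [apply_succ_apply, apply_succ_apply, h]

theorem ext_contract {θ η : ExtForms R V} (h0 : θ 0 = η 0)
    (h : ∀ X, contract X θ = contract X η) : θ = η :=
  DFinsupp.ext fun
    | 0 => h0
    | _ + 1 => apply_succ_eq_of_contract fun X => by rw [h]

/-- The grading involution `θ ↦ (-1)^k θ` on forms of degree `k`. -/
def parity : ExtForms R V →ₗ[R] ExtForms R V :=
  DirectSum.lmap fun k => ((-1 : R) ^ k) • LinearMap.id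

theorem parity_apply (θ : ExtForms R V) (n : ℕ) : parity θ n = (-1 : R) ^ n • θ n := rfl

theorem parity_parity (θ : ExtForms R V) : parity (parity θ) = θ := by
  refine DFinsupp.ext fun n => ?_
  rw [parity_apply, parity_apply, smul_smul, ← mul_pow, neg_one_mul, neg_neg, one_pow, one_smul]

theorem neg_component (θ : ExtForms R V) (n : ℕ) : (-θ) n = -(θ n) := rfl

theorem contract_parity (X : V) (θ : ExtForms R V) :
    contract X (parity θ) = -parity (contract X θ) := by
  refine DFinsupp.ext fun n => ?_
  rw [neg_component, contract_apply, parity_apply, parity_apply, contract_apply,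
    AlternatingMap.curryLeft_smul, LinearMap.smul_apply, pow_succ, mul_neg_one, neg_smul]

theorem parity_homog (k : ℕ) (η : V [⋀^Fin k]→ₗ[R] R) :
    parity (homog k η) = (-1 : R) ^ k • homog k η := by
  refine DFinsupp.ext fun n => ?_
  rw [parity_apply, DirectSum.smul_apply]
  obtain rfl | h := eq_or_ne k n
  · rfl
  · rw [homog_apply_of_ne h, smul_zero, smul_zero]

end Contract

section AltSum

open Equiv

variable {R V : Type*} [CommRing R]

/-- The signed sum of `m (v ∘ σ)` over all permutations `σ`. This is
`MultilinearMap.alternatization` without the requirement that `m` be bundled as a multilinear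
map. -/
def altSum {n : ℕ} (m : (Fin n → V) → R) (v : Fin n → V) : R :=
  ∑ σ : Perm (Fin n), ((Perm.sign σ : ℤ) : R) * m (v ∘ σ)

theorem altSum_mul_left {n : ℕ} (c : R) (m : (Fin n → V) → R) (v : Fin n → V) :
    altSum (fun u => c * m u) v = c * altSum m v := by
  simp only [altSum, Finset.mul_sum, mul_left_comm c]

/-- The permutation of `Fin (n + 1)` that sends `i` to `0` and acts as `e` between the complements:
these coset representatives expand a signed sum along its first argument. -/
def consPerm {n : ℕ} (x : Fin (n + 1) × Perm (Fin n)) : Perm (Fin (n + 1)) :=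
  Perm.decomposeFin.symm (0, x.2) * x.1.cycleRange

theorem consPerm_self {n : ℕ} (i : Fin (n + 1)) (e : Perm (Fin n)) : consPerm (i, e) i = 0 := by
  simp [consPerm]

theorem consPerm_succAbove {n : ℕ} (i : Fin (n + 1)) (e : Perm (Fin n)) (j : Fin n) :
    consPerm (i, e) (i.succAbove j) = (e j).succ := by
  simp [consPerm]

theorem sign_consPerm {n : ℕ} (i : Fin (n + 1)) (e : Perm (Fin n)) :
    Perm.sign (consPerm (i, e)) = (-1) ^ (i : ℕ) * Perm.sign e := by
  simp [consPerm, mul_comm]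

theorem vecCons_comp_consPerm {n : ℕ} (i : Fin (n + 1)) (e : Perm (Fin n)) (X : V)
    (w : Fin n → V) : Matrix.vecCons X w ∘ consPerm (i, e) = i.insertNth X (w ∘ e) := by
  funext k
  rcases Fin.eq_self_or_eq_succAbove i k with rfl | ⟨j, rfl⟩
  · simp [consPerm_self]
  · simp [consPerm_succAbove]

theorem consPerm_bijective (n : ℕ) : Function.Bijective (consPerm (n := n)) := by
  rw [Fintype.bijective_iff_injective_and_card]
  refine ⟨?_, by simp [Fintype.card_perm, Nat.factorial_succ]⟩
  rintro ⟨i, e⟩ ⟨i', e'⟩ h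
  obtain rfl : i = i' := (consPerm (i, e)).injective (by rw [consPerm_self, h, consPerm_self])
  refine Prod.ext rfl (Equiv.ext fun j => Fin.succ_injective _ ?_)
  rw [← consPerm_succAbove i, h, consPerm_succAbove]

theorem altSum_vecCons {n : ℕ} (m : (Fin (n + 1) → V) → R) (X : V) (w : Fin n → V) :
    altSum m (Matrix.vecCons X w) =
      ∑ i : Fin (n + 1), (-1 : R) ^ (i : ℕ) * altSum (fun u => m (i.insertNth X u)) w := by
  rw [altSum, ← (consPerm_bijective n).sum_comp, Fintype.sum_prod_type]
  refine Finset.sum_congr rfl fun i _ => ?_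
  rw [altSum, Finset.mul_sum]
  refine Finset.sum_congr rfl fun e _ => ?_
  rw [vecCons_comp_consPerm, sign_consPerm]
  push_cast
  ring

end AltSum

section InsertNth

variable {V : Type*}

theorem insertNth_mk_of_lt {n a k : ℕ} (ha : a < n + 1) (hk : k < a) (X : V) (u : Fin n → V) :
    (⟨a, ha⟩ : Fin (n + 1)).insertNth (α := fun _ => V) X u ⟨k, by lia⟩ = u ⟨k, by lia⟩ := by
  rw [Fin.insertNth_apply_below (Fin.mk_lt_mk.2 hk), eq_rec_constant]
  rfl

theorem insertNth_mk_of_le {n a k : ℕ} (hk : k < n) (ha : a ≤ k) (X : V) (u : Fin n → V) :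
    (⟨a, by lia⟩ : Fin (n + 1)).insertNth (α := fun _ => V) X u ⟨k + 1, by lia⟩ = u ⟨k, hk⟩ := by
  rw [Fin.insertNth_apply_above (Fin.mk_lt_mk.2 (by lia)), eq_rec_constant]
  rfl

theorem insertNth_mk_add {m n a : ℕ} (h : a + m ≤ n) (i : Fin (m + 1)) (X : V) (u : Fin n → V) :
    (fun k : Fin (m + 1) =>
      (⟨a + i, by lia⟩ : Fin (n + 1)).insertNth (α := fun _ => V) X u ⟨a + k, by lia⟩) =
      i.insertNth X fun k : Fin m => u ⟨a + k, by lia⟩ := by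
  funext ⟨k, hk⟩
  obtain ⟨i, hi⟩ := i
  obtain hki | rfl | hik := lt_trichotomy k i
  · rw [insertNth_mk_of_lt hi hki]
    exact insertNth_mk_of_lt _ (by lia) X u
  · rw [Fin.insertNth_apply_same, Fin.insertNth_apply_same]
  · obtain ⟨k, rfl⟩ := Nat.exists_eq_succ_of_ne_zero (Nat.ne_zero_of_lt hik)
    rw [insertNth_mk_of_le (Nat.lt_of_succ_lt_succ hk) (Nat.le_of_lt_succ hik)]
    exact insertNth_mk_of_le (by lia) (by lia) X u

end InsertNth

section Tensor

variable {R V : Type*} [CommRing R] [AddCommGroup V] [Module R V]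

/-- The product `P ⊗ Q` of two forms, before antisymmetrisation. The number `n = p + q` of arguments
is a separate variable, so that degrees can be rearranged without casts. -/
def tensor {p q n : ℕ} (h : p + q = n) (P : V [⋀^Fin p]→ₗ[R] R) (Q : V [⋀^Fin q]→ₗ[R] R)
    (u : Fin n → V) : R :=
  P (fun i => u ⟨i, by lia⟩) * Q (fun j => u ⟨p + j, by lia⟩)

theorem tensor_insertNth_left {p q n : ℕ} (h : p + q = n) (h' : p + 1 + q = n + 1)
    (P : V [⋀^Fin (p + 1)]→ₗ[R] R) (Q : V [⋀^Fin q]→ₗ[R] R) (i : Fin (p + 1)) (X : V)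
    (u : Fin n → V) :
    tensor h' P Q ((⟨i, by lia⟩ : Fin (n + 1)).insertNth (α := fun _ => V) X u) =
      (-1) ^ (i : ℕ) * tensor h (P.curryLeft X) Q u := by
  have hP := insertNth_mk_add (a := 0) (m := p) (n := n) (by lia) i X u
  simp only [zero_add] at hP
  have hQ (k : Fin q) : (⟨i, by lia⟩ : Fin (n + 1)).insertNth (α := fun _ => V) X u
      ⟨p + 1 + k, by lia⟩ = u ⟨p + k, by lia⟩ := by
    simp only [add_right_comm p 1]
    exact insertNth_mk_of_le (by lia) (by lia) X u
  rw [tensor, hP, P.map_insertNth, tensor]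
  simp only [hQ, AlternatingMap.curryLeft_apply_apply, zsmul_eq_mul, Int.cast_pow, Int.cast_neg,
    Int.cast_one, mul_assoc]

theorem tensor_insertNth_right {p q n : ℕ} (h : p + q = n) (h' : p + (q + 1) = n + 1)
    (P : V [⋀^Fin p]→ₗ[R] R) (Q : V [⋀^Fin (q + 1)]→ₗ[R] R) (i : Fin (q + 1)) (X : V)
    (u : Fin n → V) :
    tensor h' P Q ((⟨p + i, by lia⟩ : Fin (n + 1)).insertNth (α := fun _ => V) X u) =
      (-1) ^ (i : ℕ) * tensor h P (Q.curryLeft X) u := by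
  have hP (k : Fin p) : (⟨p + i, by lia⟩ : Fin (n + 1)).insertNth (α := fun _ => V) X u
      ⟨k, by lia⟩ = u ⟨k, by lia⟩ := insertNth_mk_of_lt _ (by lia) X u
  rw [tensor, insertNth_mk_add h.le, Q.map_insertNth, tensor]
  simp only [hP, AlternatingMap.curryLeft_apply_apply, zsmul_eq_mul, Int.cast_pow, Int.cast_neg,
    Int.cast_one, mul_left_comm]

theorem altSum_tensor_vecCons {p q n : ℕ} (h : p + q = n + 1) (P : V [⋀^Fin p]→ₗ[R] R)
    (Q : V [⋀^Fin q]→ₗ[R] R) (X : V) (w : Fin n → V) :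
    altSum (tensor h P Q) (Matrix.vecCons X w) =
      ∑ i : Fin p, (-1 : R) ^ (i : ℕ) * altSum (fun u => tensor h P Q
        ((⟨i, by lia⟩ : Fin (n + 1)).insertNth (α := fun _ => V) X u)) w +
      ∑ i : Fin q, (-1 : R) ^ (p + i : ℕ) * altSum (fun u => tensor h P Q
        ((⟨p + i, by lia⟩ : Fin (n + 1)).insertNth (α := fun _ => V) X u)) w := by
  rw [altSum_vecCons, ← (finCongr h).sum_comp, ← finSumFinEquiv.sum_comp, Fintype.sum_sum_type]
  simp only [finSumFinEquiv_apply_left, finSumFinEquiv_apply_right, finCongr_apply]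
  rfl

end Tensor

section Wedge

open Equiv
open scoped Nat

variable {R V : Type*} [CommRing R] [AddCommGroup V] [Module R V]

theorem wedge_homog (p q : ℕ) (P : V [⋀^Fin p]→ₗ[R] R) (Q : V [⋀^Fin q]→ₗ[R] R) :
    wedge (homog p P) (homog q Q) = homog (p + q) (wedgeHom p q P Q) := by
  simp [wedge]

theorem wedge_homog_apply_of_ne {p q n : ℕ} (h : p + q ≠ n) (P : V [⋀^Fin p]→ₗ[R] R)
    (Q : V [⋀^Fin q]→ₗ[R] R) : wedge (homog p P) (homog q Q) n = 0 := by
  rw [wedge_homog, homog_apply_of_ne h]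

theorem factorial_nsmul_wedgeHom (p q : ℕ) (P : V [⋀^Fin p]→ₗ[R] R) (Q : V [⋀^Fin q]→ₗ[R] R)
    (v : Fin (p + q) → V) :
    (p ! * q !) • wedgeHom p q P Q v = altSum (tensor rfl P Q) v := by
  have h := congrArg (fun m => LinearMap.mul' R R (m (v ∘ finSumFinEquiv)))
    (MultilinearMap.domCoprod_alternization_eq P Q)
  simp only [Fintype.card_fin, AlternatingMap.smul_apply, map_nsmul] at h
  refine h.symm.trans ?_
  rw [MultilinearMap.alternatization_apply, map_sum, altSum,
    ← (finSumFinEquiv (m := p) (n := q)).permCongr.sum_comp]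
  refine Finset.sum_congr rfl fun σ _ => ?_
  have hσ (x) : (v ∘ finSumFinEquiv) (σ x) =
      (v ∘ (finSumFinEquiv (m := p) (n := q)).permCongr σ) (finSumFinEquiv x) := by
    simp [Equiv.permCongr_apply]
  rw [Units.smul_def, map_zsmul]
  simp only [Perm.sign_permCongr, MultilinearMap.domDomCongr_apply,
    MultilinearMap.domCoprod_apply, LinearMap.mul'_apply, zsmul_eq_mul, hσ,
    AlternatingMap.coe_multilinearMap, finSumFinEquiv_apply_left, finSumFinEquiv_apply_right]
  rfl

theorem factorial_nsmul_wedge_apply {p q n : ℕ} (h : p + q = n) (P : V [⋀^Fin p]→ₗ[R] R)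
    (Q : V [⋀^Fin q]→ₗ[R] R) (v : Fin n → V) :
    (p ! * q !) • wedge (homog p P) (homog q Q) n v = altSum (tensor h P Q) v := by
  subst h
  rw [wedge_homog, homog_apply_self, factorial_nsmul_wedgeHom]

theorem sum_altSum_tensor_insertNth_left {p q n : ℕ} (h : p + q = n + 1) (P : V [⋀^Fin p]→ₗ[R] R)
    (Q : V [⋀^Fin q]→ₗ[R] R) (X : V) (w : Fin n → V) :
    ∑ i : Fin p, (-1 : R) ^ (i : ℕ) * altSum (fun u => tensor h P Q
        ((⟨i, by lia⟩ : Fin (n + 1)).insertNth (α := fun _ => V) X u)) w =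
      (p ! * q !) • wedge (contract X (homog p P)) (homog q Q) n w := by
  cases p with
  | zero => simp [contract_homog_zero]
  | succ p =>
    have hn : p + q = n := by lia
    simp only [tensor_insertNth_left hn, altSum_mul_left, ← mul_assoc, ← mul_pow, neg_one_mul,
      neg_neg, one_pow, one_mul, Finset.sum_const, Finset.card_univ, Fintype.card_fin]
    rw [contract_homog_succ, Nat.factorial_succ, mul_assoc, mul_nsmul',
      factorial_nsmul_wedge_apply hn]

theorem sum_altSum_tensor_insertNth_right {p q n : ℕ} (h : p + q = n + 1) (P : V [⋀^Fin p]→ₗ[R] R)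
    (Q : V [⋀^Fin q]→ₗ[R] R) (X : V) (w : Fin n → V) :
    ∑ i : Fin q, (-1 : R) ^ (p + i : ℕ) * altSum (fun u => tensor h P Q
        ((⟨p + i, by lia⟩ : Fin (n + 1)).insertNth (α := fun _ => V) X u)) w =
      (p ! * q !) • wedge (parity (homog p P)) (contract X (homog q Q)) n w := by
  cases q with
  | zero => simp [contract_homog_zero]
  | succ q =>
    have hn : p + q = n := by lia
    simp only [tensor_insertNth_right hn, altSum_mul_left, pow_add, ← mul_assoc]
    simp only [mul_assoc ((-1 : R) ^ p), ← mul_pow, neg_one_mul, neg_neg, one_pow, mul_one,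
      Finset.sum_const, Finset.card_univ, Fintype.card_fin]
    rw [contract_homog_succ, parity_homog, map_smul, LinearMap.smul_apply, DirectSum.smul_apply,
      AlternatingMap.smul_apply, smul_eq_mul, Nat.factorial_succ, mul_left_comm,
      mul_nsmul', ← mul_smul_comm (p ! * q !), factorial_nsmul_wedge_apply hn]

theorem contract_wedge_homog [IsAddTorsionFree R] (X : V) {p q : ℕ} (P : V [⋀^Fin p]→ₗ[R] R)
    (Q : V [⋀^Fin q]→ₗ[R] R) :
    contract X (wedge (homog p P) (homog q Q)) =
      wedge (contract X (homog p P)) (homog q Q) +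
        wedge (parity (homog p P)) (contract X (homog q Q)) := by
  refine DFinsupp.ext fun n => ?_
  rw [contract_apply, DirectSum.add_apply]
  by_cases h : p + q = n + 1
  · ext w
    refine nsmul_right_injective (mul_ne_zero p.factorial_ne_zero q.factorial_ne_zero) ?_
    simp only [AlternatingMap.curryLeft_apply_apply, AlternatingMap.add_apply, nsmul_add]
    rw [factorial_nsmul_wedge_apply h, altSum_tensor_vecCons, sum_altSum_tensor_insertNth_left,
      sum_altSum_tensor_insertNth_right]
  · have hP : wedge (contract X (homog p P)) (homog q Q) n = 0 := by
      cases p with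
      | zero => simp [contract_homog_zero]
      | succ p => rw [contract_homog_succ, wedge_homog_apply_of_ne (by lia)]
    have hQ : wedge (homog p P) (contract X (homog q Q)) n = 0 := by
      cases q with
      | zero => simp [contract_homog_zero]
      | succ q => rw [contract_homog_succ, wedge_homog_apply_of_ne (by lia)]
    rw [wedge_homog_apply_of_ne h, hP, parity_homog, map_smul, LinearMap.smul_apply,
      DirectSum.smul_apply, hQ, smul_zero, add_zero]
    rfl

theorem contract_wedge [IsAddTorsionFree R] (X : V) (P Q : ExtForms R V) :
    contract X (wedge P Q) = wedge (contract X P) Q + wedge (parity P) (contract X Q) := by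
  induction P using induction_homog with
  | add P P' h h' => simp only [map_add, LinearMap.add_apply, h, h']; abel
  | homog p P =>
    induction Q using induction_homog with
    | add Q Q' h h' => simp only [map_add, h, h']; abel
    | homog q Q => exact contract_wedge_homog X P Q

end Wedge

section Generators

variable {R V : Type*} [CommRing R] [AddCommGroup V] [Module R V]

theorem fn0_apply_zero (f : R) (v : Fin 0 → V) : fn0 f 0 v = f := by
  rw [fn0, homog_apply_self]; rfl

theorem form1_apply_zero (α : Module.Dual R V) : form1 α 0 = 0 := homog_apply_of_ne one_ne_zero _

theorem form1_apply_one (α : Module.Dual R V) (v : Fin 1 → V) : form1 α 1 v = α (v 0) := by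
  rw [form1, homog_apply_self]; rfl

theorem homog_zero_eq_fn0 (η : V [⋀^Fin 0]→ₗ[R] R) : homog 0 η = fn0 (η ![]) := by
  rw [fn0]; congr 1; ext v; simp [Subsingleton.elim v ![]]

theorem contract_fn0 (X : V) (f : R) : contract X (fn0 f) = 0 := contract_homog_zero X _

theorem contract_form1 (X : V) (α : Module.Dual R V) : contract X (form1 α) = fn0 (α X) := by
  rw [form1, contract_homog_succ, fn0]; congr 1

theorem neg_one_smul_eq_neg (θ : ExtForms R V) : (-1 : R) • θ = -θ :=
  DFinsupp.ext fun n => by rw [DirectSum.smul_apply, neg_component, neg_one_smul]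

theorem parity_fn0 (f : R) : parity (fn0 f : ExtForms R V) = fn0 f := by
  rw [fn0, parity_homog, pow_zero, one_smul]

theorem parity_form1 (α : Module.Dual R V) : parity (form1 α) = -form1 α := by
  rw [form1, parity_homog, pow_one, neg_one_smul_eq_neg]

theorem fn0_add (f g : R) : (fn0 (f + g) : ExtForms R V) = fn0 f + fn0 g := by
  rw [fn0, fn0, fn0, ← map_add]; rfl

theorem fn0_mul (f g : R) : (fn0 (f * g) : ExtForms R V) = f • fn0 g := by
  rw [fn0, fn0, ← map_smul]; rfl

theorem fn0_neg (f : R) : (fn0 (-f) : ExtForms R V) = -fn0 f := by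
  rw [← neg_one_mul, fn0_mul, neg_one_smul_eq_neg]

theorem form1_add (α β : Module.Dual R V) : form1 (α + β) = form1 α + form1 β := by
  rw [form1, form1, form1, ← map_add]; rfl

theorem form1_smul (f : R) (α : Module.Dual R V) : form1 (f • α) = f • form1 α := by
  rw [form1, form1, ← map_smul]; rfl

theorem form1_neg (α : Module.Dual R V) : form1 (-α) = -form1 α := by
  rw [← neg_one_smul R, form1_smul, neg_one_smul_eq_neg]

theorem form1_sub (α β : Module.Dual R V) : form1 (α - β) = form1 α - form1 β := by
  rw [sub_eq_add_neg, form1_add, form1_neg, sub_eq_add_neg]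

theorem contract_neg_left (X : V) (P : ExtForms R V) : contract (-X) P = -contract X P :=
  map_neg (contract.flip P) X

theorem contract_sub_left (X Y : V) (P : ExtForms R V) :
    contract (X - Y) P = contract X P - contract Y P :=
  map_sub (contract.flip P) X Y

theorem wedge_neg_left (P Q : ExtForms R V) : wedge (-P) Q = -wedge P Q :=
  map_neg (wedge.flip Q) P

theorem wedge_sub_left (P P' Q : ExtForms R V) : wedge (P - P') Q = wedge P Q - wedge P' Q :=
  map_sub (wedge.flip Q) P P'

theorem wedge_apply_zero (P Q : ExtForms R V) (v : Fin 0 → V) :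
    wedge P Q 0 v = P 0 v * Q 0 v := by
  induction P using induction_homog with
  | add P P' h h' =>
    simp only [map_add, LinearMap.add_apply, DirectSum.add_apply, AlternatingMap.add_apply, h, h',
      add_mul]
  | homog p P =>
    induction Q using induction_homog with
    | add Q Q' h h' =>
      simp only [map_add, DirectSum.add_apply, AlternatingMap.add_apply, h, h', mul_add]
    | homog q Q =>
      rcases p.eq_zero_or_pos with rfl | hp
      · rcases q.eq_zero_or_pos with rfl | hq
        · have hv (w : Fin 0 → V) : w = v := Subsingleton.elim w v
          have h := factorial_nsmul_wedge_apply (zero_add 0) P Q v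
          simpa [altSum, tensor, hv] using h
        · rw [wedge_homog_apply_of_ne (by lia), homog_apply_of_ne (k := q) hq.ne']; simp
      · rw [wedge_homog_apply_of_ne (by lia), homog_apply_of_ne (k := p) hp.ne']; simp

theorem form1_wedge_apply_zero (α : Module.Dual R V) (Q : ExtForms R V) :
    wedge (form1 α) Q 0 = 0 := by
  ext v
  rw [wedge_apply_zero, form1_apply_zero]; simp

theorem fn0_wedge [IsAddTorsionFree R] (f : R) (Q : ExtForms R V) : wedge (fn0 f) Q = f • Q := by
  refine DFinsupp.ext fun n => ?_
  induction n generalizing Q with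
  | zero =>
    ext v
    rw [wedge_apply_zero, fn0_apply_zero]; rfl
  | succ n ih =>
    refine apply_succ_eq_of_contract fun X => ?_
    rw [contract_wedge, contract_fn0, parity_fn0, map_zero, LinearMap.zero_apply, zero_add, ih,
      map_smul]

theorem contract_form1_wedge [IsAddTorsionFree R] (X : V) (α : Module.Dual R V)
    (Q : ExtForms R V) :
    contract X (wedge (form1 α) Q) = α X • Q - wedge (form1 α) (contract X Q) := by
  rw [contract_wedge, contract_form1, fn0_wedge, parity_form1, wedge_neg_left,
    sub_eq_add_neg]

end Generators

section RealScalars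

variable {R V : Type*} [CommRing R] [Algebra ℝ R] [AddCommGroup V] [Module R V]

instance isAddTorsionFree_of_real_algebra : IsAddTorsionFree R := .of_isTorsionFree ℝ R

instance isScalarTower_real : IsScalarTower ℝ R (ExtForms R V) where
  smul_assoc c f θ := DFinsupp.ext fun n => AlternatingMap.ext fun v => smul_assoc c f (θ n v)

theorem neg_one_pow_real_smul (p : ℕ) (θ : ExtForms R V) :
    (-1 : ℝ) ^ p • θ = (-1 : R) ^ p • θ := by
  rw [← algebraMap_smul R ((-1 : ℝ) ^ p) θ, map_pow, map_neg, map_one]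

end RealScalars

section Alternating

variable {R V : Type*} [CommRing R] [AddCommGroup V] [Module R V]

theorem sum_update_eq_zero_of_eq {k : ℕ} (η : V [⋀^Fin k]→ₗ[R] R) (F : V → V) {v : Fin k → V}
    {i j : Fin k} (hv : v i = v j) (hij : i ≠ j) :
    ∑ l, η (Function.update v l (F (v l))) = 0 := by
  have hswap : Function.update v j (F (v j)) =
      Function.update v i (F (v i)) ∘ Equiv.swap i j := by
    rw [Function.update_comp_equiv, Equiv.symm_swap, Equiv.swap_apply_left, hv,
      Equiv.comp_swap_eq_update, hv, Function.update_eq_self, ← hv, Function.update_eq_self]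
  rw [Finset.sum_eq_add i j hij _ (by simp) (by simp), hswap, add_comm, η.map_swap_add _ hij]
  rintro l - ⟨hi, hj⟩
  exact η.map_eq_zero_of_eq _ (by simp [hi.symm, hj.symm, hv]) hij

/-- The alternating map in `n + 1` variables with contractions `F`, the inverse of
`AlternatingMap.curryLeft`. -/
def consAlt {n : ℕ} (F : V →ₗ[R] V [⋀^Fin n]→ₗ[R] R)
    (hF : ∀ (v : Fin n → V) (j : Fin n), F (v j) v = 0) : V [⋀^Fin (n + 1)]→ₗ[R] R where
  toMultilinearMap := LinearMap.uncurryLeft (AlternatingMap.toMultilinearMapLM (R := R) (S := R)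
    ∘ₗ F)
  map_eq_zero_of_eq' v i j hv hij := by
    change F (v 0) (Fin.tail v) = 0
    induction i using Fin.cases with
    | zero =>
      induction j using Fin.cases with
      | zero => exact absurd rfl hij
      | succ j => rw [hv]; exact hF (Fin.tail v) j
    | succ i =>
      induction j using Fin.cases with
      | zero => rw [← hv]; exact hF (Fin.tail v) i
      | succ j => exact (F (v 0)).map_eq_zero_of_eq _ hv (fun h => hij (h ▸ rfl))

theorem contract_apply_eq_zero_of_mem (θ : ExtForms R V) {n : ℕ} (v : Fin n → V) (j : Fin n) :
    contract (v j) θ n v = 0 := by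
  rw [contract_apply_apply]
  exact (θ (n + 1)).map_eq_zero_of_eq _ (i := 0) (j := j.succ) (by simp) (Fin.succ_ne_zero j).symm

end Alternating

end ExtForms

/-! ### The Koszul differential -/

namespace AlmostLieAlgebroid

open ExtForms

variable {R B : Type*} [CommRing R] [Algebra ℝ R] [AddCommGroup B] [Module R B]
  [Module ℝ B] [IsScalarTower ℝ R B] (A : AlmostLieAlgebroid R B)

section LieDerivative

theorem bracket_smul_left (f : R) (X Y : B) :
    A.bracket (f • X) Y = f • A.bracket X Y - A.anchor Y f • X := by
  rw [A.bracket_swap, A.leibniz, A.bracket_swap Y X, smul_neg]; abel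

theorem sum_update_bracket_update (X : B) {k : ℕ} (η : B [⋀^Fin k]→ₗ[R] R) (v : Fin k → B)
    (i : Fin k) (z : B) :
    ∑ j, η (Function.update (Function.update v i z) j (A.bracket X (Function.update v i z j))) =
      η (Function.update v i (A.bracket X z)) + ∑ j ∈ Finset.univ.erase i,
        η (Function.update (Function.update v j (A.bracket X (v j))) i z) := by
  rw [← Finset.add_sum_erase _ _ (Finset.mem_univ i)]
  congr 1
  · simp
  · refine Finset.sum_congr rfl fun j hj => ?_
    have hji := Finset.ne_of_mem_erase hj
    rw [Function.update_of_ne hji, Function.update_comm hji]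

/-- The Lie derivative of a `k`-form,
`(L_X η)(v₁, …, v_k) = ρ(X)(η(v₁, …, v_k)) - ∑ᵢ η(v₁, …, [X, vᵢ], …, v_k)`. -/
def lieForm (X : B) {k : ℕ} (η : B [⋀^Fin k]→ₗ[R] R) : B [⋀^Fin k]→ₗ[R] R where
  toFun v := A.anchor X (η v) - ∑ i, η (Function.update v i (A.bracket X (v i)))
  map_update_add' := by
    intro inst v i x y
    rw [Subsingleton.elim inst (instDecidableEqFin k)]
    simp only [A.sum_update_bracket_update, η.map_update_add, map_add, Finset.sum_add_distrib]
    ring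
  map_update_smul' := by
    intro inst v i c x
    rw [Subsingleton.elim inst (instDecidableEqFin k)]
    simp only [A.sum_update_bracket_update, η.map_update_add, η.map_update_smul, A.leibniz,
      smul_eq_mul, Derivation.leibniz, ← Finset.mul_sum]
    ring
  map_eq_zero_of_eq' v i j hv hij := by
    rw [η.map_eq_zero_of_eq v hv hij, map_zero, sum_update_eq_zero_of_eq η _ hv hij, sub_zero]

theorem lieForm_apply (X : B) {k : ℕ} (η : B [⋀^Fin k]→ₗ[R] R) (v : Fin k → B) :
    A.lieForm X η v = A.anchor X (η v) - ∑ i, η (Function.update v i (A.bracket X (v i))) := rfl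

/-- The Lie derivative `L_X` on the exterior algebra. -/
def lie (X : B) : ExtForms R B →ₗ[ℝ] ExtForms R B :=
  DirectSum.lmap fun _ =>
    { toFun := A.lieForm X
      map_add' := fun η η' => by
        ext v
        simp only [lieForm_apply, AlternatingMap.add_apply, map_add, Finset.sum_add_distrib]
        ring
      map_smul' := fun c η => by
        ext v
        simp only [lieForm_apply, AlternatingMap.smul_apply, Derivation.map_smul, RingHom.id_apply,
          smul_sub, Finset.smul_sum] }

theorem lie_apply (X : B) (θ : ExtForms R B) (n : ℕ) (v : Fin n → B) :
    A.lie X θ n v = A.anchor X (θ n v) - ∑ i, θ n (Function.update v i (A.bracket X (v i))) := rfl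

theorem lie_apply_zero (X : B) (θ : ExtForms R B) (v : Fin 0 → B) :
    A.lie X θ 0 v = A.anchor X (θ 0 v) := by
  simp [lie_apply]

theorem contract_lie (X Y : B) (θ : ExtForms R B) :
    contract Y (A.lie X θ) = A.lie X (contract Y θ) - contract (A.bracket X Y) θ := by
  refine DFinsupp.ext fun n => AlternatingMap.ext fun v => ?_
  have h0 : Function.update (Matrix.vecCons Y v) 0 (A.bracket X (Matrix.vecCons Y v 0)) =
      Matrix.vecCons (A.bracket X Y) v := Fin.update_cons_zero (α := fun _ => B) Y v _
  have hsucc (i : Fin n) : Function.update (Matrix.vecCons Y v) i.succ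
      (A.bracket X (Matrix.vecCons Y v i.succ)) =
      Matrix.vecCons Y (Function.update v i (A.bracket X (v i))) :=
    (Fin.cons_update (α := fun _ => B) Y v i _).symm
  rw [DirectSum.sub_apply, AlternatingMap.sub_apply]
  simp only [contract_apply_apply, lie_apply, Fin.sum_univ_succ, h0, hsucc]
  ring

theorem lie_smul (X : B) (f : R) (θ : ExtForms R B) :
    A.lie X (f • θ) = A.anchor X f • θ + f • A.lie X θ := by
  refine DFinsupp.ext fun n => AlternatingMap.ext fun v => ?_
  simp only [DirectSum.add_apply, DirectSum.smul_apply, AlternatingMap.add_apply,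
    AlternatingMap.smul_apply, lie_apply, smul_eq_mul, Derivation.leibniz, ← Finset.mul_sum]
  ring

theorem lie_add_left (X Y : B) (θ : ExtForms R B) :
    A.lie (X + Y) θ = A.lie X θ + A.lie Y θ := by
  refine DFinsupp.ext fun n => AlternatingMap.ext fun v => ?_
  simp only [DirectSum.add_apply, AlternatingMap.add_apply, lie_apply, map_add,
    LinearMap.add_apply, Derivation.add_apply, (θ n).map_update_add, Finset.sum_add_distrib]
  ring

theorem diffFn_apply (f : R) (X : B) : A.diffFn f X = A.anchor X f := rfl

theorem lie_smul_left (f : R) (X : B) (θ : ExtForms R B) :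
    A.lie (f • X) θ = f • A.lie X θ + wedge (form1 (A.diffFn f)) (contract X θ) := by
  refine DFinsupp.ext fun n => ?_
  induction n generalizing θ with
  | zero =>
    ext v
    rw [DirectSum.add_apply, form1_wedge_apply_zero, add_zero, DirectSum.smul_apply,
      AlternatingMap.smul_apply, lie_apply_zero, lie_apply_zero, map_smul, Derivation.smul_apply]
  | succ n ih =>
    refine apply_succ_eq_of_contract fun Y => ?_
    rw [contract_lie, DirectSum.sub_apply, bracket_smul_left, ih, map_add, map_smul (contract Y),
      contract_lie, contract_form1_wedge, contract_contract Y X, diffFn_apply]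
    simp only [contract_sub_left, map_smul, LinearMap.smul_apply, DirectSum.add_apply,
      DirectSum.sub_apply, DirectSum.smul_apply, smul_sub, map_neg, neg_component]
    abel

theorem parity_lie (X : B) (θ : ExtForms R B) : parity (A.lie X θ) = A.lie X (parity θ) := by
  refine DFinsupp.ext fun n => AlternatingMap.ext fun v => ?_
  rcases neg_one_pow_eq_or R n with h | h <;>
    simp [parity_apply, lie_apply, h]
  ring

theorem lie_wedge (X : B) (P Q : ExtForms R B) :
    A.lie X (wedge P Q) = wedge (A.lie X P) Q + wedge P (A.lie X Q) := by
  refine DFinsupp.ext fun n => ?_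
  induction n generalizing P Q with
  | zero =>
    ext v
    simp only [DirectSum.add_apply, AlternatingMap.add_apply, lie_apply_zero, wedge_apply_zero,
      Derivation.leibniz, smul_eq_mul]
    ring
  | succ n ih =>
    refine apply_succ_eq_of_contract fun Y => ?_
    simp only [contract_lie, contract_wedge, map_add, DirectSum.add_apply, DirectSum.sub_apply, ih,
      wedge_sub_left, map_sub, parity_lie]
    abel

end LieDerivative

section Koszul

/-- The component of degree `n` of the Koszul differential, on all forms at once, with the two
properties that make the recursion `ι_Y d = L_Y - d ι_Y` define the component of degree `n + 1`:
the `R`-linearity in `Y` of the right-hand side comes from `map_smul`, and its antisymmetry from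
`alt`. -/
structure KoszulComponent (n : ℕ) where
  toMap : ExtForms R B →ₗ[ℝ] B [⋀^Fin n]→ₗ[R] R
  map_smul : ∀ f θ, toMap (f • θ) = f • toMap θ + wedge (form1 (A.diffFn f)) θ n
  alt : ∀ θ (v : Fin n → B) j, toMap (contract (v j) θ) v = A.lie (v j) θ n v

namespace KoszulComponent

/-- The component of degree `0` of the Koszul differential vanishes. -/
def zero : KoszulComponent A 0 where
  toMap := 0
  map_smul f θ := by simp [form1_wedge_apply_zero]
  alt θ v j := j.elim0

variable {A} {n : ℕ} (D : KoszulComponent A n)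

/-- The form of degree `n + 1` with contractions `(L_Y θ)_n - D(ι_Y θ)`. -/
def next (θ : ExtForms R B) : B [⋀^Fin (n + 1)]→ₗ[R] R :=
  consAlt
    { toFun := fun Y => A.lie Y θ n - D.toMap (contract Y θ)
      map_add' := fun Y Z => by
        rw [A.lie_add_left, map_add, LinearMap.add_apply, map_add, DirectSum.add_apply]; abel
      map_smul' := fun f Y => by
        rw [A.lie_smul_left, _root_.map_smul, LinearMap.smul_apply, D.map_smul,
          DirectSum.add_apply, DirectSum.smul_apply, RingHom.id_apply, smul_sub]; abel }
    fun v j => by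
      rw [LinearMap.coe_mk, AddHom.coe_mk, AlternatingMap.sub_apply, D.alt, sub_self]

theorem next_apply (θ : ExtForms R B) (v : Fin (n + 1) → B) :
    D.next θ v = A.lie (v 0) θ n (Fin.tail v) - D.toMap (contract (v 0) θ) (Fin.tail v) := rfl

theorem next_smul (f : R) (θ : ExtForms R B) :
    D.next (f • θ) = f • D.next θ + wedge (form1 (A.diffFn f)) θ (n + 1) := by
  ext v
  rw [AlternatingMap.add_apply, AlternatingMap.smul_apply, next_apply, next_apply,
    apply_succ_apply, contract_form1_wedge, A.lie_smul, _root_.map_smul, D.map_smul, diffFn_apply]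
  simp only [DirectSum.add_apply, DirectSum.sub_apply, DirectSum.smul_apply,
    AlternatingMap.add_apply, AlternatingMap.sub_apply, AlternatingMap.smul_apply, smul_eq_mul]
  ring

theorem next_contract (θ : ExtForms R B) (v : Fin (n + 1) → B) (j : Fin (n + 1)) :
    D.next (contract (v j) θ) v = A.lie (v j) θ (n + 1) v := by
  rw [next_apply, apply_succ_apply, contract_lie, DirectSum.sub_apply, AlternatingMap.sub_apply]
  induction j using Fin.cases with
  | zero =>
    rw [contract_contract_self, map_zero, A.bracket_self, map_zero, LinearMap.zero_apply]
    rfl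
  | succ j =>
    have hj : contract (Fin.tail v j) (A.lie (v 0) θ) n (Fin.tail v) = 0 :=
      contract_apply_eq_zero_of_mem _ _ _
    rw [contract_lie, DirectSum.sub_apply, AlternatingMap.sub_apply, sub_eq_zero] at hj
    change A.lie (v 0) (contract (Fin.tail v j) θ) n (Fin.tail v) -
      D.toMap (contract (v 0) (contract (Fin.tail v j) θ)) (Fin.tail v) =
      A.lie (Fin.tail v j) (contract (v 0) θ) n (Fin.tail v) -
        contract (A.bracket (Fin.tail v j) (v 0)) θ n (Fin.tail v)
    rw [contract_contract, map_neg, AlternatingMap.neg_apply, D.alt, hj,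
      A.bracket_swap (Fin.tail v j) (v 0), contract_neg_left, neg_component,
      AlternatingMap.neg_apply]
    ring

/-- The recursion step `ι_Y d = L_Y - d ι_Y`. -/
def succ : KoszulComponent A (n + 1) where
  toMap :=
    { toFun := D.next
      map_add' := fun θ η => by
        ext v
        simp only [next_apply, map_add, DirectSum.add_apply, AlternatingMap.add_apply]
        ring
      map_smul' := fun c θ => by
        ext v
        simp only [next_apply, _root_.map_smul, LinearMap.map_smul_of_tower, RingHom.id_apply,
          AlternatingMap.smul_apply, smul_sub]
        rfl }
  map_smul := D.next_smul
  alt := D.next_contract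

end KoszulComponent

/-- The components of the Koszul differential, by recursion on the degree. -/
def koszulComponent : (n : ℕ) → KoszulComponent A n
  | 0 => KoszulComponent.zero A
  | n + 1 => (koszulComponent n).succ

theorem koszulComponent_succ_apply (n : ℕ) (θ : ExtForms R B) (v : Fin (n + 1) → B) :
    (A.koszulComponent (n + 1)).toMap θ v =
      A.lie (v 0) θ n (Fin.tail v) -
        (A.koszulComponent n).toMap (contract (v 0) θ) (Fin.tail v) := rfl

theorem koszulComponent_succ_eq_zero (n : ℕ) (θ : ExtForms R B) (h : θ n = 0) :
    (A.koszulComponent (n + 1)).toMap θ = 0 := by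
  induction n generalizing θ with
  | zero =>
    ext v
    rw [koszulComponent_succ_apply, lie_apply_zero, h]
    simp [koszulComponent, KoszulComponent.zero]
  | succ n ih =>
    ext v
    rw [koszulComponent_succ_apply, ih _ (by rw [contract_apply, h]; rfl), lie_apply, h]
    simp

/-- The Koszul differential `d` of the algebroid, on the exterior algebra. -/
def koszul : ExtForms R B →ₗ[ℝ] ExtForms R B :=
  DirectSum.toModule ℝ ℕ _ fun k =>
    DirectSum.lof ℝ ℕ (fun k => B [⋀^Fin k]→ₗ[R] R) (k + 1) ∘ₗ
      (A.koszulComponent (k + 1)).toMap ∘ₗ DirectSum.lof ℝ ℕ (fun k => B [⋀^Fin k]→ₗ[R] R) k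

theorem koszul_homog (k : ℕ) (η : B [⋀^Fin k]→ₗ[R] R) :
    A.koszul (homog k η) = homog (k + 1) ((A.koszulComponent (k + 1)).toMap (homog k η)) :=
  DirectSum.toModule_lof ℝ (M := fun k => B [⋀^Fin k]→ₗ[R] R) k η

theorem koszul_homog_apply_of_ne {p n : ℕ} (h : n ≠ p + 1) (η : B [⋀^Fin p]→ₗ[R] R) :
    A.koszul (homog p η) n = 0 := by
  rw [koszul_homog, homog_apply_of_ne h.symm]

theorem koszul_apply (θ : ExtForms R B) (n : ℕ) :
    A.koszul θ n = (A.koszulComponent n).toMap θ := by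
  induction θ using induction_homog with
  | homog k η =>
    obtain rfl | h := eq_or_ne n (k + 1)
    · rw [koszul_homog, homog_apply_self]
    · rw [koszul_homog_apply_of_ne A h]
      cases n with
      | zero => rfl
      | succ n =>
        rw [koszulComponent_succ_eq_zero]
        exact homog_apply_of_ne (by lia) η
  | add θ η hθ hη => rw [map_add, map_add, DirectSum.add_apply, hθ, hη]

theorem koszul_apply_zero (θ : ExtForms R B) : A.koszul θ 0 = 0 := by
  rw [koszul_apply]; rfl

theorem contract_koszul (Y : B) (θ : ExtForms R B) :
    contract Y (A.koszul θ) = A.lie Y θ - A.koszul (contract Y θ) := by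
  refine DFinsupp.ext fun n => AlternatingMap.ext fun v => ?_
  rw [contract_apply_apply, koszul_apply, koszulComponent_succ_apply, DirectSum.sub_apply,
    AlternatingMap.sub_apply, koszul_apply]
  rfl

theorem koszul_smul (f : R) (θ : ExtForms R B) :
    A.koszul (f • θ) = f • A.koszul θ + wedge (form1 (A.diffFn f)) θ := by
  refine DFinsupp.ext fun n => ?_
  rw [koszul_apply, (A.koszulComponent n).map_smul, DirectSum.add_apply, DirectSum.smul_apply,
    koszul_apply]

theorem parity_koszul (θ : ExtForms R B) : parity (A.koszul θ) = -A.koszul (parity θ) := by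
  refine DFinsupp.ext fun n => ?_
  induction n generalizing θ with
  | zero =>
    rw [parity_apply, neg_component, koszul_apply_zero, koszul_apply_zero, smul_zero, neg_zero]
  | succ n ih =>
    refine apply_succ_eq_of_contract fun X => ?_
    rw [contract_parity, contract_koszul, map_neg, contract_koszul, neg_component, neg_component,
      map_sub, DirectSum.sub_apply, DirectSum.sub_apply, ih, contract_parity, map_neg, parity_lie]

theorem koszul_wedge (P Q : ExtForms R B) :
    A.koszul (wedge P Q) = wedge (A.koszul P) Q + wedge (parity P) (A.koszul Q) := by
  refine DFinsupp.ext fun n => ?_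
  induction n generalizing P Q with
  | zero =>
    ext v
    simp only [DirectSum.add_apply, AlternatingMap.add_apply, wedge_apply_zero, koszul_apply_zero,
      AlternatingMap.zero_apply, zero_mul, mul_zero, add_zero]
  | succ n ih =>
    refine apply_succ_eq_of_contract fun Y => ?_
    simp only [contract_koszul, contract_wedge, map_add, DirectSum.add_apply, DirectSum.sub_apply,
      ih, wedge_sub_left, wedge_neg_left, map_sub, lie_wedge, parity_parity, parity_koszul,
      contract_parity, neg_component]
    abel

theorem koszul_fn0 (f : R) : A.koszul (fn0 f) = form1 (A.diffFn f) := by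
  refine ext_contract ?_ fun X => ?_
  · rw [koszul_apply_zero, form1_apply_zero]
  · rw [contract_koszul, contract_fn0, map_zero, sub_zero, contract_form1]
    refine ext_contract ?_ fun Y => ?_
    · ext v
      rw [lie_apply_zero, fn0_apply_zero, fn0_apply_zero, diffFn_apply]
    · rw [contract_lie, contract_fn0, contract_fn0, contract_fn0, map_zero, sub_zero]

theorem isDegreeOneDerivation_koszul : IsDegreeOneDerivation A.koszul where
  degree _ P _ h := A.koszul_homog_apply_of_ne h P
  leibniz p P S := by
    rw [koszul_wedge, parity_homog, map_smul, LinearMap.smul_apply, neg_one_pow_real_smul]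

end Koszul

end AlmostLieAlgebroid

/-! ### The pairing of forms induced by a bivector -/

namespace ExtForms

variable {R V : Type*} [CommRing R] [AddCommGroup V] [Module R V]

section DegreeOne

/-- The component of degree `1`, as an element of the dual module. -/
def deg1 : ExtForms R V →ₗ[R] Module.Dual R V :=
  LinearMap.mk₂ R (fun θ X => contract X θ 0 ![])
    (fun θ η X => by rw [map_add]; rfl) (fun c θ X => by rw [map_smul]; rfl)
    (fun θ X Y => by rw [map_add]; rfl) (fun c θ X => by rw [map_smul]; rfl)

theorem deg1_apply (θ : ExtForms R V) (X : V) : deg1 θ X = contract X θ 0 ![] := rfl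

theorem deg1_form1 (α : Module.Dual R V) : deg1 (form1 α) = α := by
  ext X
  rw [deg1_apply, contract_form1, fn0_apply_zero]

theorem deg1_homog_of_ne {p : ℕ} (h : p ≠ 1) (η : V [⋀^Fin p]→ₗ[R] R) : deg1 (homog p η) = 0 := by
  ext X
  rw [deg1_apply, contract_apply, homog_apply_of_ne h]; rfl

theorem deg1_fn0 (f : R) : deg1 (fn0 f : ExtForms R V) = 0 := deg1_homog_of_ne zero_ne_one _

theorem deg1_parity (θ : ExtForms R V) : deg1 (parity θ) = -deg1 θ := by
  ext X
  rw [LinearMap.neg_apply, deg1_apply, deg1_apply, contract_parity, neg_component, parity_apply,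
    pow_zero, one_smul]; rfl

end DegreeOne

section Parity

/-- All components of odd degree of `P` vanish (up to `2`-torsion). -/
def IsEven (P : ExtForms R V) : Prop := parity P = P

/-- All components of even degree of `P` vanish (up to `2`-torsion). -/
def IsOdd (P : ExtForms R V) : Prop := parity P = -P

theorem IsEven.parity_eq {P : ExtForms R V} (hP : IsEven P) : parity P = P := hP

theorem IsOdd.parity_eq {P : ExtForms R V} (hP : IsOdd P) : parity P = -P := hP

theorem isEven_homog {p : ℕ} (hp : Even p) (P : V [⋀^Fin p]→ₗ[R] R) : IsEven (homog p P) := by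
  rw [IsEven, parity_homog, hp.neg_one_pow, one_smul]

theorem isOdd_homog {p : ℕ} (hp : Odd p) (P : V [⋀^Fin p]→ₗ[R] R) : IsOdd (homog p P) := by
  rw [IsOdd, parity_homog, hp.neg_one_pow, neg_one_smul_eq_neg]

theorem IsEven.contract {P : ExtForms R V} (hP : IsEven P) (Y : V) : IsOdd (contract Y P) := by
  have h := contract_parity Y P
  rw [hP.parity_eq] at h
  exact (neg_eq_iff_eq_neg (G := ExtForms R V)).1 h.symm

theorem IsOdd.contract {P : ExtForms R V} (hP : IsOdd P) (Y : V) : IsEven (contract Y P) := by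
  rw [IsEven, ← neg_inj, ← contract_parity, hP.parity_eq, map_neg]

theorem IsEven.deg1_eq_zero [IsAddTorsionFree R] {P : ExtForms R V} (hP : IsEven P) :
    deg1 P = 0 := by
  ext X
  have h : deg1 P X = -deg1 P X := by
    conv_lhs => rw [← hP.parity_eq, deg1_parity, LinearMap.neg_apply]
  exact self_eq_neg.1 h

theorem wedge_parity_apply_zero (Q S : ExtForms R V) : wedge (parity Q) S 0 = wedge Q S 0 := by
  ext v
  rw [wedge_apply_zero, wedge_apply_zero, parity_apply, pow_zero, one_smul]

end Parity

end ExtForms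

namespace Bivector

open ExtForms

variable {R V : Type*} [CommRing R] [AddCommGroup V] [Module R V]

section Pairing

/-- The component of degree `n` of the pairing of forms induced by a bivector. The property `alt`
makes the recursion `ι_Y (P, Q) = (εP, ι_Y Q) - (ι_Y P, Q)`, where `ε` is the parity, define the
component of degree `n + 1`. -/
structure PairingComponent (R V : Type*) [CommRing R] [AddCommGroup V] [Module R V] (n : ℕ) where
  toMap : ExtForms R V →ₗ[R] ExtForms R V →ₗ[R] V [⋀^Fin n]→ₗ[R] R
  alt : ∀ P Q (v : Fin n → V) j, toMap (parity P) (contract (v j) Q) v =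
    toMap (contract (v j) P) Q v

namespace PairingComponent

variable {n : ℕ} (b : PairingComponent R V n)

theorem toMap_neg_left (P Q : ExtForms R V) : b.toMap (-P) Q = -b.toMap P Q :=
  map_neg (b.toMap.flip Q) P

/-- The form of degree `n + 1` with contractions `b(εP, ι_Y Q) - b(ι_Y P, Q)`. -/
def next (P Q : ExtForms R V) : V [⋀^Fin (n + 1)]→ₗ[R] R :=
  consAlt
    { toFun := fun Y => b.toMap (parity P) (contract Y Q) - b.toMap (contract Y P) Q
      map_add' := fun Y Z => by
        simp only [map_add, LinearMap.add_apply]; abel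
      map_smul' := fun f Y => by
        simp only [map_smul, LinearMap.smul_apply, RingHom.id_apply, smul_sub] }
    fun v j => sub_eq_zero.2 (b.alt P Q v j)

theorem next_apply (P Q : ExtForms R V) (v : Fin (n + 1) → V) :
    b.next P Q v = b.toMap (parity P) (contract (v 0) Q) (Fin.tail v) -
      b.toMap (contract (v 0) P) Q (Fin.tail v) := rfl

theorem next_contract (P Q : ExtForms R V) (v : Fin (n + 1) → V) (j : Fin (n + 1)) :
    b.next (parity P) (contract (v j) Q) v = b.next (contract (v j) P) Q v := by
  rw [next_apply, next_apply]
  induction j using Fin.cases with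
  | zero =>
    rw [contract_contract_self, contract_contract_self, contract_parity]
    simp
  | succ j =>
    have hQ : b.toMap (parity (parity P)) (contract (v 0) (contract (v j.succ) Q)) (Fin.tail v) =
        b.toMap (parity (contract (v j.succ) P)) (contract (v 0) Q) (Fin.tail v) := by
      have h := b.alt (parity P) (contract (v 0) Q) (Fin.tail v) j
      rw [contract_parity, toMap_neg_left, AlternatingMap.neg_apply] at h
      rw [contract_contract, map_neg, AlternatingMap.neg_apply]
      exact neg_eq_iff_eq_neg.2 h
    have hP : b.toMap (contract (v 0) (parity P)) (contract (v j.succ) Q) (Fin.tail v) =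
        b.toMap (contract (v 0) (contract (v j.succ) P)) Q (Fin.tail v) := by
      rw [contract_contract (v 0) (v j.succ), contract_parity, toMap_neg_left, toMap_neg_left,
        AlternatingMap.neg_apply, AlternatingMap.neg_apply]
      exact congrArg Neg.neg (b.alt (contract (v 0) P) Q (Fin.tail v) j)
    rw [hQ, hP]

/-- The recursion step `ι_Y (P, Q) = (εP, ι_Y Q) - (ι_Y P, Q)`. -/
def succ : PairingComponent R V (n + 1) where
  toMap := LinearMap.mk₂ R b.next
    (fun P P' Q => AlternatingMap.ext fun v => by
      simp only [next_apply, map_add, LinearMap.add_apply, AlternatingMap.add_apply]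
      ring)
    (fun c P Q => AlternatingMap.ext fun v => by
      simp only [next_apply, map_smul, LinearMap.smul_apply, AlternatingMap.smul_apply, smul_sub])
    (fun P Q Q' => AlternatingMap.ext fun v => by
      simp only [next_apply, map_add, AlternatingMap.add_apply]
      ring)
    (fun c P Q => AlternatingMap.ext fun v => by
      simp only [next_apply, map_smul, AlternatingMap.smul_apply, smul_sub])
  alt := b.next_contract

end PairingComponent

variable (π : Bivector R V)

/-- The component of degree `0` of the pairing: the pairing of the components of degree `1`. -/
def pairingComponentZero : PairingComponent R V 0 where
  toMap := LinearMap.mk₂ R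
    (fun P Q => AlternatingMap.constOfIsEmpty R V (Fin 0) (deg1 Q (π.sharp (deg1 P))))
    (fun P P' Q => by ext; simp) (fun c P Q => by ext; simp)
    (fun P Q Q' => by ext; simp) (fun c P Q => by ext; simp)
  alt P Q v j := j.elim0

/-- The components of the pairing, by recursion on the degree. -/
def pairingComponent : (n : ℕ) → PairingComponent R V n
  | 0 => π.pairingComponentZero
  | n + 1 => (pairingComponent n).succ

theorem pairingComponent_zero_apply (P Q : ExtForms R V) (v : Fin 0 → V) :
    (π.pairingComponent 0).toMap P Q v = deg1 Q (π.sharp (deg1 P)) := rfl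

theorem pairingComponent_succ_apply (n : ℕ) (P Q : ExtForms R V) (v : Fin (n + 1) → V) :
    (π.pairingComponent (n + 1)).toMap P Q v =
      (π.pairingComponent n).toMap (parity P) (contract (v 0) Q) (Fin.tail v) -
        (π.pairingComponent n).toMap (contract (v 0) P) Q (Fin.tail v) := rfl

theorem pairingComponent_homog_eq_zero {p q n : ℕ} (h : n + 2 ≠ p + q) (P : V [⋀^Fin p]→ₗ[R] R)
    (Q : V [⋀^Fin q]→ₗ[R] R) : (π.pairingComponent n).toMap (homog p P) (homog q Q) = 0 := by
  induction n generalizing p q with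
  | zero =>
    ext v
    rw [pairingComponent_zero_apply]
    obtain rfl | hp := eq_or_ne p 1
    · rw [deg1_homog_of_ne (p := q) (by lia)]; rfl
    · rw [deg1_homog_of_ne hp]; simp
  | succ n ih =>
    ext v
    have hQ : (π.pairingComponent n).toMap (homog p P) (contract (v 0) (homog q Q)) = 0 := by
      cases q with
      | zero => rw [contract_homog_zero, map_zero]
      | succ q => rw [contract_homog_succ, ih (by lia)]
    have hP : (π.pairingComponent n).toMap (contract (v 0) (homog p P)) (homog q Q) = 0 := by
      cases p with
      | zero => rw [contract_homog_zero, map_zero, LinearMap.zero_apply]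
      | succ p => rw [contract_homog_succ, ih (by lia)]
    rw [pairingComponent_succ_apply, parity_homog, map_smul, LinearMap.smul_apply, hQ, hP]
    simp

/-- The `R`-bilinear pairing of degree `-2` on forms that is a graded derivation in each argument
and extends the bivector on `1`-forms. The degree `p + q - 2` is truncated, harmlessly: for
`p + q < 2` the component vanishes. -/
def pairing : ExtForms R V →ₗ[R] ExtForms R V →ₗ[R] ExtForms R V :=
  DirectSum.toModule R ℕ _ fun p =>
    (DirectSum.toModule R ℕ _ fun q =>
      (((π.pairingComponent (p + q - 2)).toMap.compl₁₂
        (DirectSum.lof R ℕ (fun k => V [⋀^Fin k]→ₗ[R] R) p)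
        (DirectSum.lof R ℕ (fun k => V [⋀^Fin k]→ₗ[R] R) q)).compr₂
          (DirectSum.lof R ℕ (fun k => V [⋀^Fin k]→ₗ[R] R) (p + q - 2))).flip).flip

theorem pairing_homog {p q : ℕ} (P : V [⋀^Fin p]→ₗ[R] R) (Q : V [⋀^Fin q]→ₗ[R] R) :
    π.pairing (homog p P) (homog q Q) =
      homog (p + q - 2) ((π.pairingComponent (p + q - 2)).toMap (homog p P) (homog q Q)) := by
  simp [pairing]

theorem pairing_apply (P Q : ExtForms R V) (n : ℕ) :
    π.pairing P Q n = (π.pairingComponent n).toMap P Q := by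
  induction P using induction_homog with
  | add P P' h h' =>
    simp only [map_add, LinearMap.add_apply, DirectSum.add_apply, h, h']
  | homog p P =>
    induction Q using induction_homog with
    | add Q Q' h h' => simp only [map_add, DirectSum.add_apply, h, h']
    | homog q Q =>
      rw [pairing_homog]
      obtain rfl | h := eq_or_ne n (p + q - 2)
      · rw [homog_apply_self]
      · rw [homog_apply_of_ne h.symm, pairingComponent_homog_eq_zero _ (by lia)]

theorem pairing_apply_zero (P Q : ExtForms R V) (v : Fin 0 → V) :
    π.pairing P Q 0 v = deg1 Q (π.sharp (deg1 P)) := by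
  rw [pairing_apply]; rfl

theorem pairing_homog_apply_of_ne {p q n : ℕ} (h : n + 2 ≠ p + q) (P : V [⋀^Fin p]→ₗ[R] R)
    (Q : V [⋀^Fin q]→ₗ[R] R) : π.pairing (homog p P) (homog q Q) n = 0 := by
  rw [pairing_apply, pairingComponent_homog_eq_zero _ h]

theorem contract_pairing (Y : V) (P Q : ExtForms R V) :
    contract Y (π.pairing P Q) =
      π.pairing (parity P) (contract Y Q) - π.pairing (contract Y P) Q := by
  refine DFinsupp.ext fun n => AlternatingMap.ext fun v => ?_
  rw [contract_apply_apply, pairing_apply, pairingComponent_succ_apply, DirectSum.sub_apply,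
    AlternatingMap.sub_apply, pairing_apply, pairing_apply]
  rfl

theorem pairing_neg_left (P Q : ExtForms R V) : π.pairing (-P) Q = -π.pairing P Q :=
  map_neg (π.pairing.flip Q) P

theorem parity_pairing (P Q : ExtForms R V) :
    parity (π.pairing P Q) = π.pairing (parity P) (parity Q) := by
  refine DFinsupp.ext fun n => ?_
  induction n generalizing P Q with
  | zero =>
    ext v
    rw [parity_apply, pow_zero, one_smul, pairing_apply_zero, pairing_apply_zero, deg1_parity,
      deg1_parity, map_neg, map_neg, LinearMap.neg_apply, neg_neg]
  | succ n ih =>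
    refine apply_succ_eq_of_contract fun Y => ?_
    rw [contract_parity, contract_pairing, contract_pairing, contract_parity, contract_parity,
      map_sub, neg_component, DirectSum.sub_apply, DirectSum.sub_apply, ih, ih, parity_parity,
      map_neg, pairing_neg_left, neg_component, neg_component]
    abel

theorem pairing_fn0_left (f : R) (Q : ExtForms R V) : π.pairing (fn0 f) Q = 0 := by
  refine DFinsupp.ext fun n => ?_
  induction n generalizing Q with
  | zero =>
    ext v
    rw [pairing_apply_zero, deg1_fn0, map_zero, map_zero]
    rfl
  | succ n ih =>
    refine apply_succ_eq_of_contract fun Y => ?_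
    rw [contract_pairing, contract_fn0, parity_fn0, map_zero, LinearMap.zero_apply, map_zero,
      DirectSum.sub_apply, ih, sub_self]
    rfl

theorem pairing_form1_left (α : Module.Dual R V) (Q : ExtForms R V) :
    π.pairing (form1 α) Q = contract (π.sharp α) Q := by
  refine DFinsupp.ext fun n => ?_
  induction n generalizing Q with
  | zero =>
    ext v
    rw [pairing_apply_zero, deg1_form1, deg1_apply, Subsingleton.elim v ![]]
  | succ n ih =>
    refine apply_succ_eq_of_contract fun Y => ?_
    rw [contract_pairing, contract_form1, parity_form1, pairing_fn0_left, sub_zero,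
      pairing_neg_left, neg_component, ih, contract_contract Y, neg_component]

end Pairing

section GradedDerivation

variable [IsAddTorsionFree R] (π : Bivector R V)

/- Contraction exchanges even and odd forms, so the two parities are proved by one induction. -/
theorem pairing_apply_symm (P Q : ExtForms R V) (n : ℕ) :
    (IsEven P → π.pairing P Q n = π.pairing (parity Q) P n) ∧
      (IsOdd P → π.pairing P Q n = (-π.pairing Q P) n) := by
  induction n generalizing P Q with
  | zero =>
    refine ⟨fun hP => ?_, fun _ => ?_⟩ <;> ext v
    · rw [pairing_apply_zero, pairing_apply_zero, hP.deg1_eq_zero]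
      simp
    · rw [neg_component, AlternatingMap.neg_apply, pairing_apply_zero, pairing_apply_zero,
        π.apply_sharp_swap]
  | succ n ih =>
    refine ⟨fun hP => apply_succ_eq_of_contract fun Y => ?_,
      fun hP => apply_succ_eq_of_contract fun Y => ?_⟩
    · rw [contract_pairing, contract_pairing, hP.parity_eq, parity_parity, DirectSum.sub_apply,
        DirectSum.sub_apply, (ih _ _).1 hP, (ih _ _).2 (hP.contract Y), neg_component,
        contract_parity, pairing_neg_left, neg_component]
      abel
    · rw [contract_pairing, map_neg, contract_pairing, hP.parity_eq, pairing_neg_left,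
        DirectSum.sub_apply, neg_component, neg_component, DirectSum.sub_apply, (ih _ _).2 hP,
        (ih _ _).1 (hP.contract Y), neg_component]
      abel

theorem pairing_symm_of_isEven {P : ExtForms R V} (hP : IsEven P) (Q : ExtForms R V) :
    π.pairing P Q = π.pairing (parity Q) P :=
  DFinsupp.ext fun n => (π.pairing_apply_symm P Q n).1 hP

theorem pairing_symm_of_isOdd {P : ExtForms R V} (hP : IsOdd P) (Q : ExtForms R V) :
    π.pairing P Q = -π.pairing Q P :=
  DFinsupp.ext fun n => (π.pairing_apply_symm P Q n).2 hP

theorem deg1_wedge_apply (Q S : ExtForms R V) (X : V) :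
    deg1 (wedge Q S) X = deg1 Q X * S 0 ![] + Q 0 ![] * deg1 S X := by
  rw [deg1_apply, contract_wedge, DirectSum.add_apply, AlternatingMap.add_apply, wedge_apply_zero,
    wedge_apply_zero, parity_apply, pow_zero, one_smul]
  rfl

theorem pairing_wedge_apply_zero (P Q S : ExtForms R V) :
    π.pairing P (wedge Q S) 0 = wedge (π.pairing P Q) S 0 + wedge Q (π.pairing P S) 0 := by
  ext v
  rw [AlternatingMap.add_apply, wedge_apply_zero, wedge_apply_zero, pairing_apply_zero,
    pairing_apply_zero, pairing_apply_zero, deg1_wedge_apply, Subsingleton.elim v ![]]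

theorem pairing_wedge_apply (P Q S : ExtForms R V) (n : ℕ) :
    (IsEven P → π.pairing P (wedge Q S) n =
      wedge (π.pairing P Q) S n + wedge Q (π.pairing P S) n) ∧
    (IsOdd P → π.pairing P (wedge Q S) n =
      wedge (π.pairing P Q) S n + wedge (parity Q) (π.pairing P S) n) := by
  induction n generalizing P Q S with
  | zero =>
    rw [wedge_parity_apply_zero, pairing_wedge_apply_zero]
    exact ⟨fun _ => rfl, fun _ => rfl⟩
  | succ n ih =>
    simp only [← DirectSum.add_apply] at ih ⊢
    refine ⟨fun hP => apply_succ_eq_of_contract fun Y => ?_,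
      fun hP => apply_succ_eq_of_contract fun Y => ?_⟩
    · simp only [contract_pairing, contract_wedge, map_add, DirectSum.sub_apply,
        DirectSum.add_apply, hP.parity_eq, (ih P _ _).1 hP, (ih _ _ _).2 (hP.contract Y),
        parity_pairing, wedge_sub_left, map_sub]
      abel
    · simp only [contract_pairing, contract_wedge, map_add, DirectSum.sub_apply,
        DirectSum.add_apply, hP.parity_eq, (ih P _ _).2 hP, (ih _ _ _).1 (hP.contract Y),
        parity_pairing, wedge_sub_left, map_sub, pairing_neg_left, neg_component, parity_parity,
        wedge_neg_left, map_neg, contract_parity]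
      abel

theorem pairing_wedge_of_isEven {P : ExtForms R V} (hP : IsEven P) (Q S : ExtForms R V) :
    π.pairing P (wedge Q S) = wedge (π.pairing P Q) S + wedge Q (π.pairing P S) :=
  DFinsupp.ext fun n => (π.pairing_wedge_apply P Q S n).1 hP

theorem pairing_wedge_of_isOdd {P : ExtForms R V} (hP : IsOdd P) (Q S : ExtForms R V) :
    π.pairing P (wedge Q S) = wedge (π.pairing P Q) S + wedge (parity Q) (π.pairing P S) :=
  DFinsupp.ext fun n => (π.pairing_wedge_apply P Q S n).2 hP

end GradedDerivation

end Bivector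

/-! ### The Schouten bracket of `A*_π` -/

namespace AlmostLieAlgebroid

open ExtForms

section Schouten

variable {R B : Type*} [CommRing R] [Algebra ℝ R] [AddCommGroup B] [Module R B]
  [Module ℝ B] [IsScalarTower ℝ R B] (A : AlmostLieAlgebroid R B)

theorem isEven_koszul {P : ExtForms R B} (hP : IsOdd P) : IsEven (A.koszul P) := by
  rw [IsEven, parity_koszul, hP.parity_eq, map_neg]
  abel

theorem isOdd_koszul {P : ExtForms R B} (hP : IsEven P) : IsOdd (A.koszul P) := by
  rw [IsOdd, parity_koszul, hP.parity_eq]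

theorem lie_fn0 (X : B) (f : R) : A.lie X (fn0 f) = fn0 (A.anchor X f) := by
  refine ext_contract ?_ fun Y => ?_
  · ext v
    rw [lie_apply_zero, fn0_apply_zero, fn0_apply_zero]
  · rw [contract_lie, contract_fn0, contract_fn0, contract_fn0, map_zero, sub_zero]

theorem lie_form1 (X : B) (α : Module.Dual R B) :
    A.lie X (form1 α) = form1 (A.lieDer X α) := by
  refine ext_contract ?_ fun Y => ?_
  · ext v
    rw [lie_apply_zero, form1_apply_zero, form1_apply_zero, AlternatingMap.zero_apply, map_zero]
  · rw [contract_lie, contract_form1, contract_form1, contract_form1, lie_fn0, sub_eq_add_neg,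
      ← fn0_neg, ← fn0_add, ← sub_eq_add_neg]
    rfl

variable (π : Bivector R B)

/-- The graded commutator of the Koszul differential with the pairing induced by a bivector. It is
the Schouten bracket of the dual algebroid `A.cotangent π`. -/
def schouten : ExtForms R B →ₗ[ℝ] ExtForms R B →ₗ[ℝ] ExtForms R B :=
  LinearMap.mk₂ ℝ (fun P Q => A.koszul (π.pairing P Q) + π.pairing (A.koszul P) Q -
      π.pairing (parity P) (A.koszul Q))
    (fun P P' Q => by simp only [map_add, LinearMap.add_apply]; abel)
    (fun c P Q => by
      simp only [LinearMap.map_smul_of_tower, map_smul, LinearMap.smul_apply, smul_add, smul_sub])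
    (fun P Q Q' => by simp only [map_add]; abel)
    (fun c P Q => by
      simp only [LinearMap.map_smul_of_tower, map_smul, smul_add, smul_sub])

theorem schouten_apply (P Q : ExtForms R B) :
    A.schouten π P Q = A.koszul (π.pairing P Q) + π.pairing (A.koszul P) Q -
      π.pairing (parity P) (A.koszul Q) := rfl

theorem schouten_neg_left (P Q : ExtForms R B) : A.schouten π (-P) Q = -A.schouten π P Q := by
  simp only [schouten_apply, map_neg, π.pairing_neg_left]
  abel

theorem parity_schouten (P Q : ExtForms R B) :
    parity (A.schouten π P Q) = -A.schouten π (parity P) (parity Q) := by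
  simp only [schouten_apply, map_add, map_sub, parity_koszul, π.parity_pairing, π.pairing_neg_left,
    map_neg]
  abel

theorem schouten_symm_of_isOdd {P : ExtForms R B} (hP : IsOdd P) (Q : ExtForms R B) :
    A.schouten π P Q = -A.schouten π Q P := by
  rw [schouten_apply, schouten_apply, hP.parity_eq, π.pairing_neg_left, π.pairing_symm_of_isOdd hP,
    π.pairing_symm_of_isOdd hP, π.pairing_symm_of_isEven (A.isEven_koszul hP), map_neg]
  abel

theorem schouten_symm_of_isEven {P : ExtForms R B} (hP : IsEven P) (Q : ExtForms R B) :
    A.schouten π P Q = A.schouten π (parity Q) P := by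
  rw [schouten_apply, schouten_apply, hP.parity_eq, parity_parity, π.pairing_symm_of_isEven hP,
    π.pairing_symm_of_isEven hP, π.pairing_symm_of_isOdd (A.isOdd_koszul hP), parity_koszul,
    π.pairing_neg_left]
  abel

theorem schouten_wedge_of_isOdd {P : ExtForms R B} (hP : IsOdd P) (Q S : ExtForms R B) :
    A.schouten π P (wedge Q S) = wedge (A.schouten π P Q) S + wedge Q (A.schouten π P S) := by
  simp only [schouten_apply, hP.parity_eq, π.pairing_neg_left, π.pairing_wedge_of_isOdd hP,
    π.pairing_wedge_of_isEven (A.isEven_koszul hP), koszul_wedge, parity_koszul, π.parity_pairing,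
    parity_parity, wedge_neg_left, wedge_sub_left, map_add, map_neg, map_sub, LinearMap.add_apply]
  abel

theorem schouten_wedge_of_isEven {P : ExtForms R B} (hP : IsEven P) (Q S : ExtForms R B) :
    A.schouten π P (wedge Q S) =
      wedge (A.schouten π P Q) S + wedge (parity Q) (A.schouten π P S) := by
  simp only [schouten_apply, hP.parity_eq, π.pairing_wedge_of_isEven hP,
    π.pairing_wedge_of_isOdd (A.isOdd_koszul hP), koszul_wedge, π.parity_pairing, wedge_sub_left,
    map_add, map_sub, LinearMap.add_apply]
  abel

theorem schouten_homog_apply_of_ne {p q n : ℕ} (h : n + 1 ≠ p + q) (P : B [⋀^Fin p]→ₗ[R] R)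
    (Q : B [⋀^Fin q]→ₗ[R] R) : A.schouten π (homog p P) (homog q Q) n = 0 := by
  have hkoszul : A.koszul (π.pairing (homog p P) (homog q Q)) n = 0 := by
    cases n with
    | zero => exact A.koszul_apply_zero _
    | succ n =>
      rw [koszul_apply]
      exact A.koszulComponent_succ_eq_zero n _ (π.pairing_homog_apply_of_ne (by lia) P Q)
  rw [schouten_apply, DirectSum.sub_apply, DirectSum.add_apply, hkoszul, parity_homog, map_smul,
    LinearMap.smul_apply, DirectSum.smul_apply, koszul_homog, koszul_homog,
    π.pairing_homog_apply_of_ne (by lia), π.pairing_homog_apply_of_ne (by lia), smul_zero,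
    add_zero, sub_zero]

theorem schouten_fn0 (f : R) (Q : ExtForms R B) :
    A.schouten π (fn0 f) Q = contract (π.sharp (A.diffFn f)) Q := by
  rw [schouten_apply, parity_fn0, π.pairing_fn0_left, π.pairing_fn0_left, koszul_fn0,
    π.pairing_form1_left, map_zero, zero_add, sub_zero]

theorem schouten_form1 (α : Module.Dual R B) (Q : ExtForms R B) :
    A.schouten π (form1 α) Q = A.lie (π.sharp α) Q + π.pairing (A.koszul (form1 α)) Q := by
  rw [schouten_apply, parity_form1, π.pairing_neg_left, π.pairing_form1_left,
    π.pairing_form1_left, contract_koszul]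
  abel

theorem schouten_form1_fn0 (α : Module.Dual R B) (f : R) :
    A.schouten π (form1 α) (fn0 f) = fn0 ((A.cotangent π).anchor α f) := by
  rw [schouten_form1, lie_fn0, π.pairing_symm_of_isEven (A.isEven_koszul (parity_form1 α)),
    parity_fn0, π.pairing_fn0_left, add_zero]
  rfl

theorem schouten_form1_form1 (α β : Module.Dual R B) :
    A.schouten π (form1 α) (form1 β) = form1 ((A.cotangent π).bracket α β) := by
  have hdiff : A.diffFn (α (π.sharp β)) = -A.diffFn (π.toForm ![α, β]) := by
    rw [← π.apply_sharp, π.apply_sharp_swap α β]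
    ext X
    exact map_neg (A.anchor X) _
  have hbracket : (A.cotangent π).bracket α β =
    A.lieDer (π.sharp α) β - A.lieDer (π.sharp β) α - A.diffFn (π.toForm ![α, β]) := rfl
  rw [schouten_form1, lie_form1, π.pairing_symm_of_isEven (A.isEven_koszul (parity_form1 α)),
    parity_form1, π.pairing_neg_left, π.pairing_form1_left, contract_koszul, contract_form1,
    lie_form1, koszul_fn0, ← form1_sub, ← form1_neg, ← form1_add, hdiff, hbracket]
  congr 1
  abel

theorem schouten_homog_symm (p q : ℕ) (P : B [⋀^Fin p]→ₗ[R] R) (Q : B [⋀^Fin q]→ₗ[R] R) :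
    A.schouten π (homog p P) (homog q Q) =
      -((-1 : ℝ) ^ ((p + 1) * (q + 1)) • A.schouten π (homog q Q) (homog p P)) := by
  rw [neg_one_pow_real_smul]
  rcases Nat.even_or_odd p with hp | hp
  · rw [schouten_symm_of_isEven _ _ (isEven_homog hp P)]
    rcases Nat.even_or_odd q with hq | hq
    · rw [(isEven_homog hq Q).parity_eq, (hp.add_one.mul hq.add_one).neg_one_pow,
        neg_one_smul_eq_neg]
      abel
    · rw [(isOdd_homog hq Q).parity_eq, (hq.add_one.mul_left _).neg_one_pow, one_smul,
        schouten_neg_left]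
  · rw [schouten_symm_of_isOdd _ _ (isOdd_homog hp P), (hp.add_one.mul_right _).neg_one_pow,
      one_smul]

theorem schouten_homog_wedge (p q : ℕ) (P : B [⋀^Fin p]→ₗ[R] R) (Q : B [⋀^Fin q]→ₗ[R] R)
    (S : ExtForms R B) :
    A.schouten π (homog p P) (wedge (homog q Q) S) =
      wedge (A.schouten π (homog p P) (homog q Q)) S +
        (-1 : ℝ) ^ ((p + 1) * q) • wedge (homog q Q) (A.schouten π (homog p P) S) := by
  rw [neg_one_pow_real_smul]
  rcases Nat.even_or_odd p with hp | hp
  · rw [schouten_wedge_of_isEven _ _ (isEven_homog hp P), parity_homog, map_smul,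
      LinearMap.smul_apply, pow_mul, hp.add_one.neg_one_pow]
  · rw [schouten_wedge_of_isOdd _ _ (isOdd_homog hp P), (hp.add_one.mul_right _).neg_one_pow,
      one_smul]

theorem isSchoutenBracket_schouten :
    IsSchoutenBracket (A.cotangent π) LinearMap.id (A.schouten π) where
  degree _ _ P Q _ h := A.schouten_homog_apply_of_ne π h P Q
  skew p q P Q := A.schouten_homog_symm π p q P Q
  leibniz p q P Q S := A.schouten_homog_wedge π p q P Q S
  sections α β := A.schouten_form1_form1 π α β
  function α f := A.schouten_form1_fn0 π α f

end Schouten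

end AlmostLieAlgebroid

section Frames

variable (R V : Type*) [CommRing R] [AddCommGroup V] [Module R V]

/-- The multiplication by `χ` has finite rank. For sections of a vector bundle, this holds when `χ`
is supported in the domain of a local frame. -/
def IsFrameFunction (χ : R) : Prop :=
  ∃ (n : ℕ) (e : Fin n → V) (ε : Fin n → Module.Dual R V), ∀ X, χ • X = ∑ i, ε i X • e i

/-- There are enough functions for which multiplication has finite rank to detect zero functions and
zero sections. This algebraic substitute for local frames replaces all localization arguments. -/
structure HasLocalFrames : Prop where
  eq_zero_of_mul : ∀ r : R, (∀ χ, IsFrameFunction R V χ → χ * r = 0) → r = 0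
  eq_zero_of_smul : ∀ X : V, (∀ χ, IsFrameFunction R V χ → χ • X = 0) → X = 0

variable {R V}

theorem HasLocalFrames.ext_dual (hV : HasLocalFrames R V) {X Y : V}
    (h : ∀ α : Module.Dual R V, α X = α Y) : X = Y := by
  refine sub_eq_zero.1 (hV.eq_zero_of_smul _ ?_)
  rintro χ ⟨n, e, ε, hχ⟩
  rw [hχ]
  exact Finset.sum_eq_zero fun i _ => by rw [map_sub, h, sub_self, zero_smul]

end Frames

namespace ExtForms

variable {R V : Type*} [CommRing R] [AddCommGroup V] [Module R V] {χ : R} {m : ℕ} {e : Fin m → V}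
  {ε : Fin m → Module.Dual R V}

theorem smul_contract_eq_sum (h : ∀ X, χ • X = ∑ i, ε i X • e i) (θ : ExtForms R V) (X : V) :
    χ • contract X θ = ∑ i, ε i X • contract (e i) θ := by
  rw [← LinearMap.smul_apply, ← map_smul, h X, map_sum, LinearMap.sum_apply]
  exact Finset.sum_congr rfl fun i _ => by rw [map_smul, LinearMap.smul_apply]

theorem contract_sum_form1_wedge_contract [IsAddTorsionFree R]
    (h : ∀ X, χ • X = ∑ i, ε i X • e i) (θ : ExtForms R V) (X : V) :
    contract X (∑ i, wedge (form1 (ε i)) (contract (e i) θ)) =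
      χ • contract X θ + ∑ i, wedge (form1 (ε i)) (contract (e i) (contract X θ)) := by
  rw [map_sum, smul_contract_eq_sum h, ← Finset.sum_add_distrib]
  refine Finset.sum_congr rfl fun i _ => ?_
  rw [contract_form1_wedge, contract_contract X, map_neg]
  abel

/- Up to the factor `χ`, this is Euler's formula `∑ εⁱ ∧ ι_{eᵢ} θ = (deg θ) θ` for a frame. -/
theorem sum_form1_wedge_contract_apply [IsAddTorsionFree R] (h : ∀ X, χ • X = ∑ i, ε i X • e i)
    (θ : ExtForms R V) (n : ℕ) :
    (∑ i, wedge (form1 (ε i)) (contract (e i) θ)) n = ((n : R) * χ) • θ n := by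
  induction n generalizing θ with
  | zero =>
    rw [DirectSum.sum_apply, Nat.cast_zero, zero_mul, zero_smul]
    exact Finset.sum_eq_zero fun i _ => form1_wedge_apply_zero _ _
  | succ n ih =>
    ext v
    rw [apply_succ_apply, contract_sum_form1_wedge_contract h, DirectSum.add_apply, ih,
      AlternatingMap.smul_apply, apply_succ_apply θ, DirectSum.smul_apply,
      AlternatingMap.add_apply, AlternatingMap.smul_apply, AlternatingMap.smul_apply]
    simp only [smul_eq_mul]
    push_cast
    ring

theorem sum_form1_wedge_contract_homog [IsAddTorsionFree R] (h : ∀ X, χ • X = ∑ i, ε i X • e i)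
    (k : ℕ) (η : V [⋀^Fin k]→ₗ[R] R) :
    ∑ i, wedge (form1 (ε i)) (contract (e i) (homog k η)) = ((k : R) * χ) • homog k η := by
  refine DFinsupp.ext fun n => ?_
  rw [sum_form1_wedge_contract_apply h, DirectSum.smul_apply]
  by_cases hn : k = n
  · subst hn; rfl
  · rw [homog_apply_of_ne hn, smul_zero, smul_zero]

/- A derivation of forms vanishing on generators vanishes: by Euler's formula, a multiple of a form
of positive degree is a sum of products of forms of lower degree. -/
theorem derivation_eq_zero [IsAddTorsionFree R] (hV : HasLocalFrames R V)
    (D : ExtForms R V →+ ExtForms R V) (τ : ExtForms R V → ExtForms R V)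
    (hτ : ∀ f, τ (fn0 f) = fn0 f)
    (hD : ∀ Q S, D (wedge Q S) = wedge (D Q) S + wedge (τ Q) (D S))
    (hfn : ∀ f, D (fn0 f) = 0) (hform : ∀ α, D (form1 α) = 0) (θ : ExtForms R V) : D θ = 0 := by
  have hsmul : ∀ (f : R) (S : ExtForms R V), D (f • S) = f • D S := fun f S => by
    rw [← fn0_wedge, hD, hfn, hτ, fn0_wedge, map_zero, LinearMap.zero_apply, zero_add]
  induction θ using induction_homog with
  | add θ η h h' => rw [map_add, h, h', add_zero]
  | homog k η =>
  induction k with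
  | zero => rw [homog_zero_eq_fn0, hfn]
  | succ k ih =>
    refine DFinsupp.ext fun n => AlternatingMap.ext fun v => hV.eq_zero_of_mul _ ?_
    rintro χ ⟨m, e, ε, h⟩
    have heuler : (((k + 1 : ℕ) : R) * χ) • D (homog (k + 1) η) = 0 := by
      rw [← hsmul, ← sum_form1_wedge_contract_homog h, map_sum]
      refine Finset.sum_eq_zero fun i _ => ?_
      rw [hD, hform, contract_homog_succ, ih, map_zero, map_zero, LinearMap.zero_apply, zero_add]
    have hcomponent : (((k + 1 : ℕ) : R) * χ) * D (homog (k + 1) η) n v = 0 :=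
      congrArg (fun θ => θ n v) heuler
    rw [mul_assoc, ← nsmul_eq_mul] at hcomponent
    exact (nsmul_eq_zero_iff_right k.succ_ne_zero).1 hcomponent

end ExtForms

namespace AlmostLieAlgebroid

open ExtForms

variable {R B : Type*} [CommRing R] [Algebra ℝ R] [AddCommGroup B] [Module R B]
  [Module ℝ B] [IsScalarTower ℝ R B]

section Defect

variable (A A' : AlmostLieAlgebroid R B) (π : Bivector R B)

/-- The failure of the Koszul differential of `A'` to be a derivation of the Schouten bracket of
`A.cotangent π`. -/
def schoutenDefect : ExtForms R B →ₗ[ℝ] ExtForms R B →ₗ[ℝ] ExtForms R B :=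
  LinearMap.mk₂ ℝ (fun P Q => A'.koszul (A.schouten π P Q) - A.schouten π (A'.koszul P) Q +
      A.schouten π (parity P) (A'.koszul Q))
    (fun P P' Q => by simp only [map_add, LinearMap.add_apply]; abel)
    (fun c P Q => by
      simp only [LinearMap.map_smul_of_tower, map_smul, LinearMap.smul_apply, smul_add, smul_sub])
    (fun P Q Q' => by simp only [map_add]; abel)
    (fun c P Q => by simp only [map_smul, smul_add, smul_sub])

theorem schoutenDefect_apply (P Q : ExtForms R B) :
    schoutenDefect A A' π P Q = A'.koszul (A.schouten π P Q) - A.schouten π (A'.koszul P) Q +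
      A.schouten π (parity P) (A'.koszul Q) := rfl

theorem schoutenDefect_neg_left (P Q : ExtForms R B) :
    schoutenDefect A A' π (-P) Q = -schoutenDefect A A' π P Q := by
  simp only [schoutenDefect_apply, schouten_neg_left, map_neg]
  abel

theorem schoutenDefect_symm_of_isOdd {P : ExtForms R B} (hP : IsOdd P) (Q : ExtForms R B) :
    schoutenDefect A A' π P Q = -schoutenDefect A A' π Q P := by
  rw [schoutenDefect_apply, schoutenDefect_apply, hP.parity_eq, schouten_neg_left,
    schouten_symm_of_isOdd A π hP, schouten_symm_of_isOdd A π hP,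
    schouten_symm_of_isEven A π (A'.isEven_koszul hP), map_neg]
  abel

theorem schoutenDefect_symm_of_isEven {P : ExtForms R B} (hP : IsEven P) (Q : ExtForms R B) :
    schoutenDefect A A' π P Q = schoutenDefect A A' π (parity Q) P := by
  rw [schoutenDefect_apply, schoutenDefect_apply, hP.parity_eq, parity_parity,
    schouten_symm_of_isEven A π hP, schouten_symm_of_isEven A π hP,
    schouten_symm_of_isOdd A π (A'.isOdd_koszul hP), parity_koszul, schouten_neg_left]
  abel

theorem schoutenDefect_wedge_of_isOdd {P : ExtForms R B} (hP : IsOdd P) (Q S : ExtForms R B) :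
    schoutenDefect A A' π P (wedge Q S) =
      wedge (schoutenDefect A A' π P Q) S + wedge (parity Q) (schoutenDefect A A' π P S) := by
  simp only [schoutenDefect_apply, hP.parity_eq, schouten_neg_left,
    schouten_wedge_of_isOdd A π hP, schouten_wedge_of_isEven A π (A'.isEven_koszul hP),
    koszul_wedge, parity_schouten, wedge_neg_left, wedge_sub_left, map_add, map_sub, map_neg,
    LinearMap.add_apply]
  abel

theorem schoutenDefect_wedge_of_isEven {P : ExtForms R B} (hP : IsEven P) (Q S : ExtForms R B) :
    schoutenDefect A A' π P (wedge Q S) =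
      wedge (schoutenDefect A A' π P Q) S + wedge Q (schoutenDefect A A' π P S) := by
  simp only [schoutenDefect_apply, hP.parity_eq, schouten_wedge_of_isEven A π hP,
    schouten_wedge_of_isOdd A π (A'.isOdd_koszul hP), koszul_wedge, parity_schouten,
    parity_koszul, parity_parity, wedge_neg_left, wedge_sub_left, map_add, map_sub,
    LinearMap.add_apply]
  abel

variable {A A' π}

theorem schoutenDefect_eq_zero_of_isOdd (hV : HasLocalFrames R B) {P : ExtForms R B}
    (hP : IsOdd P) (hfn : ∀ f, schoutenDefect A A' π P (fn0 f) = 0)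
    (hform : ∀ α, schoutenDefect A A' π P (form1 α) = 0) : schoutenDefect A A' π P = 0 :=
  LinearMap.ext <| derivation_eq_zero hV (schoutenDefect A A' π P).toAddMonoidHom parity parity_fn0
    (schoutenDefect_wedge_of_isOdd A A' π hP) hfn hform

theorem schoutenDefect_eq_zero_of_isEven (hV : HasLocalFrames R B) {P : ExtForms R B}
    (hP : IsEven P) (hfn : ∀ f, schoutenDefect A A' π P (fn0 f) = 0)
    (hform : ∀ α, schoutenDefect A A' π P (form1 α) = 0) : schoutenDefect A A' π P = 0 :=
  LinearMap.ext <| derivation_eq_zero hV (schoutenDefect A A' π P).toAddMonoidHom id (fun _ => rfl)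
    (schoutenDefect_wedge_of_isEven A A' π hP) hfn hform

theorem schoutenDefect_eq_zero (hV : HasLocalFrames R B)
    (hff : ∀ f g, schoutenDefect A A' π (fn0 f) (fn0 g) = 0)
    (hαf : ∀ α f, schoutenDefect A A' π (form1 α) (fn0 f) = 0)
    (hαβ : ∀ α β, schoutenDefect A A' π (form1 α) (form1 β) = 0) :
    schoutenDefect A A' π = 0 := by
  have hform_left : ∀ α, schoutenDefect A A' π (form1 α) = 0 := fun α =>
    schoutenDefect_eq_zero_of_isOdd hV (parity_form1 α) (hαf α) (hαβ α)
  have hfn_left : ∀ f, schoutenDefect A A' π (fn0 f) = 0 := fun f =>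
    schoutenDefect_eq_zero_of_isEven hV (parity_fn0 f) (hff f) fun α => by
      rw [schoutenDefect_symm_of_isEven A A' π (parity_fn0 f), parity_form1,
        schoutenDefect_neg_left, hαf, neg_zero]
  have hfn : ∀ P f, schoutenDefect A A' π P (fn0 f) = 0 := fun P f => by
    rw [← parity_parity P, ← schoutenDefect_symm_of_isEven A A' π (parity_fn0 f), hfn_left,
      LinearMap.zero_apply]
  have hform : ∀ P α, schoutenDefect A A' π P (form1 α) = 0 := fun P α => by
    rw [← neg_eq_zero, ← schoutenDefect_symm_of_isOdd A A' π (parity_form1 α), hform_left,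
      LinearMap.zero_apply]
  refine LinearMap.ext fun P => ?_
  induction P using induction_homog with
  | add P P' h h' => rw [map_add, h, h', ← map_add]
  | homog p P =>
    rcases Nat.even_or_odd p with hp | hp
    · exact schoutenDefect_eq_zero_of_isEven hV (isEven_homog hp P) (hfn _) (hform _)
    · exact schoutenDefect_eq_zero_of_isOdd hV (isOdd_homog hp P) (hfn _) (hform _)

theorem koszul_koszul_eq_schouten (hV : HasLocalFrames R B) {φ : ExtForms R B} (hφ : IsOdd φ)
    (hfn : ∀ f, A'.koszul (A'.koszul (fn0 f)) = A.schouten π φ (fn0 f))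
    (hform : ∀ α, A'.koszul (A'.koszul (form1 α)) = A.schouten π φ (form1 α)) :
    A'.koszul ∘ₗ A'.koszul = A.schouten π φ := by
  refine LinearMap.ext fun S => sub_eq_zero.1 ?_
  refine derivation_eq_zero hV
    (AddMonoidHom.mk' (fun S => A'.koszul (A'.koszul S) - A.schouten π φ S)
      fun Q S => by simp only [map_add]; abel)
    id (fun _ => rfl) (fun Q S => ?_) (fun f => sub_eq_zero.2 (hfn f))
    (fun α => sub_eq_zero.2 (hform α)) S
  simp only [AddMonoidHom.mk'_apply, koszul_wedge, schouten_wedge_of_isOdd A π hφ,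
    parity_koszul, parity_parity, wedge_neg_left, wedge_sub_left, map_add, map_sub, id]
  abel

end Defect

end AlmostLieAlgebroid

namespace AlmostLieAlgebroid

open ExtForms

variable {R B : Type*} [CommRing R] [Algebra ℝ R] [AddCommGroup B] [Module R B]
  [Module ℝ B] [IsScalarTower ℝ R B] (A : AlmostLieAlgebroid R B)

section Diff

theorem diff_zero (η : (Fin 0 → B) → R) (X : Fin 1 → B) :
    A.diff η X = A.anchor (X 0) (η ![]) := by
  have hIoi : Finset.Ioi (0 : Fin 1) = ∅ := rfl
  rw [diff, Fin.sum_univ_one, hIoi, Finset.sum_empty, sub_zero, Fin.val_zero, pow_zero, one_mul,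
    Subsingleton.elim (Fin.removeNth 0 X) ![]]

theorem diff_vecCons {k : ℕ} (η : (Fin (k + 1) → B) → R) (X : B) (v : Fin (k + 1) → B) :
    A.diff η (Matrix.vecCons X v) =
      A.anchor X (η v) - ∑ j, η (Function.update v j (A.bracket X (v j))) -
        A.diff (fun w => η (Matrix.vecCons X w)) v := by
  have hzero : Finset.Ioi (0 : Fin (k + 2)) = Finset.univ.map (Fin.succEmb (k + 1)) :=
    Fin.Ioi_zero_eq_map
  have hsucc : ∀ i : Fin (k + 1),
      Finset.Ioi i.succ = (Finset.Ioi i).map (Fin.succEmb (k + 1)) := fun i => by simp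
  have hremove : ∀ (i : Fin (k + 1)) (w : Fin (k + 1) → B),
      i.succ.removeNth (Matrix.vecCons X w) = Matrix.vecCons X (i.removeNth w) :=
    fun i w => funext <| Fin.cases rfl fun m => by simp [Fin.removeNth]
  have hupdate : ∀ (j : Fin (k + 1)) (Y : B), Function.update (Matrix.vecCons X v) j.succ Y =
      Matrix.vecCons X (Function.update v j Y) := fun j Y =>
    (Fin.cons_update (α := fun _ => B) X v j Y).symm
  have htail : ∀ w : Fin (k + 1) → B, Fin.removeNth 0 (Matrix.vecCons X w) = w :=
    fun w => by rw [Fin.removeNth_zero]; rfl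
  rw [diff, Fin.sum_univ_succ, sub_eq_add_neg _ (diff _ _ _), diff, ← Finset.sum_neg_distrib,
    hzero, Finset.sum_map]
  simp only [hsucc, Finset.sum_map, Fin.coe_succEmb, hupdate, htail, hremove, Matrix.cons_val_zero,
    Matrix.cons_val_succ, Fin.val_zero, pow_zero, one_mul, Fin.val_succ, pow_succ, mul_neg_one,
    neg_mul]

theorem koszul_homog_apply (k : ℕ) (η : B [⋀^Fin k]→ₗ[R] R) (X : Fin (k + 1) → B) :
    A.koszul (homog k η) (k + 1) X = A.diff η X := by
  induction k with
  | zero => rw [homog_zero_eq_fn0, koszul_fn0, form1_apply_one, diff_zero, diffFn_apply]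
  | succ k ih =>
    have hX : X = Matrix.vecCons (X 0) (Fin.tail X) := (Fin.cons_self_tail X).symm
    rw [apply_succ_apply, contract_koszul, DirectSum.sub_apply, AlternatingMap.sub_apply,
      contract_homog_succ, ih, lie_apply, homog_apply_self, hX, diff_vecCons]
    rfl

theorem diff_two (η : (Fin 2 → B) → R) (X Y Z : B) :
    A.diff η ![X, Y, Z] =
      A.anchor X (η ![Y, Z]) - η ![A.bracket X Y, Z] - η ![Y, A.bracket X Z] -
      (A.anchor Y (η ![X, Z]) - η ![X, A.bracket Y Z]) + A.anchor Z (η ![X, Y]) := by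
  simp only [diff_vecCons, diff_zero]
  simp only [Fin.sum_univ_succ, Finset.univ_eq_empty, Finset.sum_empty,
    Matrix.vecCons, ← Fin.cons_update, Fin.update_cons_zero, Fin.cons_zero, Fin.cons_succ]
  ring

theorem diff_three (η : (Fin 3 → B) → R) (X Y Z W : B) :
    A.diff η ![X, Y, Z, W] =
      A.anchor X (η ![Y, Z, W]) - η ![A.bracket X Y, Z, W] - η ![Y, A.bracket X Z, W] -
        η ![Y, Z, A.bracket X W] -
      (A.anchor Y (η ![X, Z, W]) - η ![X, A.bracket Y Z, W] - η ![X, Z, A.bracket Y W]) +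
      (A.anchor Z (η ![X, Y, W]) - η ![X, Y, A.bracket Z W]) - A.anchor W (η ![X, Y, Z]) := by
  simp only [diff_vecCons, diff_zero]
  simp only [Fin.sum_univ_succ, Finset.univ_eq_empty, Finset.sum_empty,
    Matrix.vecCons, ← Fin.cons_update, Fin.update_cons_zero, Fin.cons_zero, Fin.cons_succ]
  ring

end Diff

section LowDegree

theorem lieDer_apply (X : B) (β : Module.Dual R B) (Y : B) :
    A.lieDer X β Y = A.anchor X (β Y) - β (A.bracket X Y) := rfl

/-- The contraction `i_X dα` of the differential of a `1`-form. -/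
def dOne (α : Module.Dual R B) (X : B) : Module.Dual R B := A.lieDer X α - A.diffFn (α X)

theorem dOne_apply (α : Module.Dual R B) (X Y : B) :
    A.dOne α X Y = A.anchor X (α Y) - α (A.bracket X Y) - A.anchor Y (α X) := rfl

theorem dOne_swap (α : Module.Dual R B) (X Y : B) : A.dOne α X Y = -A.dOne α Y X := by
  rw [dOne_apply, dOne_apply, A.bracket_swap X Y, map_neg]; ring

theorem contract_koszul_form1 (α : Module.Dual R B) (X : B) :
    contract X (A.koszul (form1 α)) = form1 (A.dOne α X) := by
  rw [contract_koszul, contract_form1, lie_form1, koszul_fn0, ← form1_sub]; rfl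

theorem koszul_form1_apply (α : Module.Dual R B) (X Y : B) :
    A.koszul (form1 α) 2 ![X, Y] = A.dOne α X Y := by
  have h := contract_apply_apply X (A.koszul (form1 α)) 1 ![Y]
  rw [contract_koszul_form1, form1_apply_one] at h
  exact h.symm

theorem cotangent_anchor_apply (π : Bivector R B) (α : Module.Dual R B) :
    (A.cotangent π).anchor α = A.anchor (π.sharp α) := rfl

theorem cotangent_bracket_apply (π : Bivector R B) (α β : Module.Dual R B) (X : B) :
    (A.cotangent π).bracket α β X =
      A.anchor (π.sharp α) (β X) - β (A.bracket (π.sharp α) X) -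
      (A.anchor (π.sharp β) (α X) - α (A.bracket (π.sharp β) X)) -
      A.anchor X (β (π.sharp α)) := by
  rw [π.apply_sharp]; rfl

end LowDegree

end AlmostLieAlgebroid

namespace ExtForms

variable {R V : Type*} [CommRing R] [AddCommGroup V] [Module R V] [IsAddTorsionFree R]

theorem form1_wedge_fn0 (α : Module.Dual R V) (f : R) :
    wedge (form1 α) (fn0 f) = f • form1 α := by
  refine ext_contract ?_ fun X => ?_
  · rw [form1_wedge_apply_zero, DirectSum.smul_apply, form1_apply_zero, smul_zero]
  · rw [contract_form1_wedge, contract_fn0, map_zero, sub_zero, map_smul, contract_form1,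
      ← fn0_mul, ← fn0_mul, mul_comm]

theorem contract_form1_wedge_form1 (α β : Module.Dual R V) (X : V) :
    contract X (wedge (form1 α) (form1 β)) = α X • form1 β - β X • form1 α := by
  rw [contract_form1_wedge, contract_form1, form1_wedge_fn0]

theorem form1_wedge_form1_apply (α β : Module.Dual R V) (X Y : V) :
    wedge (form1 α) (form1 β) 2 ![X, Y] = α X * β Y - β X * α Y := by
  have h := contract_apply_apply X (wedge (form1 α) (form1 β)) 1 ![Y]
  rw [contract_form1_wedge_form1, DirectSum.sub_apply, DirectSum.smul_apply, DirectSum.smul_apply,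
    AlternatingMap.sub_apply, AlternatingMap.smul_apply, AlternatingMap.smul_apply,
    form1_apply_one, form1_apply_one] at h
  exact h.symm

end ExtForms

namespace Bivector

open ExtForms

variable {R B : Type*} [CommRing R] [AddCommGroup B] [Module R B] (π : Bivector R B)

theorem contract_homog_toForm (α : Module.Dual R B) :
    contract α (homog 2 π.toForm) = form1 (Module.Dual.eval R B (π.sharp α)) := by
  rw [contract_homog_succ, form1]
  congr 1
  ext v
  have hv : v = ![v 0] := funext fun i => by rw [Subsingleton.elim i 0]; rfl
  rw [AlternatingMap.curryLeft_apply_apply, hv]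
  exact (π.apply_sharp α (v 0)).symm

variable [IsAddTorsionFree R]

theorem two_mul_smul_homog_toForm {χ : R} {n : ℕ} {e : Fin n → B} {ε : Fin n → Module.Dual R B}
    (h : ∀ X, χ • X = ∑ i, ε i X • e i) :
    (2 * χ) • homog 2 π.toForm = ∑ i, wedge (form1 (Module.Dual.eval R B (e i)))
      (form1 (Module.Dual.eval R B (π.sharp (ε i)))) := by
  have hdual : ∀ α : Module.Dual R B, χ • α = ∑ i, Module.Dual.eval R B (e i) α • ε i := fun α => by
    ext X
    rw [LinearMap.smul_apply, ← map_smul, h X, map_sum, LinearMap.sum_apply]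
    exact Finset.sum_congr rfl fun i _ => by
      rw [map_smul, LinearMap.smul_apply, smul_eq_mul, smul_eq_mul, mul_comm,
        Module.Dual.eval_apply]
  have heuler := sum_form1_wedge_contract_homog hdual 2 π.toForm
  simp only [contract_homog_toForm] at heuler
  exact_mod_cast heuler.symm

/- Locally a bivector is a sum of products of two sections, hence an additive map vanishing on such
products vanishes on it, provided that it commutes with multiplying the bivector by functions. -/
theorem map_homog_toForm_eq_zero (hV : HasLocalFrames R B)
    (D : ExtForms R (Module.Dual R B) →+ R)
    (hsmul : ∀ f : R, D (f • homog 2 π.toForm) = f * D (homog 2 π.toForm))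
    (hwedge : ∀ X Y, D (wedge (form1 (Module.Dual.eval R B X))
      (form1 (Module.Dual.eval R B Y))) = 0) : D (homog 2 π.toForm) = 0 := by
  refine hV.eq_zero_of_mul _ ?_
  rintro χ ⟨n, e, ε, he⟩
  have hsum : 2 • (χ * D (homog 2 π.toForm)) = 0 := by
    rw [nsmul_eq_mul, ← mul_assoc, Nat.cast_ofNat, ← hsmul, π.two_mul_smul_homog_toForm he, map_sum]
    exact Finset.sum_eq_zero fun i _ => hwedge _ _
  exact (nsmul_eq_zero_iff_right two_ne_zero).1 hsum

end Bivector

namespace IsSchoutenBracket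

open ExtForms

section General

variable {R B C : Type*} [CommRing R] [Algebra ℝ R] [AddCommGroup B] [Module R B]
  [Module ℝ B] [IsScalarTower ℝ R B] [AddCommGroup C] [Module R C] {A : AlmostLieAlgebroid R B}
  {pair : B →ₗ[R] Module.Dual R C}
  {br : ExtForms R C →ₗ[ℝ] ExtForms R C →ₗ[ℝ] ExtForms R C} (h : IsSchoutenBracket A pair br)
include h

theorem homog_smul {p : ℕ} (P : C [⋀^Fin p]→ₗ[R] R) (f : R) (S : ExtForms R C) :
    br (homog p P) (f • S) = wedge (br (homog p P) (fn0 f)) S + f • br (homog p P) S := by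
  have hleibniz := h.leibniz p 0 P (AlternatingMap.constOfIsEmpty R C (Fin 0) f) S
  rw [mul_zero, pow_zero, one_smul, homog_zero_eq_fn0, fn0_wedge, fn0_wedge] at hleibniz
  exact hleibniz

theorem homog_form1_wedge_of_even {p : ℕ} (hp : Even p) (P : C [⋀^Fin p]→ₗ[R] R)
    (α : Module.Dual R C) (S : ExtForms R C) :
    br (homog p P) (wedge (form1 α) S) =
      wedge (br (homog p P) (form1 α)) S - wedge (form1 α) (br (homog p P) S) := by
  rw [form1, h.leibniz, neg_one_pow_real_smul, mul_one, hp.add_one.neg_one_pow,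
    neg_one_smul_eq_neg, ← sub_eq_add_neg (G := ExtForms R C)]

theorem homog_form1_wedge_of_odd {p : ℕ} (hp : Odd p) (P : C [⋀^Fin p]→ₗ[R] R)
    (α : Module.Dual R C) (S : ExtForms R C) :
    br (homog p P) (wedge (form1 α) S) =
      wedge (br (homog p P) (form1 α)) S + wedge (form1 α) (br (homog p P) S) := by
  rw [form1, h.leibniz, mul_one, hp.add_one.neg_one_pow, one_smul]

theorem fn0_fn0 (f g : R) : br (fn0 f) (fn0 g) = 0 :=
  DFinsupp.ext fun n => h.degree 0 0 _ _ n (by lia)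

theorem homog_fn0_of_even {p : ℕ} (hp : Even p) (P : C [⋀^Fin p]→ₗ[R] R) (f : R) :
    br (homog p P) (fn0 f) = br (fn0 f) (homog p P) := by
  rw [fn0, h.skew, neg_one_pow_real_smul, zero_add, mul_one, hp.add_one.neg_one_pow,
    neg_one_smul_eq_neg]
  exact neg_neg (G := ExtForms R C) _

theorem homog_form1 {p : ℕ} (P : C [⋀^Fin p]→ₗ[R] R) (α : Module.Dual R C) :
    br (homog p P) (form1 α) = -br (form1 α) (homog p P) := by
  rw [form1, h.skew, (show Even ((p + 1) * (1 + 1)) from even_two.mul_left _).neg_one_pow, one_smul]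

theorem fn0_form1_pair (f : R) (X : B) :
    br (fn0 f) (form1 (pair X)) = -fn0 (A.anchor X f) := by
  rw [← h.function]
  exact h.homog_form1 _ _

theorem fn0_smul (f g : R) (S : ExtForms R C) : br (fn0 f) (g • S) = g • br (fn0 f) S := by
  have hsmul : br (fn0 f) (g • S) = wedge (br (fn0 f) (fn0 g)) S + g • br (fn0 f) S :=
    h.homog_smul _ g S
  rw [hsmul, h.fn0_fn0, map_zero, LinearMap.zero_apply, zero_add]

theorem fn0_form1_wedge (f : R) (α : Module.Dual R C) (S : ExtForms R C) :
    br (fn0 f) (wedge (form1 α) S) =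
      wedge (br (fn0 f) (form1 α)) S - wedge (form1 α) (br (fn0 f) S) :=
  h.homog_form1_wedge_of_even Even.zero _ α S

end General

section Bivector

variable {R B : Type*} [CommRing R] [Algebra ℝ R] [AddCommGroup B] [Module R B]
  [Module ℝ B] [IsScalarTower ℝ R B] {A : AlmostLieAlgebroid R B}
  {br : ExtForms R (Module.Dual R B) →ₗ[ℝ] ExtForms R (Module.Dual R B) →ₗ[ℝ]
      ExtForms R (Module.Dual R B)}
  (h : IsSchoutenBracket A (Module.Dual.eval R B) br) (hV : HasLocalFrames R B) (π : Bivector R B)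
include h hV

theorem fn0_toForm (f : R) :
    br (fn0 f) (homog 2 π.toForm) = -contract (A.diffFn f) (homog 2 π.toForm) := by
  refine eq_neg_of_add_eq_zero_left (G := ExtForms R (Module.Dual R B)) <|
    DFinsupp.ext fun n => AlternatingMap.ext fun v => π.map_homog_toForm_eq_zero hV
      (AddMonoidHom.mk' (fun T => (br (fn0 f) T + contract (A.diffFn f) T) n v) fun S T => ?_)
      (fun g => ?_) fun X Y => ?_
  · rw [map_add, map_add, add_add_add_comm]
    rfl
  · rw [AddMonoidHom.mk'_apply, h.fn0_smul, map_smul, ← smul_add]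
    rfl
  · have hwedge : br (fn0 f) (wedge (form1 (Module.Dual.eval R B X))
        (form1 (Module.Dual.eval R B Y))) =
        A.anchor Y f • form1 (Module.Dual.eval R B X) -
          A.anchor X f • form1 (Module.Dual.eval R B Y) := by
      rw [h.fn0_form1_wedge, h.fn0_form1_pair, h.fn0_form1_pair, wedge_neg_left, fn0_wedge, map_neg,
        form1_wedge_fn0, sub_neg_eq_add (α := ExtForms R (Module.Dual R B)),
        neg_add_eq_sub (α := ExtForms R (Module.Dual R B))]
    rw [AddMonoidHom.mk'_apply, hwedge, contract_form1_wedge_form1]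
    simp only [Module.Dual.eval_apply, AlmostLieAlgebroid.diffFn_apply]
    exact congrArg (fun S : ExtForms R (Module.Dual R B) => S n v)
      ((sub_add_sub_cancel _ _ _).trans (sub_self _))

theorem toForm_fn0 (f : R) : br (homog 2 π.toForm) (fn0 f) = (A.cotangent π).koszul (fn0 f) := by
  rw [h.homog_fn0_of_even even_two, h.fn0_toForm hV, AlmostLieAlgebroid.koszul_fn0,
    π.contract_homog_toForm, ← form1_neg]
  congr 1
  ext α
  exact (π.apply_sharp_swap (A.diffFn f) α).symm

theorem form1_toForm_apply (X : B) (α β : Module.Dual R B) :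
    br (form1 (Module.Dual.eval R B X)) (homog 2 π.toForm) 2 ![α, β] =
      A.anchor X (π.toForm ![α, β]) - π.toForm ![A.lieDer X α, β] -
        π.toForm ![α, A.lieDer X β] := by
  rw [← homog_apply_self 2 π.toForm]
  refine sub_eq_zero.1 <| π.map_homog_toForm_eq_zero hV (AddMonoidHom.mk' (fun T =>
    br (form1 (Module.Dual.eval R B X)) T 2 ![α, β] -
      (A.anchor X (T 2 ![α, β]) - T 2 ![A.lieDer X α, β] - T 2 ![α, A.lieDer X β]))
    fun S T => ?_) (fun f => ?_) fun Y Z => ?_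
  · simp only [map_add, DirectSum.add_apply, AlternatingMap.add_apply]
    ring
  · have hsmul := h.homog_smul (AlternatingMap.ofSubsingleton R (Module.Dual R B) R (0 : Fin 1)
      (Module.Dual.eval R B X)) f (homog 2 π.toForm)
    rw [← form1, h.function, fn0_wedge] at hsmul
    simp only [AddMonoidHom.mk'_apply, hsmul, DirectSum.add_apply, DirectSum.smul_apply,
      AlternatingMap.add_apply, AlternatingMap.smul_apply, smul_eq_mul, Derivation.leibniz]
    ring
  · have hwedge : br (form1 (Module.Dual.eval R B X)) (wedge (form1 (Module.Dual.eval R B Y))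
        (form1 (Module.Dual.eval R B Z))) =
        wedge (form1 (Module.Dual.eval R B (A.bracket X Y))) (form1 (Module.Dual.eval R B Z)) +
          wedge (form1 (Module.Dual.eval R B Y))
            (form1 (Module.Dual.eval R B (A.bracket X Z))) := by
      rw [← h.sections, ← h.sections]
      exact h.homog_form1_wedge_of_odd odd_one _ _ _
    simp only [AddMonoidHom.mk'_apply, hwedge, DirectSum.add_apply, AlternatingMap.add_apply,
      form1_wedge_form1_apply, Module.Dual.eval_apply, AlmostLieAlgebroid.lieDer_apply, map_sub,
      Derivation.leibniz, smul_eq_mul]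
    ring

theorem toForm_form1 (X : B) :
    br (homog 2 π.toForm) (form1 (Module.Dual.eval R B X)) =
      (A.cotangent π).koszul (form1 (Module.Dual.eval R B X)) := by
  refine DFinsupp.ext fun n => ?_
  by_cases hn : n = 2
  · subst hn
    ext v
    obtain ⟨α, β, rfl⟩ : ∃ α β, v = ![α, β] := ⟨v 0, v 1, by ext i; fin_cases i <;> rfl⟩
    rw [h.homog_form1, neg_component, AlternatingMap.neg_apply, h.form1_toForm_apply hV,
      AlmostLieAlgebroid.koszul_form1_apply, AlmostLieAlgebroid.dOne_apply,
      ← π.apply_sharp, ← π.apply_sharp, ← π.apply_sharp]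
    simp only [Module.Dual.eval_apply, AlmostLieAlgebroid.cotangent_bracket_apply,
      AlmostLieAlgebroid.cotangent_anchor_apply, AlmostLieAlgebroid.lieDer_apply]
    rw [π.apply_sharp_swap β (A.lieDer X α)]
    simp only [AlmostLieAlgebroid.lieDer_apply, A.bracket_swap X, map_neg]
    rw [π.apply_sharp_swap α β, map_neg]
    ring
  · rw [form1, AlmostLieAlgebroid.koszul_homog_apply_of_ne _ (by lia)]
    exact h.degree 2 1 _ _ n (by lia)

theorem toForm_toForm :
    br (homog 2 π.toForm) (homog 2 π.toForm) = (A.cotangent π).koszul (homog 2 π.toForm) := by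
  refine sub_eq_zero (G := ExtForms R (Module.Dual R B)).1 <|
    DFinsupp.ext fun n => AlternatingMap.ext fun v => π.map_homog_toForm_eq_zero hV
      (AddMonoidHom.mk' (fun T => (br (homog 2 π.toForm) T - (A.cotangent π).koszul T) n v)
        fun S T => ?_) (fun f => ?_) fun X Y => ?_
  · rw [map_add, map_add, add_sub_add_comm (α := ExtForms R (Module.Dual R B))]
    rfl
  · rw [AddMonoidHom.mk'_apply, h.homog_smul, h.toForm_fn0 hV, AlmostLieAlgebroid.koszul_smul,
      AlmostLieAlgebroid.koszul_fn0, add_comm,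
      add_sub_add_right_eq_sub (G := ExtForms R (Module.Dual R B))]
    exact (mul_sub f _ _).symm
  · rw [AddMonoidHom.mk'_apply, h.homog_form1_wedge_of_even even_two,
      AlmostLieAlgebroid.koszul_wedge, parity_form1, wedge_neg_left, h.toForm_form1 hV,
      h.toForm_form1 hV, ← sub_eq_add_neg, sub_self]
    rfl

end Bivector

end IsSchoutenBracket

namespace AlmostLieAlgebroid

variable {R B : Type*} [CommRing R] [Algebra ℝ R] [AddCommGroup B] [Module R B]
  [Module ℝ B] [IsScalarTower ℝ R B] (A : AlmostLieAlgebroid R B) (π : Bivector R B)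

theorem koszul_toForm_apply (α β γ : Module.Dual R B) :
    (A.cotangent π).koszul (homog 2 π.toForm) 3 ![α, β, γ] =
      2 * (γ (A.bracket (π.sharp α) (π.sharp β)) - γ (π.sharp ((A.cotangent π).bracket α β))) := by
  rw [koszul_homog_apply, diff_two]
  simp only [← π.apply_sharp, cotangent_anchor_apply]
  rw [π.apply_sharp_swap _ β, π.apply_sharp_swap γ ((A.cotangent π).bracket α β)]
  simp only [cotangent_bracket_apply]
  rw [π.apply_sharp_swap β γ, π.apply_sharp_swap α β, π.apply_sharp_swap α γ]
  simp only [A.bracket_swap (π.sharp β) (π.sharp α), A.bracket_swap (π.sharp α) (π.sharp γ),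
    A.bracket_swap (π.sharp β) (π.sharp γ), map_neg]
  ring

variable {A π}

theorem sharp_bracket (hV : HasLocalFrames R B) (hπ : IsPoisson A π) (α β : Module.Dual R B) :
    π.sharp ((A.cotangent π).bracket α β) = A.bracket (π.sharp α) (π.sharp β) := by
  obtain ⟨br, hbr, hzero⟩ := hπ
  refine hV.ext_dual fun γ => ?_
  have hkoszul := A.koszul_toForm_apply π α β γ
  rw [← hbr.toForm_toForm hV, hzero, DirectSum.zero_apply, AlternatingMap.zero_apply,
    two_mul, ← two_nsmul] at hkoszul
  exact (sub_eq_zero.1 ((nsmul_eq_zero_iff_right two_ne_zero).1 hkoszul.symm)).symm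

theorem isLie_cotangent (hA : A.IsLie) (hV : HasLocalFrames R B) (hπ : IsPoisson A π) :
    (A.cotangent π).IsLie where
  jacobi α β γ := by
    ext X
    have hjacobi (δ : Module.Dual R B) (Y Z : B) :
        δ (A.bracket Y (A.bracket Z X)) =
          δ (A.bracket (A.bracket Y Z) X) + δ (A.bracket Z (A.bracket Y X)) := by
      rw [hA.jacobi, map_add]
    have hsharp : A.anchor X (γ (π.sharp ((A.cotangent π).bracket α β))) =
        A.anchor X (γ (A.bracket (π.sharp α) (π.sharp β))) := by rw [sharp_bracket hV hπ]
    rw [π.apply_sharp_swap γ, cotangent_bracket_apply, π.apply_sharp_swap β γ,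
      π.apply_sharp_swap α γ, A.bracket_swap (π.sharp α) (π.sharp γ),
      A.bracket_swap (π.sharp β) (π.sharp γ)] at hsharp
    rw [LinearMap.add_apply]
    simp only [cotangent_bracket_apply, sharp_bracket hV hπ, map_sub, hA.anchor_bracket,
      Derivation.commutator_apply]
    rw [A.bracket_swap (π.sharp β) (π.sharp α), π.apply_sharp_swap α β]
    simp only [map_neg, map_sub] at hsharp ⊢
    linear_combination -hjacobi γ (π.sharp α) (π.sharp β) + hjacobi β (π.sharp α) (π.sharp γ) -
      hjacobi α (π.sharp β) (π.sharp γ) + hsharp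
  anchor_bracket α β := by
    rw [cotangent_anchor_apply, sharp_bracket hV hπ, hA.anchor_bracket]
    rfl

end AlmostLieAlgebroid

namespace ExtForms

variable {R V : Type*} [CommRing R] [AddCommGroup V] [Module R V] (η θ : V [⋀^Fin 3]→ₗ[R] R)

/-- A `3`-form as a trilinear map; `curry₃ η X Y` is the `1`-form `η(X, Y, ·)`. -/
def curry₃ : V →ₗ[R] V →ₗ[R] Module.Dual R V :=
  LinearMap.mk₂ R (contract2 η)
    (fun X X' Y => LinearMap.ext fun Z => DFunLike.congr_fun (η.curryLeft.map_add X X') ![Y, Z])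
    (fun c X Y => LinearMap.ext fun Z => DFunLike.congr_fun (η.curryLeft.map_smul c X) ![Y, Z])
    (fun X Y Y' => LinearMap.ext fun Z =>
      DFunLike.congr_fun ((η.curryLeft X).curryLeft.map_add Y Y') ![Z])
    (fun c X Y => LinearMap.ext fun Z =>
      DFunLike.congr_fun ((η.curryLeft X).curryLeft.map_smul c Y) ![Z])

theorem curry₃_apply (X Y Z : V) : curry₃ η X Y Z = η ![X, Y, Z] := rfl

theorem contract2_eq_curry₃ (X Y : V) : contract2 η X Y = curry₃ η X Y := rfl

theorem curry₃_add (X Y : V) : curry₃ (η + θ) X Y = curry₃ η X Y + curry₃ θ X Y := rfl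

theorem curry₃_self (X : V) : curry₃ η X X = 0 :=
  LinearMap.ext fun _ => η.map_eq_zero_of_eq _ (i := 0) (j := 1) rfl (by decide)

theorem curry₃_swap_left (X Y Z : V) : curry₃ η X Y Z = -curry₃ η Y X Z := by
  have hself := curry₃_self η (X + Y)
  simp only [map_add, LinearMap.add_apply, curry₃_self, zero_add, add_zero] at hself
  exact eq_neg_of_add_eq_zero_right (DFunLike.congr_fun hself Z)

theorem curry₃_swap_right (X Y Z : V) : curry₃ η X Y Z = -curry₃ η X Z Y := by
  rw [curry₃_apply, curry₃_apply, ← η.map_swap ![X, Z, Y] (i := 1) (j := 2) (by decide)]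
  congr 1
  ext i; fin_cases i <;> rfl

theorem curry₃_rotate (X Y Z : V) : curry₃ η X Y Z = curry₃ η Y Z X := by
  rw [curry₃_swap_left, curry₃_swap_right, neg_neg]

theorem curry₃_insertEnd (N : V →ₗ[R] V) (X Y Z : V) :
    curry₃ (insertEnd N η) X Y Z =
      curry₃ η (N X) Y Z + curry₃ η X (N Y) Z + curry₃ η X Y (N Z) := by
  rw [curry₃_apply, insertEnd_apply, Fin.sum_univ_three]
  refine congrArg₂ _ (congrArg₂ _ ?_ ?_) ?_ <;>
    exact congrArg η (funext fun i => by fin_cases i <;> rfl)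

theorem curry₃_add_insertEnd (N : V →ₗ[R] V) (X Y Z : V) :
    curry₃ (η + insertEnd N θ) X Y Z =
      curry₃ η X Y Z + (curry₃ θ (N X) Y Z + curry₃ θ X (N Y) Z + curry₃ θ X Y (N Z)) := by
  rw [curry₃_add, LinearMap.add_apply, curry₃_insertEnd]

end ExtForms

namespace AlmostLieAlgebroid

open ExtForms

variable {R B : Type*} [CommRing R] [Algebra ℝ R] [AddCommGroup B] [Module R B]
  [Module ℝ B] [IsScalarTower ℝ R B] (A : AlmostLieAlgebroid R B)

section Curvature

/-- The cyclic sum `[[X, Y], Z] + [[Y, Z], X] + [[Z, X], Y]`, the obstruction to the Jacobi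
identity. -/
def jacobiator (X Y Z : B) : B :=
  A.bracket (A.bracket X Y) Z + A.bracket (A.bracket Y Z) X + A.bracket (A.bracket Z X) Y

/-- The obstruction `[ρ X, ρ Y] - ρ [X, Y]` to the anchor being a homomorphism. -/
def anchorCurvature (X Y : B) : Derivation ℝ R R :=
  ⁅A.anchor X, A.anchor Y⁆ - A.anchor (A.bracket X Y)

theorem anchorCurvature_apply (X Y : B) (f : R) :
    A.anchorCurvature X Y f =
      A.anchor X (A.anchor Y f) - A.anchor Y (A.anchor X f) - A.anchor (A.bracket X Y) f := rfl

variable {A} in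
theorem IsLie.jacobiator_eq_zero (hA : A.IsLie) (X Y Z : B) : A.jacobiator X Y Z = 0 := by
  have hjacobi := hA.jacobi X Y Z
  rw [A.bracket_swap X (A.bracket Y Z), A.bracket_swap Y (A.bracket X Z), A.bracket_swap X Z,
    map_neg, LinearMap.neg_apply, neg_neg, neg_eq_iff_add_eq_zero] at hjacobi
  rw [jacobiator, ← hjacobi]
  abel

theorem koszul_koszul_fn0_apply (f : R) (X Y : B) :
    A.koszul (A.koszul (fn0 f)) 2 ![X, Y] = A.anchorCurvature X Y f := by
  rw [koszul_fn0, koszul_form1_apply, dOne_apply, anchorCurvature_apply]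
  simp only [diffFn_apply]
  ring

theorem koszul_form1_eq_homog (α : Module.Dual R B) :
    A.koszul (form1 α) = homog 2 (A.koszul (form1 α) 2) := by
  rw [form1, koszul_homog, homog_apply_self]

theorem koszul_koszul_form1_apply (α : Module.Dual R B) (X Y Z : B) :
    A.koszul (A.koszul (form1 α)) 3 ![X, Y, Z] =
      A.anchorCurvature X Y (α Z) + A.anchorCurvature Y Z (α X) + A.anchorCurvature Z X (α Y) +
        α (A.jacobiator X Y Z) := by
  rw [koszul_form1_eq_homog, koszul_homog_apply, diff_two, jacobiator]
  simp only [koszul_form1_apply, dOne_apply, anchorCurvature_apply, map_add, map_sub]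
  rw [A.bracket_swap Y (A.bracket X Z), A.bracket_swap X (A.bracket Y Z), A.bracket_swap X Z]
  simp only [map_neg, LinearMap.neg_apply, Derivation.neg_apply]
  ring

end Curvature

section SchoutenOneForm

variable (π : Bivector R B) (α : Module.Dual R B)

theorem contract_pairing_koszul_form1 (X : B) (Q : ExtForms R B) :
    contract X (π.pairing (A.koszul (form1 α)) Q) =
      π.pairing (A.koszul (form1 α)) (contract X Q) - contract (π.sharp (A.dOne α X)) Q := by
  rw [π.contract_pairing, (A.isEven_koszul (parity_form1 α)).parity_eq, contract_koszul_form1,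
    π.pairing_form1_left]

theorem pairing_koszul_form1_homog_apply (k : ℕ) (η : B [⋀^Fin k]→ₗ[R] R) (X : Fin k → B) :
    π.pairing (A.koszul (form1 α)) (homog k η) k X =
      -∑ j, η (Function.update X j (π.sharp (A.dOne α (X j)))) := by
  induction k with
  | zero =>
    rw [homog_zero_eq_fn0, π.pairing_symm_of_isEven (A.isEven_koszul (parity_form1 α)),
      parity_fn0, π.pairing_fn0_left, Finset.univ_eq_empty, Finset.sum_empty,
      neg_zero]
    rfl
  | succ k ih =>
    have hcons : ∀ (W : B) (v : Fin k → B),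
        η.curryLeft W v = η (Fin.cons W v : Fin (k + 1) → B) := fun _ _ => rfl
    rw [apply_succ_apply, contract_pairing_koszul_form1, contract_homog_succ, contract_homog_succ,
      DirectSum.sub_apply, AlternatingMap.sub_apply, ih, homog_apply_self, Fin.sum_univ_succ]
    obtain ⟨W, v, rfl⟩ : ∃ W v, X = Fin.cons W v := ⟨X 0, Fin.tail X, (Fin.cons_self_tail X).symm⟩
    simp only [Fin.tail_cons, Fin.cons_zero, Fin.cons_succ, hcons, Fin.update_cons_zero,
      Fin.cons_update]
    ring

theorem schouten_form1_homog_apply (k : ℕ) (η : B [⋀^Fin k]→ₗ[R] R) (X : Fin k → B) :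
    A.schouten π (form1 α) (homog k η) k X =
      A.anchor (π.sharp α) (η X) -
        ∑ j, η (Function.update X j (A.bracket (π.sharp α) (X j))) -
        ∑ j, η (Function.update X j (π.sharp (A.dOne α (X j)))) := by
  rw [schouten_form1, DirectSum.add_apply, AlternatingMap.add_apply, lie_apply, homog_apply_self,
    pairing_koszul_form1_homog_apply, ← sub_eq_add_neg]

end SchoutenOneForm

end AlmostLieAlgebroid

namespace ExtForms

variable {R V : Type*} [CommRing R] [AddCommGroup V] [Module R V]

theorem alternatingMap_ext_two {η θ : V [⋀^Fin 2]→ₗ[R] R} (h : ∀ X Y, η ![X, Y] = θ ![X, Y]) :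
    η = θ := by
  ext v
  convert h (v 0) (v 1) using 2 <;> ext i <;> fin_cases i <;> rfl

theorem alternatingMap_ext_three {η θ : V [⋀^Fin 3]→ₗ[R] R}
    (h : ∀ X Y Z, η ![X, Y, Z] = θ ![X, Y, Z]) : η = θ := by
  ext v
  convert h (v 0) (v 1) (v 2) using 2 <;> ext i <;> fin_cases i <;> rfl

end ExtForms

namespace AlmostLieAlgebroid

open ExtForms

variable {R B : Type*} [CommRing R] [Algebra ℝ R] [AddCommGroup B] [Module R B]
  [Module ℝ B] [IsScalarTower ℝ R B] (A : AlmostLieAlgebroid R B)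

section SchoutenOneForm

variable (π : Bivector R B) (α : Module.Dual R B)

theorem schouten_form1_koszul_form1_apply (A' : AlmostLieAlgebroid R B) (β : Module.Dual R B)
    (X Y : B) :
    A.schouten π (form1 α) (A'.koszul (form1 β)) 2 ![X, Y] =
      A.anchor (π.sharp α) (A'.dOne β X Y) - A'.dOne β (A.bracket (π.sharp α) X) Y -
        A'.dOne β X (A.bracket (π.sharp α) Y) - A'.dOne β (π.sharp (A.dOne α X)) Y -
        A'.dOne β X (π.sharp (A.dOne α Y)) := by
  rw [koszul_form1_eq_homog, schouten_form1_homog_apply]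
  simp only [← koszul_form1_apply, Fin.sum_univ_succ, Finset.univ_eq_empty, Finset.sum_empty,
    Matrix.vecCons, ← Fin.cons_update, Fin.update_cons_zero, Fin.cons_zero, Fin.cons_succ]
  ring

theorem schouten_form1_homog_three_apply (η : B [⋀^Fin 3]→ₗ[R] R) (X Y Z : B) :
    A.schouten π (form1 α) (homog 3 η) 3 ![X, Y, Z] =
      A.anchor (π.sharp α) (curry₃ η X Y Z) - curry₃ η (A.bracket (π.sharp α) X) Y Z -
        curry₃ η X (A.bracket (π.sharp α) Y) Z - curry₃ η X Y (A.bracket (π.sharp α) Z) -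
        curry₃ η (π.sharp (A.dOne α X)) Y Z - curry₃ η X (π.sharp (A.dOne α Y)) Z -
        curry₃ η X Y (π.sharp (A.dOne α Z)) := by
  rw [schouten_form1_homog_apply]
  simp only [curry₃_apply, Fin.sum_univ_succ, Finset.univ_eq_empty, Finset.sum_empty,
    Matrix.vecCons, ← Fin.cons_update, Fin.update_cons_zero, Fin.cons_zero, Fin.cons_succ]
  ring

end SchoutenOneForm

section Deform

variable (N : B →ₗ[R] B)

theorem deform_bracket_apply (X Y : B) :
    (A.deform N).bracket X Y = A.bracket (N X) Y + A.bracket X (N Y) - N (A.bracket X Y) := rfl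

theorem deform_anchor_apply (X : B) : (A.deform N).anchor X = A.anchor (N X) := rfl

theorem map_deform_bracket (X Y : B) :
    N ((A.deform N).bracket X Y) = A.bracket (N X) (N Y) - A.torsion N X Y := by
  rw [torsion, sub_sub_cancel, deform_bracket_apply]

variable {A} in
theorem IsLie.jacobiator_deform (hA : A.IsLie) (X Y Z : B) :
    (A.deform N).jacobiator X Y Z =
      -(A.bracket (A.torsion N X Y) Z + A.torsion N (A.bracket X Y) Z) -
        (A.bracket (A.torsion N Y Z) X + A.torsion N (A.bracket Y Z) X) -
        (A.bracket (A.torsion N Z X) Y + A.torsion N (A.bracket Z X) Y) := by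
  have hN (U V W : B) : N (A.jacobiator U V W) = 0 := by rw [hA.jacobiator_eq_zero, map_zero]
  have hNN : N (N (A.jacobiator X Y Z)) = 0 := by rw [hN, map_zero]
  have hNX := hN (N X) Y Z
  have hNY := hN X (N Y) Z
  have hNZ := hN X Y (N Z)
  have hNXNY := hA.jacobiator_eq_zero (N X) (N Y) Z
  have hNYNZ := hA.jacobiator_eq_zero X (N Y) (N Z)
  have hNZNX := hA.jacobiator_eq_zero (N X) Y (N Z)
  simp only [jacobiator, torsion, deform_bracket_apply, map_add, map_sub, LinearMap.add_apply,
    LinearMap.sub_apply] at hNN hNX hNY hNZ hNXNY hNYNZ hNZNX ⊢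
  linear_combination (norm := abel) hNXNY + hNYNZ + hNZNX - hNX - hNY - hNZ + hNN

end Deform

section Twist

variable (π : Bivector R B) (N : B →ₗ[R] B) (H : B [⋀^Fin 3]→ₗ[R] R)

/-- The bracket `[X, Y]_N - π♯ H(X, Y, ·)` with the anchor `ρ ∘ N`, whose Koszul differential is the
twisted differential `d_N^H`. -/
def twist : AlmostLieAlgebroid R B where
  bracket := LinearMap.mk₂ ℝ (fun X Y => (A.deform N).bracket X Y - π.sharp (curry₃ H X Y))
    (fun X X' Y => by simp only [map_add, LinearMap.add_apply]; abel)
    (fun c X Y => by simp only [LinearMap.map_smul_of_tower, LinearMap.smul_apply, smul_sub])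
    (fun X Y Y' => by simp only [map_add]; abel)
    (fun c X Y => by simp only [LinearMap.map_smul_of_tower, smul_sub])
  anchor := (A.deform N).anchor
  bracket_self X := by rw [LinearMap.mk₂_apply, bracket_self, curry₃_self, map_zero, sub_zero]
  leibniz X Y f := by
    simp only [LinearMap.mk₂_apply, leibniz, map_smul, smul_sub]
    abel

theorem twist_anchor_apply (X : B) : (A.twist π N H).anchor X = A.anchor (N X) := rfl

theorem twist_diffFn (f : R) : (A.twist π N H).diffFn f = N.dualMap (A.diffFn f) := rfl

theorem twist_bracket_apply (X Y : B) :
    (A.twist π N H).bracket X Y = (A.deform N).bracket X Y - π.sharp (curry₃ H X Y) := rfl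

theorem twist_dOne (α : Module.Dual R B) (X : B) :
    (A.twist π N H).dOne α X = (A.deform N).dOne α X - curry₃ H (π.sharp α) X := by
  ext Y
  rw [LinearMap.sub_apply, dOne_apply, dOne_apply, twist_bracket_apply, map_sub,
    π.apply_sharp_swap α, curry₃_rotate H (π.sharp α)]
  change A.anchor (N X) _ - _ - A.anchor (N Y) _ = A.anchor (N X) _ - _ - A.anchor (N Y) _ - _
  ring

theorem deform_dOne_apply (α : Module.Dual R B) (X Y : B) :
    (A.deform N).dOne α X Y =
      A.dOne α (N X) Y + A.dOne α X (N Y) - A.dOne (N.dualMap α) X Y := by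
  simp only [dOne_apply, deform_bracket_apply, deform_anchor_apply, map_sub, map_add,
    LinearMap.dualMap_apply]
  ring

theorem isTwistedDifferential_koszul : IsTwistedDifferential A π N H (A.twist π N H).koszul where
  derivation := isDegreeOneDerivation_koszul _
  function := koszul_fn0 _
  one_form α X Y := by
    have hdiff : (A.deform N).koszul (form1 α) 2 ![X, Y] =
        (A.deform N).diff (fun Z : Fin 1 → B => α (Z 0)) ![X, Y] :=
      (A.deform N).koszul_homog_apply 1 (AlternatingMap.ofSubsingleton R B R 0 α) ![X, Y]
    rw [← hdiff, koszul_form1_apply, koszul_form1_apply, twist_dOne, LinearMap.sub_apply,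
      curry₃_apply]

end Twist

section OneForms

theorem dOne_sub (α β : Module.Dual R B) (X Y : B) :
    A.dOne (α - β) X Y = A.dOne α X Y - A.dOne β X Y := by
  simp only [dOne_apply, LinearMap.sub_apply, map_sub]
  ring

theorem curry₃_sharp_dOne (π : Bivector R B) (η : B [⋀^Fin 3]→ₗ[R] R) (α : Module.Dual R B)
    (X Y Z : B) :
    curry₃ η X Y (π.sharp (A.dOne α Z)) =
      A.anchor (π.sharp (curry₃ η X Y)) (α Z) - α (A.bracket (π.sharp (curry₃ η X Y)) Z) +
        A.anchor Z (curry₃ η X Y (π.sharp α)) := by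
  rw [π.apply_sharp_swap, dOne_swap, dOne_apply, π.apply_sharp_swap α, map_neg]
  ring

theorem cotangent_bracket (π : Bivector R B) (α β : Module.Dual R B) :
    (A.cotangent π).bracket α β =
      A.lieDer (π.sharp α) β - A.lieDer (π.sharp β) α - A.diffFn (β (π.sharp α)) := by
  rw [π.apply_sharp]
  rfl

variable {A}

theorem IsLie.dOne_diffFn (hA : A.IsLie) (f : R) (X Y : B) : A.dOne (A.diffFn f) X Y = 0 := by
  simp only [dOne_apply, diffFn_apply, hA.anchor_bracket, Derivation.commutator_apply]
  ring

theorem IsLie.dOne_lieDer (hA : A.IsLie) (Z : B) (β : Module.Dual R B) (X Y : B) :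
    A.dOne (A.lieDer Z β) X Y =
      A.anchor Z (A.dOne β X Y) - A.dOne β (A.bracket Z X) Y - A.dOne β X (A.bracket Z Y) := by
  simp only [dOne_apply, lieDer_apply, map_sub, hA.anchor_bracket, Derivation.commutator_apply]
  rw [hA.jacobi Z X Y, map_add]
  ring

theorem IsLie.dOne_cotangent_bracket (hA : A.IsLie) (π : Bivector R B) (α β : Module.Dual R B)
    (X Y : B) :
    A.dOne ((A.cotangent π).bracket α β) X Y =
      A.anchor (π.sharp α) (A.dOne β X Y) - A.dOne β (A.bracket (π.sharp α) X) Y -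
        A.dOne β X (A.bracket (π.sharp α) Y) -
      (A.anchor (π.sharp β) (A.dOne α X Y) - A.dOne α (A.bracket (π.sharp β) X) Y -
        A.dOne α X (A.bracket (π.sharp β) Y)) := by
  rw [cotangent_bracket, dOne_sub, dOne_sub, hA.dOne_diffFn, hA.dOne_lieDer, hA.dOne_lieDer,
    sub_zero]

end OneForms

end AlmostLieAlgebroid

/-! ### Poisson quasi-Nijenhuis structures with background -/

namespace IsPoissonQuasiNijenhuis

open ExtForms AlmostLieAlgebroid

variable {R B : Type*} [CommRing R] [Algebra ℝ R] [AddCommGroup B] [Module R B]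
  [Module ℝ B] [IsScalarTower ℝ R B] {A : AlmostLieAlgebroid R B} {π : Bivector R B}
  {N : B →ₗ[R] B} {ψ H : B [⋀^Fin 3]→ₗ[R] R} (h : IsPoissonQuasiNijenhuis A π N ψ H)

include h

section Compatibility

theorem map_sharp (α : Module.Dual R B) : N (π.sharp α) = π.sharp (N.dualMap α) :=
  LinearMap.congr_fun h.comm α

theorem apply_map_sharp_swap (α β : Module.Dual R B) :
    α (N (π.sharp β)) = -β (N (π.sharp α)) := by
  rw [h.map_sharp β, π.apply_sharp_swap, LinearMap.dualMap_apply]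

theorem concomitant_apply (α β : Module.Dual R B) (X : B) :
    β (A.bracket (π.sharp α) (N X)) - β (N (A.bracket (π.sharp α) X)) -
        α (A.bracket (π.sharp β) (N X)) + α (N (A.bracket (π.sharp β) X)) +
        A.anchor (N X) (β (π.sharp α)) - A.anchor X (β (N (π.sharp α))) =
      curry₃ H (π.sharp α) (π.sharp β) X := by
  have hconcomitant := LinearMap.congr_fun (h.concomitant α β) X
  rw [AlmostLieAlgebroid.concomitant, LinearMap.sub_apply, cotangent_bracket_apply,
    deform_bracket_apply (A.cotangent π), LinearMap.sub_apply, LinearMap.add_apply,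
    LinearMap.dualMap_apply, cotangent_bracket_apply, cotangent_bracket_apply,
    cotangent_bracket_apply, contract2_eq_curry₃, LinearMap.smul_apply, smul_eq_mul,
    ← h.map_sharp, ← h.map_sharp]
    at hconcomitant
  simp only [deform_bracket_apply, deform_anchor_apply, LinearMap.dualMap_apply, map_add,
    map_sub] at hconcomitant
  refine sub_eq_zero.1 ((nsmul_eq_zero_iff_right two_ne_zero).1 ?_)
  rw [two_nsmul]
  linear_combination -hconcomitant

theorem apply_bracket_sharp_map (α β : Module.Dual R B) (X : B) :
    β (A.bracket (π.sharp α) (N X)) =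
      β (N (A.bracket (π.sharp α) X)) - A.dOne α (π.sharp β) (N X) +
        A.dOne (N.dualMap α) (π.sharp β) X + curry₃ H (π.sharp α) (π.sharp β) X := by
  simp only [dOne_apply, LinearMap.dualMap_apply]
  rw [π.apply_sharp_swap α β, h.apply_map_sharp_swap α β, map_neg, map_neg]
  linear_combination h.concomitant_apply α β X

theorem dualMap_bracket (α β : Module.Dual R B) :
    N.dualMap ((A.cotangent π).bracket α β) =
      A.lieDer (π.sharp α) (N.dualMap β) - A.lieDer (π.sharp β) (N.dualMap α) -
        curry₃ H (π.sharp α) (π.sharp β) - A.diffFn (β (N (π.sharp α))) := by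
  ext X
  simp only [LinearMap.sub_apply, lieDer_apply, diffFn_apply, LinearMap.dualMap_apply,
    cotangent_bracket_apply]
  linear_combination -h.concomitant_apply α β X

theorem sharp_curry₃_add_insertEnd (X Y : B) :
    π.sharp (curry₃ (ψ + insertEnd N H) X Y) =
      A.torsion N X Y + N (π.sharp (curry₃ H X Y)) := by
  have hcurry : curry₃ (ψ + insertEnd N H) X Y =
      contract2 H (N X) Y - contract2 H (N Y) X + contract2 ψ X Y + N.dualMap (curry₃ H X Y) := by
    ext Z
    rw [curry₃_add]
    simp only [LinearMap.add_apply, LinearMap.sub_apply, contract2_eq_curry₃, curry₃_insertEnd,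
      LinearMap.dualMap_apply]
    rw [curry₃_swap_left H (N Y) X]
    ring
  rw [hcurry, map_add π.sharp _ (N.dualMap _), ← h.torsion, h.map_sharp]

theorem map_twist_bracket (X Y : B) :
    N ((A.twist π N H).bracket X Y) =
      A.bracket (N X) (N Y) - π.sharp (curry₃ (ψ + insertEnd N H) X Y) := by
  rw [h.sharp_curry₃_add_insertEnd, twist_bracket_apply, map_sub, map_deform_bracket]
  abel

theorem anchorCurvature_twist (hA : A.IsLie) (X Y : B) :
    (A.twist π N H).anchorCurvature X Y =
      A.anchor (π.sharp (curry₃ (ψ + insertEnd N H) X Y)) := by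
  rw [anchorCurvature, twist_anchor_apply, twist_anchor_apply, twist_anchor_apply,
    h.map_twist_bracket, map_sub, hA.anchor_bracket]
  abel

end Compatibility

section Derivation

theorem schoutenDefect_fn0_fn0 (f g : R) :
    schoutenDefect A (A.twist π N H) π (fn0 f) (fn0 g) = 0 := by
  rw [schoutenDefect_apply, schouten_fn0, contract_fn0, map_zero, koszul_fn0, koszul_fn0,
    schouten_form1_fn0, parity_fn0, schouten_fn0, contract_form1, twist_diffFn, twist_diffFn,
    LinearMap.dualMap_apply, cotangent_anchor_apply, ← h.map_sharp, diffFn_apply]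
  abel

theorem schoutenDefect_form1_fn0 (hA : A.IsLie) (α : Module.Dual R B) (f : R) :
    schoutenDefect A (A.twist π N H) π (form1 α) (fn0 f) = 0 := by
  have hform : (A.twist π N H).diffFn (A.anchor (π.sharp α) f) -
      (A.twist π N H).dOne α (π.sharp (A.diffFn f)) -
      (A.cotangent π).bracket α ((A.twist π N H).diffFn f) = 0 := by
    ext X
    have hconcomitant := h.apply_bracket_sharp_map α (A.diffFn f) X
    simp only [LinearMap.sub_apply, LinearMap.zero_apply, twist_diffFn, LinearMap.dualMap_apply,
      twist_dOne, deform_dOne_apply, cotangent_bracket_apply, diffFn_apply, ← h.map_sharp]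
      at hconcomitant ⊢
    rw [hA.anchor_bracket, Derivation.commutator_apply] at hconcomitant
    rw [dOne_apply A α (N _), h.apply_map_sharp_swap α (A.diffFn f), diffFn_apply, map_neg]
    linear_combination -hconcomitant
  rw [schoutenDefect_apply, schouten_form1_fn0, koszul_fn0, koszul_fn0,
    schouten_symm_of_isEven A π (isEven_koszul _ (parity_form1 α)), parity_fn0, parity_form1,
    schouten_neg_left, schouten_fn0, contract_koszul_form1, schouten_form1_form1,
    cotangent_anchor_apply, ← sub_eq_add_neg, ← form1_sub, ← form1_sub, hform]
  exact map_zero _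

theorem dOne_dualMap_bracket (hA : A.IsLie) (α β : Module.Dual R B) (X Y : B) :
    A.dOne (N.dualMap ((A.cotangent π).bracket α β)) X Y =
      A.anchor (π.sharp α) (A.dOne (N.dualMap β) X Y) -
        A.dOne (N.dualMap β) (A.bracket (π.sharp α) X) Y -
        A.dOne (N.dualMap β) X (A.bracket (π.sharp α) Y) -
      (A.anchor (π.sharp β) (A.dOne (N.dualMap α) X Y) -
        A.dOne (N.dualMap α) (A.bracket (π.sharp β) X) Y -
        A.dOne (N.dualMap α) X (A.bracket (π.sharp β) Y)) -
      A.dOne (curry₃ H (π.sharp α) (π.sharp β)) X Y := by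
  rw [h.dualMap_bracket, dOne_sub, dOne_sub, dOne_sub, hA.dOne_diffFn, hA.dOne_lieDer,
    hA.dOne_lieDer, sub_zero]

theorem twist_dOne_bracket (hA : A.IsLie) (hV : HasLocalFrames R B) (α β : Module.Dual R B)
    (X Y : B) :
    (A.twist π N H).dOne ((A.cotangent π).bracket α β) X Y =
      A.schouten π (form1 α) ((A.twist π N H).koszul (form1 β)) 2 ![X, Y] -
        A.schouten π (form1 β) ((A.twist π N H).koszul (form1 α)) 2 ![X, Y] := by
  have hclosed := h.closed_H ![π.sharp α, π.sharp β, X, Y]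
  rw [diff_three] at hclosed
  simp only [← curry₃_apply] at hclosed
  have hdOne_sharp (γ γ' : Module.Dual R B) (W : B) :
      A.dOne γ (π.sharp γ') W = -A.dOne γ W (π.sharp γ') := dOne_swap ..
  have hdOne_bracket (γ : Module.Dual R B) (U V W : B) :
      A.dOne γ (A.bracket U V) W = -A.dOne γ W (A.bracket U V) := dOne_swap ..
  have hdOne_map_sharp (γ γ' : Module.Dual R B) (W : B) :
      A.dOne γ (N (π.sharp γ')) W = -A.dOne γ W (N (π.sharp γ')) := dOne_swap ..
  have hdOne_map_bracket (γ : Module.Dual R B) (U V W : B) :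
      A.dOne γ (N (A.bracket U V)) W = -A.dOne γ W (N (A.bracket U V)) := dOne_swap ..
  have hcurry_sharp (γ γ' : Module.Dual R B) (U W : B) :
      curry₃ H (π.sharp γ) (π.sharp (A.dOne γ' U)) W =
        -curry₃ H (π.sharp γ) W (π.sharp (A.dOne γ' U)) := curry₃_swap_right ..
  have hαY := h.apply_bracket_sharp_map α (A.dOne β Y) X
  have hαX := h.apply_bracket_sharp_map α (A.dOne β X) Y
  have hβY := h.apply_bracket_sharp_map β (A.dOne α Y) X
  have hβX := h.apply_bracket_sharp_map β (A.dOne α X) Y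
  have hXY := h.apply_map_sharp_swap (A.dOne β X) (A.dOne α Y)
  have hYX := h.apply_map_sharp_swap (A.dOne β Y) (A.dOne α X)
  have hdOne_curry := A.dOne_apply (curry₃ H (π.sharp α) (π.sharp β)) X Y
  simp only [schouten_form1_koszul_form1_apply, twist_dOne, deform_dOne_apply,
    LinearMap.sub_apply, hA.dOne_cotangent_bracket, h.dOne_dualMap_bracket hA,
    sharp_bracket hV h.poisson, map_sub, map_add, hdOne_sharp, hdOne_bracket, hdOne_map_sharp,
    hdOne_map_bracket, hcurry_sharp] at hαX hαY hβX hβY hclosed ⊢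
  linear_combination hαY - hαX - hβY + hβX + hXY - hYX + hclosed + hdOne_curry

theorem schoutenDefect_form1_form1 (hA : A.IsLie) (hV : HasLocalFrames R B)
    (α β : Module.Dual R B) :
    schoutenDefect A (A.twist π N H) π (form1 α) (form1 β) = 0 := by
  rw [schoutenDefect_apply, schouten_form1_form1,
    schouten_symm_of_isEven A π (isEven_koszul _ (parity_form1 α)), parity_form1, parity_form1,
    schouten_neg_left, schouten_neg_left]
  refine DFinsupp.ext fun n => ?_
  rw [DirectSum.add_apply, DirectSum.sub_apply, neg_component, neg_component]
  obtain rfl | hn := eq_or_ne n 2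
  · refine alternatingMap_ext_two fun X Y => ?_
    rw [AlternatingMap.add_apply, AlternatingMap.sub_apply, AlternatingMap.neg_apply,
      AlternatingMap.neg_apply, koszul_form1_apply, h.twist_dOne_bracket hA hV]
    change _ = (0 : R)
    ring
  · have hschouten (γ γ' : Module.Dual R B) :
        A.schouten π (form1 γ) ((A.twist π N H).koszul (form1 γ')) n = 0 := by
      rw [koszul_form1_eq_homog]
      exact A.schouten_homog_apply_of_ne π (by lia) _ _
    rw [hschouten, hschouten, form1, koszul_homog_apply_of_ne _ hn]
    simp only [neg_zero, sub_zero, add_zero, DirectSum.zero_apply]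

end Derivation

section Square

theorem apply_torsion (α : Module.Dual R B) (X Y : B) :
    α (A.torsion N X Y) =
      curry₃ H X Y (N (π.sharp α)) - curry₃ (ψ + insertEnd N H) X Y (π.sharp α) := by
  rw [eq_sub_of_add_eq (h.sharp_curry₃_add_insertEnd X Y).symm, map_sub, π.apply_sharp_swap,
    h.apply_map_sharp_swap]
  ring

theorem apply_twist_bracket_bracket (α : Module.Dual R B) (X Y Z : B) :
    α ((A.twist π N H).bracket ((A.twist π N H).bracket X Y) Z) =
      α ((A.deform N).bracket ((A.deform N).bracket X Y) Z) + α (A.bracket (A.torsion N X Y) Z) -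
        α (A.bracket (π.sharp (curry₃ (ψ + insertEnd N H) X Y)) Z) +
        A.dOne (curry₃ H X Y) (π.sharp α) (N Z) -
        A.dOne (N.dualMap (curry₃ H X Y)) (π.sharp α) Z +
        curry₃ H ((A.deform N).bracket X Y) Z (π.sharp α) := by
  have hbracket := h.apply_bracket_sharp_map (curry₃ H X Y) α Z
  have hdeform : (A.deform N).bracket (π.sharp (curry₃ H X Y)) Z =
      A.bracket (N (π.sharp (curry₃ H X Y))) Z + A.bracket (π.sharp (curry₃ H X Y)) (N Z) -
        N (A.bracket (π.sharp (curry₃ H X Y)) Z) := rfl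
  rw [twist_bracket_apply, twist_bracket_apply, h.sharp_curry₃_add_insertEnd]
  simp only [map_sub, map_add, LinearMap.sub_apply, LinearMap.add_apply, hdeform]
  rw [hbracket, π.apply_sharp_swap α, π.apply_sharp_swap α,
    curry₃_swap_right H (π.sharp (curry₃ H X Y))]
  ring

theorem apply_jacobiator_twist (hA : A.IsLie) (α : Module.Dual R B) (X Y Z : B) :
    α ((A.twist π N H).jacobiator X Y Z) =
      A.anchor X (curry₃ (ψ + insertEnd N H) Y Z (π.sharp α)) +
        A.anchor Y (curry₃ (ψ + insertEnd N H) Z X (π.sharp α)) +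
        A.anchor Z (curry₃ (ψ + insertEnd N H) X Y (π.sharp α)) -
        A.anchor (π.sharp α) (curry₃ (ψ + insertEnd N H) X Y Z) +
        curry₃ (ψ + insertEnd N H) (A.bracket (π.sharp α) X) Y Z +
        curry₃ (ψ + insertEnd N H) X (A.bracket (π.sharp α) Y) Z +
        curry₃ (ψ + insertEnd N H) X Y (A.bracket (π.sharp α) Z) -
        α (A.bracket (π.sharp (curry₃ (ψ + insertEnd N H) X Y)) Z) -
        α (A.bracket (π.sharp (curry₃ (ψ + insertEnd N H) Y Z)) X) -
        α (A.bracket (π.sharp (curry₃ (ψ + insertEnd N H) Z X)) Y) := by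
  have hψ := h.closed_psi ![X, Y, Z, π.sharp α]
  have hNX := h.closed_H ![N X, Y, Z, π.sharp α]
  have hNY := h.closed_H ![X, N Y, Z, π.sharp α]
  have hNZ := h.closed_H ![X, Y, N Z, π.sharp α]
  have hjacobiator := congrArg α (hA.jacobiator_deform N X Y Z)
  simp only [jacobiator, map_add α, map_sub α, map_neg α, h.apply_torsion] at hjacobiator
  simp only [jacobiator, map_add α, h.apply_twist_bracket_bracket]
  simp only [diff_three, ← curry₃_apply] at hψ hNX hNY hNZ
  have hbracket_mid (η : B [⋀^Fin 3]→ₗ[R] R) (U V W S : B) :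
      curry₃ η U (A.bracket V W) S = -curry₃ η (A.bracket V W) U S := curry₃_swap_left ..
  have hbracket_right (η : B [⋀^Fin 3]→ₗ[R] R) (U V W S : B) :
      curry₃ η U S (A.bracket V W) = curry₃ η (A.bracket V W) U S := (curry₃_rotate ..).symm
  have hmap_bracket_right (η : B [⋀^Fin 3]→ₗ[R] R) (U V W S : B) :
      curry₃ η U S (N (A.bracket V W)) = curry₃ η (N (A.bracket V W)) U S :=
    (curry₃_rotate ..).symm
  have hbracket_sharp (U : B) : A.bracket U (π.sharp α) = -A.bracket (π.sharp α) U :=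
    A.bracket_swap _ _
  have hZX := A.bracket_swap Z X
  have hNZX := A.bracket_swap (N Z) X
  have hZNX := A.bracket_swap Z (N X)
  have hcurryZX (η : B [⋀^Fin 3]→ₗ[R] R) := curry₃_swap_left η Z X
  have hcurry_ZX (η : B [⋀^Fin 3]→ₗ[R] R) (U : B) := curry₃_swap_right η U Z X
  simp only [dOne_apply, LinearMap.dualMap_apply, deform_bracket_apply,
    curry₃_add, curry₃_insertEnd, map_add, map_sub, map_neg, LinearMap.add_apply,
    LinearMap.sub_apply, LinearMap.neg_apply, hbracket_mid, hbracket_right, hmap_bracket_right,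
    hbracket_sharp, hZX, hNZX, hZNX, hcurryZX, hcurry_ZX] at hjacobiator hψ hNX hNY hNZ ⊢
  linear_combination (norm := abel) hjacobiator - hψ - hNX - hNY - hNZ

theorem koszul_koszul_fn0 (hA : A.IsLie) (f : R) :
    (A.twist π N H).koszul ((A.twist π N H).koszul (fn0 f)) =
      A.schouten π (homog 3 (ψ + insertEnd N H)) (fn0 f) := by
  rw [schouten_symm_of_isOdd A π (isOdd_homog (by decide) _), schouten_fn0, contract_homog_succ]
  refine DFinsupp.ext fun n => ?_
  rw [neg_component]
  obtain rfl | hn := eq_or_ne n 2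
  · refine alternatingMap_ext_two fun X Y => ?_
    rw [koszul_koszul_fn0_apply, h.anchorCurvature_twist hA, AlternatingMap.neg_apply,
      homog_apply_self]
    change _ = -curry₃ (ψ + insertEnd N H) (π.sharp (A.diffFn f)) X Y
    rw [curry₃_rotate, π.apply_sharp_swap (curry₃ _ X Y), neg_neg, diffFn_apply]
  · rw [koszul_fn0, form1, koszul_homog_apply_of_ne _ hn, homog_apply_of_ne hn.symm, neg_zero]

theorem koszul_koszul_form1 (hA : A.IsLie) (α : Module.Dual R B) :
    (A.twist π N H).koszul ((A.twist π N H).koszul (form1 α)) =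
      A.schouten π (homog 3 (ψ + insertEnd N H)) (form1 α) := by
  rw [schouten_symm_of_isOdd A π (isOdd_homog (by decide) _)]
  refine DFinsupp.ext fun n => ?_
  rw [neg_component]
  obtain rfl | hn := eq_or_ne n 3
  · refine alternatingMap_ext_three fun X Y Z => ?_
    rw [koszul_koszul_form1_apply, AlternatingMap.neg_apply, schouten_form1_homog_three_apply,
      h.anchorCurvature_twist hA, h.anchorCurvature_twist hA, h.anchorCurvature_twist hA,
      h.apply_jacobiator_twist hA, curry₃_rotate _ (π.sharp (A.dOne α X)),
      ← curry₃_rotate _ Z X (π.sharp (A.dOne α Y)), curry₃_sharp_dOne, curry₃_sharp_dOne,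
      curry₃_sharp_dOne]
    ring
  · rw [koszul_form1_eq_homog, koszul_homog_apply_of_ne _ hn, form1,
      schouten_homog_apply_of_ne A π (by lia), neg_zero]

end Square

section Closed

theorem curry₃_sharp_curry₃_add (X Y Z W : B) :
    curry₃ ψ (π.sharp (curry₃ H X Y)) Z W + curry₃ H (π.sharp (curry₃ H X Y)) (N Z) W +
        curry₃ H (π.sharp (curry₃ H X Y)) Z (N W) +
        curry₃ H (π.sharp (curry₃ (ψ + insertEnd N H) X Y)) Z W +
      (curry₃ ψ (π.sharp (curry₃ H Z W)) X Y + curry₃ H (π.sharp (curry₃ H Z W)) (N X) Y +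
        curry₃ H (π.sharp (curry₃ H Z W)) X (N Y) +
        curry₃ H (π.sharp (curry₃ (ψ + insertEnd N H) Z W)) X Y) = 0 := by
  have htransfer (X Y Z W : B) : curry₃ H (π.sharp (curry₃ (ψ + insertEnd N H) X Y)) Z W =
      -curry₃ ψ (π.sharp (curry₃ H Z W)) X Y - curry₃ H (N (π.sharp (curry₃ H Z W))) X Y -
        curry₃ H (π.sharp (curry₃ H Z W)) (N X) Y -
        curry₃ H (π.sharp (curry₃ H Z W)) X (N Y) := by
    rw [curry₃_rotate, π.apply_sharp_swap, ← curry₃_rotate (ψ + insertEnd N H),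
      curry₃_add_insertEnd]
    ring
  have hmap : curry₃ H (N (π.sharp (curry₃ H Z W))) X Y =
      -curry₃ H (N (π.sharp (curry₃ H X Y))) Z W := by
    rw [curry₃_rotate, h.apply_map_sharp_swap, ← curry₃_rotate]
  linear_combination htransfer X Y Z W + htransfer Z W X Y - hmap

theorem deform_diff_psi (X Y Z W : B) :
    (A.deform N).diff ψ ![X, Y, Z, W] =
      A.diff (fun U => curry₃ H (N (U 0)) (N (U 1)) (U 2) +
        curry₃ H (U 0) (N (U 1)) (N (U 2)) + curry₃ H (N (U 0)) (U 1) (N (U 2)))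
        ![X, Y, Z, W] := by
  rw [h.diff_psi]
  congr 1
  funext U
  rw [curry₃_rotate H (U 0), ← curry₃_rotate H (N (U 2))]
  rfl

theorem twist_diff_eq_zero (X Y Z W : B) :
    (A.twist π N H).diff (ψ + insertEnd N H) ![X, Y, Z, W] = 0 := by
  have hψ := h.deform_diff_psi X Y Z W
  have hXY := h.closed_H ![N X, N Y, Z, W]
  have hXZ := h.closed_H ![N X, Y, N Z, W]
  have hXW := h.closed_H ![N X, Y, Z, N W]
  have hYZ := h.closed_H ![X, N Y, N Z, W]
  have hYW := h.closed_H ![X, N Y, Z, N W]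
  have hZW := h.closed_H ![X, Y, N Z, N W]
  have hquadXY := h.curry₃_sharp_curry₃_add X Y Z W
  have hquadXZ := h.curry₃_sharp_curry₃_add X Z Y W
  have hquadXW := h.curry₃_sharp_curry₃_add X W Y Z
  have hsharp_mid (η : B [⋀^Fin 3]→ₗ[R] R) (γ : Module.Dual R B) (U V : B) :
      curry₃ η U (π.sharp γ) V = -curry₃ η (π.sharp γ) U V := curry₃_swap_left ..
  have hsharp_right (η : B [⋀^Fin 3]→ₗ[R] R) (γ : Module.Dual R B) (U V : B) :
      curry₃ η U V (π.sharp γ) = curry₃ η (π.sharp γ) U V := (curry₃_rotate ..).symm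
  have hcons_zero (U V T : B) : ![U, V, T] 0 = U := rfl
  have hcons_one (U V T : B) : ![U, V, T] 1 = V := rfl
  have hcons_two (U V T : B) : ![U, V, T] 2 = T := rfl
  simp only [diff_three, ← curry₃_apply, hcons_zero, hcons_one, hcons_two, deform_bracket_apply,
    deform_anchor_apply, curry₃_add_insertEnd, h.map_twist_bracket, twist_anchor_apply]
    at hψ hXY hXZ hXW hYZ hYW hZW ⊢
  simp only [twist_bracket_apply, deform_bracket_apply, map_add, map_sub, LinearMap.add_apply,
    LinearMap.sub_apply, hsharp_mid, hsharp_right] at hψ ⊢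
  linear_combination (norm := abel)
    hψ + hXY + hXZ + hXW + hYZ + hYW + hZW + hquadXY - hquadXZ + hquadXW

theorem koszul_twist_homog_add_insertEnd :
    (A.twist π N H).koszul (homog 3 (ψ + insertEnd N H)) = 0 := by
  refine DFinsupp.ext fun n => ?_
  obtain rfl | hn := eq_or_ne n 4
  · ext v
    obtain ⟨X, Y, Z, W, rfl⟩ : ∃ X Y Z W, v = ![X, Y, Z, W] :=
      ⟨v 0, v 1, v 2, v 3, by ext i; fin_cases i <;> rfl⟩
    rw [koszul_homog_apply, h.twist_diff_eq_zero]
    rfl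
  · exact koszul_homog_apply_of_ne _ hn _

end Closed

theorem isLieQuasiBialgebroid (hA : A.IsLie) (hV : HasLocalFrames R B) :
    IsLieQuasiBialgebroid (A.cotangent π) LinearMap.id (A.twist π N H).koszul
      (ψ + insertEnd N H) where
  isLie := isLie_cotangent hA hV h.poisson
  derivation := isDegreeOneDerivation_koszul _
  bracket := by
    have hdefect := schoutenDefect_eq_zero hV h.schoutenDefect_fn0_fn0
      (h.schoutenDefect_form1_fn0 hA) (h.schoutenDefect_form1_form1 hA hV)
    have hsquare := koszul_koszul_eq_schouten hV (isOdd_homog (by decide) _)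
      (h.koszul_koszul_fn0 hA) (h.koszul_koszul_form1 hA)
    refine ⟨A.schouten π, isSchoutenBracket_schouten A π, fun p P S => ?_,
      LinearMap.congr_fun hsquare⟩
    have hP := LinearMap.congr_fun₂ hdefect (homog p P) S
    rw [schoutenDefect_apply, parity_homog] at hP
    rw [neg_one_pow_real_smul, ← sub_eq_zero]
    refine Eq.trans ?_ hP
    obtain hp | hp := Nat.even_or_odd p
    · rw [hp.neg_one_pow, one_smul, hp.add_one.neg_one_pow, neg_one_smul_eq_neg]
      abel
    · rw [hp.neg_one_pow, neg_one_smul_eq_neg, schouten_neg_left, hp.add_one.neg_one_pow, one_smul]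
      abel
  closed := h.koszul_twist_homog_add_insertEnd

end IsPoissonQuasiNijenhuis

/-! ### Local frames of a vector bundle -/

section LocalFrames

variable {EM : Type*} [NormedAddCommGroup EM] [NormedSpace ℝ EM]
  {M : Type*} [TopologicalSpace M] [ChartedSpace EM M]
  {F : Type*} [NormedAddCommGroup F] [NormedSpace ℝ F]
  {E : M → Type*} [TopologicalSpace (Bundle.TotalSpace F E)]
  [∀ x, AddCommGroup (E x)] [∀ x, Module ℝ (E x)] [∀ x, TopologicalSpace (E x)]
  [FiberBundle F E] [VectorBundle ℝ F E] [ContMDiffVectorBundle ∞ F E 𝓘(ℝ, EM)]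

section Cutoff

variable (e : Bundle.Trivialization F (Bundle.TotalSpace.proj : Bundle.TotalSpace F E → M))
  [MemTrivializationAtlas e] {ι : Type*} (b : Module.Basis ι ℝ F)
  {f : C^∞⟮𝓘(ℝ, EM), M; 𝓘(ℝ), ℝ⟯} (hf : tsupport f ⊆ e.baseSet)

/-- The local frame of the trivialization `e` given by the basis `b`, multiplied by a function
supported in the base set of `e` so that its sections become global. -/
def cutoffFrame (i : ι) : Cₛ^∞⟮𝓘(ℝ, EM); F, E⟯ where
  toFun y := f y • e.localFrame b i y
  contMDiff_toFun := ContMDiffOn.smul_section_of_tsupport f.contMDiff.contMDiffOn e.open_baseSet hf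
    (e.contMDiffOn_localFrame_baseSet ∞ b i)

theorem cutoffFrame_apply (i : ι) (y : M) :
    cutoffFrame e b hf i y = f y • e.localFrame b i y := rfl

variable [FiniteDimensional ℝ F]

/-- The coefficient functionals of the frame of `cutoffFrame`, multiplied by the same cutoff
function. -/
def cutoffCoeff (i : ι) :
    Module.Dual C^∞⟮𝓘(ℝ, EM), M; 𝓘(ℝ), ℝ⟯ Cₛ^∞⟮𝓘(ℝ, EM); F, E⟯ where
  toFun s := ⟨fun y => f y * e.localFrameCoeff 𝓘(ℝ, EM) b i y (s y),
    contMDiff_of_tsupport fun y hy => (f.contMDiff y).mul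
      (contMDiffAt_localFrameCoeff b (hf (tsupport_mul_subset_left hy)) (s.contMDiff y) i)⟩
  map_add' s t := by
    ext y
    change f y * e.localFrameCoeff 𝓘(ℝ, EM) b i y (s y + t y) =
      f y * e.localFrameCoeff 𝓘(ℝ, EM) b i y (s y) +
        f y * e.localFrameCoeff 𝓘(ℝ, EM) b i y (t y)
    rw [map_add, mul_add]
  map_smul' c s := by
    ext y
    change f y * e.localFrameCoeff 𝓘(ℝ, EM) b i y (c y • s y) =
      c y * (f y * e.localFrameCoeff 𝓘(ℝ, EM) b i y (s y))
    rw [map_smul, smul_eq_mul, mul_left_comm]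

theorem cutoffCoeff_apply (i : ι) (s : Cₛ^∞⟮𝓘(ℝ, EM); F, E⟯) (y : M) :
    cutoffCoeff e b hf i s y = f y * e.localFrameCoeff 𝓘(ℝ, EM) b i y (s y) := rfl

theorem mul_self_smul_eq_sum_cutoff [Fintype ι] (s : Cₛ^∞⟮𝓘(ℝ, EM); F, E⟯) :
    (f * f) • s = ∑ i, cutoffCoeff e b hf i s • cutoffFrame e b hf i := by
  ext y
  have hsum : (∑ i, cutoffCoeff e b hf i s • cutoffFrame e b hf i) y =
      ∑ i, cutoffCoeff e b hf i s y • cutoffFrame e b hf i y :=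
    map_sum (⟨⟨fun s => s y, rfl⟩, fun _ _ => rfl⟩ : Cₛ^∞⟮𝓘(ℝ, EM); F, E⟯ →+ E y) _ _
  rw [hsum]
  simp only [cutoffCoeff_apply, cutoffFrame_apply]
  change (f y * f y) • s y = _
  by_cases hy : y ∈ e.baseSet
  · conv_lhs => rw [e.eq_sum_localFrameCoeff_smul (I := 𝓘(ℝ, EM)) (b := b) hy (s := s)]
    rw [Finset.smul_sum]
    refine Finset.sum_congr rfl fun i _ => ?_
    rw [smul_smul, smul_smul, mul_right_comm]
  · have hfy : f y = 0 := image_eq_zero_of_notMem_tsupport fun h => hy (hf h)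
    simp only [hfy, zero_mul, zero_smul, Finset.sum_const_zero]

end Cutoff

variable [FiniteDimensional ℝ EM] [FiniteDimensional ℝ F] [IsManifold 𝓘(ℝ, EM) ∞ M] [T2Space M]

theorem exists_isFrameFunction (x : M) :
    ∃ χ : C^∞⟮𝓘(ℝ, EM), M; 𝓘(ℝ), ℝ⟯,
      IsFrameFunction C^∞⟮𝓘(ℝ, EM), M; 𝓘(ℝ), ℝ⟯ Cₛ^∞⟮𝓘(ℝ, EM); F, E⟯ χ ∧ χ x = 1 := by
  let e := trivializationAt F E x
  obtain ⟨f, -, hf⟩ := (SmoothBumpFunction.nhds_basis_tsupport (I := 𝓘(ℝ, EM)) x).mem_iff.1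
    (e.open_baseSet.mem_nhds (FiberBundle.mem_baseSet_trivializationAt F E x))
  let g : C^∞⟮𝓘(ℝ, EM), M; 𝓘(ℝ), ℝ⟯ := ⟨f, f.contMDiff⟩
  have hg : tsupport g ⊆ e.baseSet := hf
  let b := Module.finBasis ℝ F
  refine ⟨g * g, ⟨_, cutoffFrame e b hg, cutoffCoeff e b hg,
    mul_self_smul_eq_sum_cutoff e b hg⟩, ?_⟩
  change f x * f x = 1
  rw [f.eq_one, one_mul]

theorem hasLocalFrames :
    HasLocalFrames C^∞⟮𝓘(ℝ, EM), M; 𝓘(ℝ), ℝ⟯ Cₛ^∞⟮𝓘(ℝ, EM); F, E⟯ where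
  eq_zero_of_mul r h := by
    ext x
    obtain ⟨χ, hχ, hχx⟩ := exists_isFrameFunction (EM := EM) (F := F) (E := E) x
    have hx : χ x * r x = 0 := DFunLike.congr_fun (h χ hχ) x
    rwa [hχx, one_mul] at hx
  eq_zero_of_smul X h := by
    ext x
    obtain ⟨χ, hχ, hχx⟩ := exists_isFrameFunction (EM := EM) (F := F) (E := E) x
    have hx : χ x • X x = 0 := DFunLike.congr_fun (h χ hχ) x
    rwa [hχx, one_smul] at hx

end LocalFrames

theorem mainTheorem1_general {R B : Type*} [CommRing R] [Algebra ℝ R] [AddCommGroup B] [Module R B]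
    [Module ℝ B] [IsScalarTower ℝ R B] (hV : HasLocalFrames R B) (A : AlmostLieAlgebroid R B)
    (hA : A.IsLie) (π : Bivector R B) (N : B →ₗ[R] B) (ψ H : B [⋀^Fin 3]→ₗ[R] R)
    (h : IsPoissonQuasiNijenhuis A π N ψ H) :
    ∃ δ : ExtForms R B →ₗ[ℝ] ExtForms R B,
      IsTwistedDifferential A π N H δ ∧
      IsLieQuasiBialgebroid (A.cotangent π) LinearMap.id δ (ψ + insertEnd N H) :=
  ⟨(A.twist π N H).koszul, A.isTwistedDifferential_koszul π N H, h.isLieQuasiBialgebroid hA hV⟩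

end

theorem mainTheorem1
    {EM : Type*} [NormedAddCommGroup EM] [NormedSpace ℝ EM] [FiniteDimensional ℝ EM]
    {M : Type*} [TopologicalSpace M] [ChartedSpace EM M] [IsManifold 𝓘(ℝ, EM) ∞ M]
    [T2Space M] [SigmaCompactSpace M]
    {F : Type*} [NormedAddCommGroup F] [NormedSpace ℝ F] [FiniteDimensional ℝ F]
    {E : M → Type*} [TopologicalSpace (Bundle.TotalSpace F E)]
    [∀ x, AddCommGroup (E x)] [∀ x, Module ℝ (E x)] [∀ x, TopologicalSpace (E x)]
    [FiberBundle F E] [VectorBundle ℝ F E] [ContMDiffVectorBundle ∞ F E 𝓘(ℝ, EM)]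
    (A : AlmostLieAlgebroid C^∞⟮𝓘(ℝ, EM), M; 𝓘(ℝ), ℝ⟯ Cₛ^∞⟮𝓘(ℝ, EM); F, E⟯)
    (hA : A.IsLie)
    (π : Bivector C^∞⟮𝓘(ℝ, EM), M; 𝓘(ℝ), ℝ⟯ Cₛ^∞⟮𝓘(ℝ, EM); F, E⟯)
    (N : Cₛ^∞⟮𝓘(ℝ, EM); F, E⟯ →ₗ[C^∞⟮𝓘(ℝ, EM), M; 𝓘(ℝ), ℝ⟯] Cₛ^∞⟮𝓘(ℝ, EM); F, E⟯)
    (ψ H : Cₛ^∞⟮𝓘(ℝ, EM); F, E⟯ [⋀^Fin 3]→ₗ[C^∞⟮𝓘(ℝ, EM), M; 𝓘(ℝ), ℝ⟯]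
      C^∞⟮𝓘(ℝ, EM), M; 𝓘(ℝ), ℝ⟯)
    (h : IsPoissonQuasiNijenhuis A π N ψ H) :
    ∃ δ : ExtForms C^∞⟮𝓘(ℝ, EM), M; 𝓘(ℝ), ℝ⟯ Cₛ^∞⟮𝓘(ℝ, EM); F, E⟯ →ₗ[ℝ]
        ExtForms C^∞⟮𝓘(ℝ, EM), M; 𝓘(ℝ), ℝ⟯ Cₛ^∞⟮𝓘(ℝ, EM); F, E⟯,
      IsTwistedDifferential A π N H δ ∧
      IsLieQuasiBialgebroid (A.cotangent π) LinearMap.id δ (ψ + insertEnd N H) :=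
  mainTheorem1_general hasLocalFrames A hA π N ψ H h
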